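/- **Setting.** Let $d\in\{2,3\}$, $T>0$, $\delta t>0$, $N=\lfloor T/\delta t\rfloor$, $\gamma\ge1$, $\mu>0$, $\mu+\lambda>0$ and $\wp(\rho)=\rho^\gamma$. Let $\Omega\subset\mathbb R^d$ be an open box, with a fixed, possibly non-uniform, rectangular MAC mesh: cells $K\in\mathcal M$, and internal faces $\sigma=K|L\in\mathcal E^{(i)}_{\rm int}$ orthogonal to the $i$-th basis vector $e^{(i)}$. Scalar unknowns $\rho_K,p_K$ are attached to the cells, and the $i$-th velocity component $u_{\sigma,i}$ to the faces of $\mathcal E^{(i)}_{\rm int}$; velocities vanish on external faces. Let $n_{K,\sigma}$ be the normal to $\sigma$ outward $K$, $u_{K,\sigma}=u_{\sigma,i}\,n_{K,\sigma}\cdot e^{(i)}$, and let $D_\sigma=D_{K,\sigma}\cup D_{L,\sigma}$ be the dual cell of $\sigma=K|L$, $D_{K,\sigma}$ being the half of $K$ adjacent to $\sigma$. Define: * $F_{K,\sigma}(\rho,u)=|\sigma|\,\rho_\sigma\,u_{K,\sigma}$ with $\rho_\sigma=\rho_K$ if $u_{K,\sigma}\ge0$ and $\rho_\sigma=\rho_L$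 otherwise ($F_{K,\sigma}=0$ on external faces), $\mathrm{div}(\rho u)_K=|K|^{-1}\sum_{\sigma\subset\partial K}F_{K,\sigma}(\rho,u)$, $(\mathrm{div}\,u)_K=\mathrm{div}(1\times u)_K$; * $(\nabla p)_{\sigma,i}=\frac{|\sigma|}{|D_\sigma|}(p_L-p_K)\,n_{K,\sigma}\cdot e^{(i)}$ and $|D_\sigma|\rho_{D_\sigma}=|D_{K,\sigma}|\rho_K+|D_{L,\sigma}|\rho_L$; * $\mathrm{div}(\rho v_iu)_\sigma=|D_\sigma|^{-1}\sum_{\epsilon\subset\partial D_\sigma}F_{\sigma,\epsilon}(\rho,u)\,v_{\epsilon,i}$ with centered values $v_{\epsilon,i}=\frac12(v_{\sigma,i}+v_{\sigma',i})$ at $\epsilon=D_\sigma|D_{\sigma'}$, where the flux $F_{\sigma,\epsilon}$ outward $D_\sigma$ is half the sum of the mass fluxes, oriented as the outward normal of $D_\sigma$ at $\epsilon$, through the two faces of $K$ orthogonal to $e^{(i)}$ if $\epsilon\subset K$ is orthogonal to $e^{(i)}$ (and likewise for $L$), and through the two primal faces, one of $K$ and one of $L$, whose halves make up $\epsilon$,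 if $\epsilon$ is parallel to $e^{(i)}$ (so it is zero if $\epsilon\subset\partial\Omega$); * $\mathrm{div}\,\tau(v)_{\sigma,i}=\mu(\Delta v)_{\sigma,i}+(\mu+\lambda)(\nabla\,\mathrm{div}\,v)_{\sigma,i}$, where $(\Delta v)_{\sigma,i}=|D_\sigma|^{-1}\sum_{\epsilon\subset\partial D_\sigma}\frac{|\epsilon|}{d_\epsilon}(v_{\sigma',i}-v_{\sigma,i})$ for $\epsilon=D_\sigma|D_{\sigma'}$, $d_\epsilon$ being the distance between the centres of $\sigma$ and $\sigma'$; if $\epsilon\subset\partial\Omega$ one takes $v_{\sigma',i}=0$ and $d_\epsilon$ is the distance from the centre of $\sigma$ to $\epsilon$. **Compressible scheme.** For a Mach number $\mathrm{Ma}>0$ and data $(\rho_0,u_0)$, put $\rho^0_K=\frac1{|K|}\int_K\rho_0$, $u^0_{\sigma,i}=\frac1{|\sigma|}\int_\sigma u_0\cdot e^{(i)}$ (in the sense of traces), and let $\rho^{-1}$ be given by $\frac1{\delta t}(\rho^0_K-\rho^{-1}_K)+\mathrm{div}(\rho^0u^0)_K=0$. A solution $(\rho,u)$ consists of $(\rho^n,u^n)_{0\le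 n\le N}$ such that, for $0\le n<N$ and some $\tilde u^{n+1}$, with $p^n=\wp(\rho^n)$ and $(\overline{\nabla p})^n_{\sigma,i}=(\rho^n_{D_\sigma}/\rho^{n-1}_{D_\sigma})^{1/2}(\nabla p^n)_{\sigma,i}$, for all $i$, $\sigma\in\mathcal E^{(i)}_{\rm int}$ and $K\in\mathcal M$, $$\tfrac1{\delta t}(\rho^n_{D_\sigma}\tilde u^{n+1}_{\sigma,i}-\rho^{n-1}_{D_\sigma}u^n_{\sigma,i})+\mathrm{div}(\rho^n\tilde u^{n+1}_iu^n)_\sigma-\mathrm{div}\,\tau(\tilde u^{n+1})_{\sigma,i}+\tfrac1{\mathrm{Ma}^2}(\overline{\nabla p})^n_{\sigma,i}=0,$$ $$\tfrac1{\delta t}\rho^n_{D_\sigma}(u^{n+1}_{\sigma,i}-\tilde u^{n+1}_{\sigma,i})+\tfrac1{\mathrm{Ma}^2}(\nabla p^{n+1})_{\sigma,i}-\tfrac1{\mathrm{Ma}^2}(\overline{\nabla p})^n_{\sigma,i}=0,$$ $$\tfrac1{\delta t}(\rho^{n+1}_K-\rho^n_K)+\mathrm{div}(\rho^{n+1}u^{n+1})_K=0.$$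 Put $\delta p^n_K=\mathrm{Ma}^{-2}\bigl(p^n_K-|\Omega|^{-1}\int_\Omega p^n\bigr)$. The discrete density is also regarded as the function equal to $\rho^n_K$ on $[n\delta t,(n+1)\delta t)\times K$. **Incompressible scheme** with initial data $(V^0,P^0)$: find $(u^n,\delta p^n)_{0\le n\le N}$ with $u^0=V^0$, $\delta p^0=P^0$, $\int_\Omega\delta p^n=0$ for all $n\le N$, and, for $0\le n<N$ and some $\tilde u^{n+1}$, $$\tfrac1{\delta t}(\tilde u^{n+1}_{\sigma,i}-u^n_{\sigma,i})+\mathrm{div}(\tilde u^{n+1}_iu^n)_\sigma-\mathrm{div}\,\tau(\tilde u^{n+1})_{\sigma,i}+(\nabla\delta p^n)_{\sigma,i}=0,$$ $$\tfrac1{\delta t}(u^{n+1}_{\sigma,i}-\tilde u^{n+1}_{\sigma,i})+(\nabla\delta p^{n+1})_{\sigma,i}-(\nabla\delta p^n)_{\sigma,i}=0,\qquad(\mathrm{div}\,u^{n+1})_K=0.$$ **Theorem.** Let $\mathrm{Ma}_m>0$, $\mathrm{Ma}_m\to0$, and let the initial data $\rho_{0,m}\in L^\infty(\Omega)$, $\rho_{0,m}>0$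 a.e., $u_{0,m}\in H^1_0(\Omega)^d$ be well prepared: for some $C$ and all $m$, $$\|u_{0,m}\|_{H^1(\Omega)^d}+\tfrac1{\mathrm{Ma}_m}\|\mathrm{div}\,u_{0,m}\|_{L^2(\Omega)}+\tfrac1{\mathrm{Ma}_m^2}\|\rho_{0,m}-1\|_{L^\infty(\Omega)}\le C,$$ and $u_{0,m}\to\bar u_0$ in $L^2(\Omega)^d$. Let $(\rho_m,u_m)$ be corresponding solutions of the compressible scheme. Then: 1. $\rho_m\to1$ in $L^\infty(0,T;L^q(\Omega))$ for every $q\in[1,\min(\gamma,2)]$. 2. $\bar u_0\in H^1_0(\Omega)^d$, and the field $V^0$ of its face means satisfies $(\mathrm{div}\,V^0)_K=0$ for all $K$. If the initial scaled pressure deviations $\delta p^0_m$ (which are determined by $\rho_{0,m}$) converge to some $P^0$, then the incompressible scheme with initial data $(V^0,P^0)$ has exactly one solution $(u,\delta p)$, and $(u_m^n,\delta p_m^n)_{0\le n\le N}\to(u^n,\delta p^n)_{0\le n\le N}$ in any norm on the space of discrete functions. 3. In general, every subsequence has a further subsequence along which $\delta p^0_m$ converges, and the conclusion of 2 holds along every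 subsequence for which $\delta p^0_m$ converges, $P^0$ being the limit along that subsequence. -/

import Mathlib

open MeasureTheory Filter Topology
open scoped ENNReal ContDiff

noncomputable section

/-! ### Sobolev data on an open set of `ℝ^d` -/

/-- The partial derivative `∂_j φ`. -/
def partialDeriv {d : ℕ} (j : Fin d) (φ : (Fin d → ℝ) → ℝ) (y : Fin d → ℝ) : ℝ :=
  fderiv ℝ φ y (Pi.single j 1)

/-- `φ_k ∈ C_c^∞(Ω)`, `φ_k → f` in `L²(Ω)` and `∂_j φ_k → g_j` in `L²(Ω)` for every `j`,
that is, `φ_k → f` in `H¹(Ω)`, the weak gradient of `f` being `g`. -/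
structure IsH10Approx {d : ℕ} (Ω : Set (Fin d → ℝ)) (f : (Fin d → ℝ) → ℝ)
    (g : Fin d → (Fin d → ℝ) → ℝ) (φ : ℕ → (Fin d → ℝ) → ℝ) : Prop where
  smooth : ∀ k, ContDiff ℝ ∞ (φ k)
  compactSupport : ∀ k, HasCompactSupport (φ k)
  support_subset : ∀ k, tsupport (φ k) ⊆ Ω
  tendsto_val : Tendsto (fun k => eLpNorm (fun y => φ k y - f y) 2 (volume.restrict Ω))
    atTop (𝓝 0)
  tendsto_grad : ∀ j, Tendsto
    (fun k => eLpNorm (fun y => partialDeriv j (φ k) y - g j y) 2 (volume.restrict Ω))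
    atTop (𝓝 0)

/-- `f ∈ H¹₀(Ω)` (the closure of `C_c^∞(Ω)` in `H¹(Ω)`), with weak gradient `g ∈ L²(Ω)^d`. -/
structure HasH10Grad {d : ℕ} (Ω : Set (Fin d → ℝ)) (f : (Fin d → ℝ) → ℝ)
    (g : Fin d → (Fin d → ℝ) → ℝ) : Prop where
  memLp_val : MemLp f 2 (volume.restrict Ω)
  memLp_grad : ∀ j, MemLp (g j) 2 (volume.restrict Ω)
  approx : ∃ φ, IsH10Approx Ω f g φ

/-- The `L²(Ω)` norm. -/
def l2Norm {d : ℕ} (Ω : Set (Fin d → ℝ)) (f : (Fin d → ℝ) → ℝ) : ℝ :=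
  (eLpNorm f 2 (volume.restrict Ω)).toReal

/-- The `H¹(Ω)^d` norm of the vector field `(f_1, …, f_d)` with weak gradients `g i = ∇ f_i`. -/
def h1Norm {d : ℕ} (Ω : Set (Fin d → ℝ)) (f : Fin d → (Fin d → ℝ) → ℝ)
    (g : Fin d → Fin d → (Fin d → ℝ) → ℝ) : ℝ :=
  Real.sqrt (∑ i, (l2Norm Ω (f i) ^ 2 + ∑ j, l2Norm Ω (g i j) ^ 2))

/-- Well-prepared initial data for the Mach number `Ma`, with constant `C`;
`Gu₀ i` is the weak gradient of the `i`-th component of `u₀`. -/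
structure WellPrepared {d : ℕ} (Ω : Set (Fin d → ℝ)) (Ma C : ℝ) (ρ₀ : (Fin d → ℝ) → ℝ)
    (u₀ : Fin d → (Fin d → ℝ) → ℝ) (Gu₀ : Fin d → Fin d → (Fin d → ℝ) → ℝ) : Prop where
  density_memLp : MemLp ρ₀ ∞ (volume.restrict Ω)
  density_pos : ∀ᵐ y ∂(volume.restrict Ω), 0 < ρ₀ y
  velocity_h10 : ∀ i, HasH10Grad Ω (u₀ i) (Gu₀ i)
  bound : h1Norm Ω u₀ Gu₀ + (1 / Ma) * l2Norm Ω (fun y => ∑ i, Gu₀ i i y)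
    + (1 / Ma ^ 2) * (eLpNorm (fun y => ρ₀ y - 1) ∞ (volume.restrict Ω)).toReal ≤ C

/-! ### MAC meshes and discrete fields -/

/-- A (possibly non-uniform) MAC mesh of a box of `ℝ^d`: in the direction `j` there are `n j`
layers of cells, separated by the abscissae `x j 0 < x j 1 < ⋯ < x j (n j)`
(the other values of `x j` play no role). -/
structure MACMesh (d : ℕ) where
  n : Fin d → ℕ
  n_pos : ∀ j, 0 < n j
  x : Fin d → ℤ → ℝ
  x_lt : ∀ j (k : ℤ), 0 ≤ k → k < n j → x j k < x j (k + 1)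

namespace MACMesh

variable {d : ℕ} (M : MACMesh d)

/-- The domain `Ω`. -/
def domain : Set (Fin d → ℝ) := Set.pi Set.univ fun j => Set.Ioo (M.x j 0) (M.x j (M.n j))

/-- Multi-indices of the primal cells: cell `k` is `∏_j (x j (k j), x j (k j + 1))`. -/
def cells : Finset (Fin d → ℤ) := Fintype.piFinset fun j => Finset.Ico (0 : ℤ) (M.n j)

/-- The shift by one in the direction `j`. -/
def e (j : Fin d) : Fin d → ℤ := Pi.single j 1

/-- Internal faces orthogonal to the `i`-th basis vector. The index `k` stands for the face
`K|L` common to the cell `K` of index `k` and to the next cell `L`, of index `k + e i`. -/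
def faces (i : Fin d) : Finset (Fin d → ℤ) := M.cells.filter fun k => k i + 1 < M.n i

/-- Discrete scalar fields (densities, pressures): one value per cell. -/
abbrev CellField : Type := M.cells → ℝ

/-- Discrete velocity fields: one value per internal face; the values at external faces are
zero (see `fv`). -/
abbrev FaceField : Type := (i : Fin d) → M.faces i → ℝ

variable {M} in
/-- The value of a cell field at the cell of index `k` (zero if there is no such cell). -/
def cv (p : M.CellField) (k : Fin d → ℤ) : ℝ := if h : k ∈ M.cells then p ⟨k, h⟩ else 0

variable {M} in
/-- The value of the `i`-th velocity component at the face of index `k`: this is the degree of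
freedom at an internal face, and zero otherwise; in particular it is zero at the external faces
(the upper ones, `k i = n i - 1`, and the lower ones, `k i = -1`). -/
def fv (u : M.FaceField) (i : Fin d) (k : Fin d → ℤ) : ℝ :=
  if h : k ∈ M.faces i then u i ⟨k, h⟩ else 0

/-- The width in the direction `j` of the cells of index `k`, and zero outside the domain. -/
def width (j : Fin d) (k : Fin d → ℤ) : ℝ :=
  if 0 ≤ k j ∧ k j < M.n j then M.x j (k j + 1) - M.x j (k j) else 0

/-- The measure `|K|`. -/
def vol (k : Fin d → ℤ) : ℝ := ∏ j, M.width j k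

/-- The measure `|σ|` of the faces of the cell `k` orthogonal to the direction `i`. -/
def area (i : Fin d) (k : Fin d → ℤ) : ℝ := ∏ j ∈ Finset.univ.erase i, M.width j k

/-- The measure `|D_σ| = |D_{K,σ}| + |D_{L,σ}|` of the dual cell of the internal face
`σ = K|L`, where `D_{K,σ}` is the half of `K` adjacent to `σ`. -/
def dualVol (i : Fin d) (k : Fin d → ℤ) : ℝ := M.vol k / 2 + M.vol (k + e i) / 2

/-! ### Discrete operators -/

variable {M}

/-- The upwind mass flux through the upper face of the cell `k` in the direction `i`, counted
positively in the direction `+ e_i`. It vanishes at external faces. It is the flux outward `K`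
for the lower cell `K`, and the opposite of the flux outward `L` for the upper cell `L`. -/
def massFlux (ρ : M.CellField) (u : M.FaceField) (i : Fin d) (k : Fin d → ℤ) : ℝ :=
  M.area i k * (if 0 ≤ fv u i k then cv ρ k else cv ρ (k + e i)) * fv u i k

/-- The discrete divergence `div(ρ u)_K`. -/
def divMass (ρ : M.CellField) (u : M.FaceField) (k : Fin d → ℤ) : ℝ :=
  (1 / M.vol k) * ∑ i, (massFlux ρ u i k - massFlux ρ u i (k - e i))

/-- The discrete divergence `(div u)_K = div(1 × u)_K`. -/
def divVel (u : M.FaceField) : M.CellField := fun k => divMass (fun _ => 1) u k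

/-- The discrete gradient `(∇ p)_{σ,i}` of a cell field. -/
def grad (p : M.CellField) (i : Fin d) (k : Fin d → ℤ) : ℝ :=
  M.area i k / M.dualVol i k * (cv p (k + e i) - cv p k)

/-- The density `ρ_{D_σ}` on the dual cell. -/
def dualDensity (ρ : M.CellField) (i : Fin d) (k : Fin d → ℤ) : ℝ :=
  (M.vol k / 2 * cv ρ k + M.vol (k + e i) / 2 * cv ρ (k + e i)) / M.dualVol i k

/-- The mass flux, counted positively in the direction `+ e_j`, through the upper face in the
direction `j` of the dual cell `D_σ`, `σ = K|L` being the face of index `k` orthogonal to `e_i`.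
For `j ≠ i` the dual face is the union of the halves of the upper faces of `K` and `L` in the
direction `j`; for `j = i` it is the median section of `L`, and the fluxes are those at the
lower and at the upper face of `L`. In both cases one takes the half sum. The lower dual face
of `D_σ` in the direction `j` has the index `k - e j`. -/
def dualFlux (ρ : M.CellField) (u : M.FaceField) (i j : Fin d) (k : Fin d → ℤ) : ℝ :=
  (massFlux ρ u j k + massFlux ρ u j (k + e i)) / 2

/-- The centered approximation of the `i`-th component of `v` at the upper face in the
direction `j` of the dual cell of index `k`. -/
def dualFaceVal (v : M.FaceField) (i j : Fin d) (k : Fin d → ℤ) : ℝ :=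
  (fv v i k + fv v i (k + e j)) / 2

/-- The velocity convection operator `div(ρ v_i u)_σ`. -/
def conv (ρ : M.CellField) (v u : M.FaceField) (i : Fin d) (k : Fin d → ℤ) : ℝ :=
  (1 / M.dualVol i k) * ∑ j, (dualFlux ρ u i j k * dualFaceVal v i j k
    - dualFlux ρ u i j (k - e j) * dualFaceVal v i j (k - e j))

variable (M) in
/-- The measure of the upper face in the direction `j` of the dual cell of index `k`. -/
def dualArea (i j : Fin d) (k : Fin d → ℤ) : ℝ := (M.area j k + M.area j (k + e i)) / 2

variable (M) in
/-- The distance between the centres of the two velocity faces (orthogonal to `e_i`, of indices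
`k` and `k + e j`) on both sides of a dual face. For `j ≠ i`, if the dual face lies on the
boundary of the domain, it is the distance from the only face centre to the boundary, since one
of the two widths is then zero. -/
def dualDist (i j : Fin d) (k : Fin d → ℤ) : ℝ :=
  if j = i then M.width i (k + e i) else (M.width j k + M.width j (k + e j)) / 2

/-- The two-point diffusion flux through the upper dual face in the direction `j`. -/
def diffFlux (v : M.FaceField) (i j : Fin d) (k : Fin d → ℤ) : ℝ :=
  M.dualArea i j k / M.dualDist i j k * (fv v i (k + e j) - fv v i k)

/-- The MAC discrete Laplacian `(Δ v)_{σ,i}` with homogeneous Dirichlet conditions. -/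
def laplacian (v : M.FaceField) (i : Fin d) (k : Fin d → ℤ) : ℝ :=
  (1 / M.dualVol i k) * ∑ j, (diffFlux v i j k - diffFlux v i j (k - e j))

/-- The discrete diffusion term `div τ(v)_{σ,i}`, with
`div τ(v) = μ Δ v + (μ + lam) ∇ div v`. -/
def divTau (μ lam : ℝ) (v : M.FaceField) (i : Fin d) (k : Fin d → ℤ) : ℝ :=
  μ * laplacian v i k + (μ + lam) * grad (divVel v) i k

/-- The pressure field `℘(ρ) = ρ^γ`. -/
def pressure (γ : ℝ) (ρ : M.CellField) : M.CellField := fun k => ρ k ^ γ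

/-- The integral of a cell field over `Ω`. -/
def integral (p : M.CellField) : ℝ := ∑ k : M.cells, M.vol k * p k

/-- The scaled pressure deviation `δp = (p - |Ω|⁻¹ ∫_Ω p) / Ma²`, `p = ℘(ρ)`. -/
def deltaP (γ Ma : ℝ) (ρ : M.CellField) : M.CellField := fun k =>
  (pressure γ ρ k - (∑ k : M.cells, M.vol k)⁻¹ * integral (pressure γ ρ)) / Ma ^ 2

/-! ### Initialization -/

variable (M) in
/-- The open cell of index `k`, as a subset of `ℝ^d`. -/
def cellBox (k : Fin d → ℤ) : Set (Fin d → ℝ) :=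
  Set.pi Set.univ fun j => Set.Ioo (M.x j (k j)) (M.x j (k j + 1))

variable (M) in
/-- The mean value of `φ` over the internal face of index `k` orthogonal to `e_i`, for the
`(d-1)`-dimensional Lebesgue measure of the hyperplane `y_i = x i (k i + 1)`. -/
def smoothFaceMean (φ : (Fin d → ℝ) → ℝ) (i : Fin d) (k : Fin d → ℤ) : ℝ :=
  ⨍ z in (Set.pi Set.univ fun j : {j : Fin d // j ≠ i} =>
      Set.Ioo (M.x j (k j)) (M.x j (k j + 1)) : Set ({j : Fin d // j ≠ i} → ℝ)),
    φ (fun j => if h : j = i then M.x i (k i + 1) else z ⟨j, h⟩)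

variable (M) in
/-- `f ∈ H¹₀(Ω)` and `c` is the mean value of (the trace of) `f` over the internal face of index
`k` orthogonal to `e_i`. The trace is the continuous extension to `H¹₀(Ω)` of the restriction
of functions of `C_c^∞(Ω)`. -/
def IsFaceMean (f : (Fin d → ℝ) → ℝ) (i : Fin d) (k : Fin d → ℤ) (c : ℝ) : Prop :=
  ∃ g, HasH10Grad M.domain f g ∧ ∃ φ, IsH10Approx M.domain f g φ ∧
    Tendsto (fun l => M.smoothFaceMean (φ l) i k) atTop (𝓝 c)

/-- `U` is the field of the face mean values of the components of the vector field `f`. -/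
def IsFaceInterpolate (f : Fin d → (Fin d → ℝ) → ℝ) (U : M.FaceField) : Prop :=
  ∀ i (k : M.faces i), M.IsFaceMean (f i) i k (U i k)

/-! ### The schemes -/

/-- `(ρ^n)_{-1 ≤ n ≤ N}`, `(u^n)_{0 ≤ n ≤ N}`, with predicted velocities `(w^n)_{1 ≤ n ≤ N}`,
is a solution of the compressible pressure correction scheme for the initial data `(ρ₀, u₀)`.
-/
structure IsCompressibleSol (γ μ lam δt Ma : ℝ) (N : ℕ) (ρ₀ : (Fin d → ℝ) → ℝ)
    (u₀ : Fin d → (Fin d → ℝ) → ℝ) (ρ : ℤ → M.CellField) (u w : ℕ → M.FaceField) : Prop where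
  init_density : ∀ k : M.cells, ρ 0 k = ⨍ y in M.cellBox k, ρ₀ y
  init_velocity : IsFaceInterpolate u₀ (u 0)
  /-- backward mass balance, which defines `ρ^{-1}` -/
  init_backward : ∀ k : M.cells,
    (1 / δt) * (ρ 0 k - ρ (-1) k) + divMass (ρ 0) (u 0) k = 0
  /-- prediction step, with the scaled pressure gradient
  `(ρ^n_{D_σ} / ρ^{n-1}_{D_σ})^{1/2} (∇ p^n)_{σ,i}` -/
  prediction : ∀ n : ℕ, n < N → ∀ i (k : M.faces i),
    (1 / δt) * (dualDensity (ρ n) i k * w (n + 1) i k - dualDensity (ρ (n - 1)) i k * u n i k)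
      + conv (ρ n) (w (n + 1)) (u n) i k
      - divTau μ lam (w (n + 1)) i k
      + (1 / Ma ^ 2) * (Real.sqrt (dualDensity (ρ n) i k / dualDensity (ρ (n - 1)) i k)
          * grad (pressure γ (ρ n)) i k) = 0
  correction : ∀ n : ℕ, n < N → ∀ i (k : M.faces i),
    (1 / δt) * dualDensity (ρ n) i k * (u (n + 1) i k - w (n + 1) i k)
      + (1 / Ma ^ 2) * grad (pressure γ (ρ (n + 1))) i k
      - (1 / Ma ^ 2) * (Real.sqrt (dualDensity (ρ n) i k / dualDensity (ρ (n - 1)) i k)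
          * grad (pressure γ (ρ n)) i k) = 0
  mass : ∀ n : ℕ, n < N → ∀ k : M.cells,
    (1 / δt) * (ρ (n + 1) k - ρ n k) + divMass (ρ (n + 1)) (u (n + 1)) k = 0

/-- `(v^n, π^n)_{0 ≤ n ≤ N}`, with predicted velocities `(w^n)_{1 ≤ n ≤ N}`, is a solution of
the incompressible pressure correction scheme starting from `(v⁰, π⁰) = (V₀, P₀)`; pressures
have a zero mean value. -/
structure IsIncompressibleSol (μ lam δt : ℝ) (N : ℕ) (V₀ : M.FaceField) (P₀ : M.CellField)
    (v w : ℕ → M.FaceField) (π : ℕ → M.CellField) : Prop where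
  init_velocity : v 0 = V₀
  init_pressure : π 0 = P₀
  mean_zero : ∀ n : ℕ, n ≤ N → integral (π n) = 0
  prediction : ∀ n : ℕ, n < N → ∀ i (k : M.faces i),
    (1 / δt) * (w (n + 1) i k - v n i k)
      + conv (fun _ => 1) (w (n + 1)) (v n) i k
      - divTau μ lam (w (n + 1)) i k
      + grad (π n) i k = 0
  correction : ∀ n : ℕ, n < N → ∀ i (k : M.faces i),
    (1 / δt) * (v (n + 1) i k - w (n + 1) i k)
      + grad (π (n + 1)) i k - grad (π n) i k = 0
  div_free : ∀ n : ℕ, n < N → ∀ k : M.cells, divVel (v (n + 1)) k = 0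

/-! ### The discrete density as a function of time and space -/

/-- The function of space, constant over each cell, associated with a cell field. -/
def cellFun (p : M.CellField) (y : Fin d → ℝ) : ℝ :=
  ∑ k : M.cells, (M.cellBox k).indicator (fun _ => p k) y

/-- The discrete density as a function of `(t, y)`: it is equal to `ρ^n_K` for
`t ∈ [n δt, (n + 1) δt)` and `y ∈ K`. -/
def densityFun (δt : ℝ) (ρ : ℤ → M.CellField) (t : ℝ) (y : Fin d → ℝ) : ℝ :=
  cellFun (ρ ⌊t / δt⌋) y

end MACMesh

end

/-!
At a fixed mesh and time step the discrete energy (kinetic energy, convex elastic potential of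
the pressure divided by `Ma²`, and the square of the scaled pressure gradient) does not increase
from one step to the next: the convection operator is compatible with the mass balance of the
dual cells, so the discrete kinetic energy identity holds; the diffusion is dissipative; and
`-div` and `∇` are dual to each other. Well-prepared data have an initial energy bounded
uniformly in `Ma`. Hence `ρ → 1`, and the velocities and the pressure deviations `δp` are bounded,
since a cell field of zero mean is controlled by its gradient. The space of discrete fields being
finite-dimensional, subsequences converge, and their limits solve the incompressible scheme. For
that scheme prediction is a coercive linear problem and correction an orthogonal projection, so
its solution is unique and the whole sequence converges.

The mean of the trace of `f ∈ H¹₀` over a face is an integral of `f` and `∂ᵢf` over a slab of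
thickness `ε` adjacent to that face. With bounded gradients the contribution of `∂ᵢf` is
`O(√ε)`, so face means are continuous for the convergence in `L²`. The weak gradients are
bounded in `L²`, and convex combinations of them converge strongly, so the limit stays in `H¹₀`.
-/

lemma sum_sub_translate_mul {G R : Type*} [AddCommGroup G] [DecidableEq G]
    [NonUnitalNonAssocRing R] (S : Finset G) (e : G) (A z : G → R) (hz : ∀ k ∉ S, z k = 0) :
    ∑ k ∈ S, (A k - A (k - e)) * z k
      = ∑ k ∈ S ∪ S.image (fun k => k - e), A k * (z k - z (k + e)) := by
  have unshifted : ∑ k ∈ S, A k * z k = ∑ k ∈ S ∪ S.image (fun k => k - e), A k * z k :=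
    Finset.sum_subset Finset.subset_union_left fun k _ hk => by rw [hz k hk, mul_zero]
  have shifted : ∑ k ∈ S, A (k - e) * z k
      = ∑ k ∈ S ∪ S.image (fun k => k - e), A k * z (k + e) := by
    calc ∑ k ∈ S, A (k - e) * z k
        = ∑ k ∈ S.image (fun k => k - e), A k * z (k + e) := by
          rw [Finset.sum_image sub_left_injective.injOn]
          simp only [sub_add_cancel]
      _ = _ := Finset.sum_subset Finset.subset_union_right fun k _ hk => by
          rw [hz (k + e) fun hS => hk (Finset.mem_image.2 ⟨k + e, hS, add_sub_cancel_right k e⟩),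
            mul_zero]
  simp only [mul_sub, sub_mul, Finset.sum_sub_distrib]
  rw [unshifted, shifted]

namespace MACMesh

variable {d : ℕ} {M : MACMesh d}

/-! ### Cells and faces -/

lemma mem_cells {k : Fin d → ℤ} : k ∈ M.cells ↔ ∀ j, 0 ≤ k j ∧ k j < M.n j := by
  simp [cells, Fintype.mem_piFinset]

lemma zero_mem_cells : (0 : Fin d → ℤ) ∈ M.cells :=
  mem_cells.2 fun j => ⟨le_rfl, by simpa using M.n_pos j⟩

lemma add_e_apply_self (k : Fin d → ℤ) (i : Fin d) : (k + e i) i = k i + 1 := by simp [e]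

lemma add_e_apply_of_ne (k : Fin d → ℤ) {i j : Fin d} (h : j ≠ i) : (k + e i) j = k j := by
  simp [e, h]

lemma sub_e_apply_self (k : Fin d → ℤ) (i : Fin d) : (k - e i) i = k i - 1 := by simp [e]

lemma sub_e_apply_of_ne (k : Fin d → ℤ) {i j : Fin d} (h : j ≠ i) : (k - e i) j = k j := by
  simp [e, h]

lemma mem_faces {i : Fin d} {k : Fin d → ℤ} :
    k ∈ M.faces i ↔ k ∈ M.cells ∧ k + e i ∈ M.cells := by
  rw [faces, Finset.mem_filter]
  refine and_congr_right fun hk => ?_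
  simp only [mem_cells] at hk ⊢
  refine ⟨fun h j => ?_, fun h => by simpa only [add_e_apply_self] using (h i).2⟩
  obtain rfl | hj := eq_or_ne j i
  · rw [add_e_apply_self]
    exact ⟨by linarith [(hk j).1], h⟩
  · rw [add_e_apply_of_ne k hj]
    exact hk j

lemma mem_cells_of_mem_faces {i : Fin d} {k : Fin d → ℤ} (h : k ∈ M.faces i) : k ∈ M.cells :=
  (mem_faces.1 h).1

lemma add_e_mem_cells {i : Fin d} {k : Fin d → ℤ} (h : k ∈ M.faces i) : k + e i ∈ M.cells :=
  (mem_faces.1 h).2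

lemma cv_of_mem (p : M.CellField) {k : Fin d → ℤ} (h : k ∈ M.cells) : cv p k = p ⟨k, h⟩ :=
  dif_pos h

lemma cv_of_notMem (p : M.CellField) {k : Fin d → ℤ} (h : k ∉ M.cells) : cv p k = 0 :=
  dif_neg h

lemma fv_of_mem (u : M.FaceField) {i : Fin d} {k : Fin d → ℤ} (h : k ∈ M.faces i) :
    fv u i k = u i ⟨k, h⟩ :=
  dif_pos h

lemma fv_of_notMem (u : M.FaceField) {i : Fin d} {k : Fin d → ℤ} (h : k ∉ M.faces i) :
    fv u i k = 0 :=
  dif_neg h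

lemma width_of_mem {j : Fin d} {k : Fin d → ℤ} (h : 0 ≤ k j ∧ k j < M.n j) :
    M.width j k = M.x j (k j + 1) - M.x j (k j) :=
  if_pos h

lemma width_pos {j : Fin d} {k : Fin d → ℤ} (h : 0 ≤ k j ∧ k j < M.n j) : 0 < M.width j k := by
  rw [width_of_mem h]
  exact sub_pos.2 (M.x_lt j (k j) h.1 h.2)

lemma width_nonneg (j : Fin d) (k : Fin d → ℤ) : 0 ≤ M.width j k := by
  by_cases h : 0 ≤ k j ∧ k j < M.n j
  · exact (width_pos h).le
  · rw [width, if_neg h]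

lemma vol_pos {k : Fin d → ℤ} (h : k ∈ M.cells) : 0 < M.vol k :=
  Finset.prod_pos fun j _ => width_pos (mem_cells.1 h j)

lemma sum_vol_pos : 0 < ∑ k : M.cells, M.vol k :=
  Finset.sum_pos (fun k _ => vol_pos k.2) ⟨⟨0, zero_mem_cells⟩, Finset.mem_univ _⟩

lemma area_pos (i : Fin d) {k : Fin d → ℤ} (h : k ∈ M.cells) : 0 < M.area i k :=
  Finset.prod_pos fun j _ => width_pos (mem_cells.1 h j)

lemma area_nonneg (i : Fin d) (k : Fin d → ℤ) : 0 ≤ M.area i k :=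
  Finset.prod_nonneg fun j _ => width_nonneg j k

lemma dualVol_pos {i : Fin d} {k : Fin d → ℤ} (h : k ∈ M.faces i) : 0 < M.dualVol i k :=
  add_pos (half_pos (vol_pos (mem_cells_of_mem_faces h))) (half_pos (vol_pos (add_e_mem_cells h)))

lemma dualArea_nonneg (i j : Fin d) (k : Fin d → ℤ) : 0 ≤ M.dualArea i j k :=
  div_nonneg (add_nonneg (area_nonneg j k) (area_nonneg j (k + e i))) zero_le_two

lemma dualDist_nonneg (i j : Fin d) (k : Fin d → ℤ) : 0 ≤ M.dualDist i j k := by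
  rw [dualDist]
  split_ifs
  · exact width_nonneg _ _
  · exact div_nonneg (add_nonneg (width_nonneg j k) (width_nonneg j (k + e j))) zero_le_two

lemma dualVol_mul_dualDensity (ρ : M.CellField) {i : Fin d} {k : Fin d → ℤ}
    (h : k ∈ M.faces i) : M.dualVol i k * dualDensity ρ i k
      = M.vol k / 2 * cv ρ k + M.vol (k + e i) / 2 * cv ρ (k + e i) :=
  mul_div_cancel₀ _ (dualVol_pos h).ne'

lemma dualDensity_pos {ρ : M.CellField} (hρ : ∀ k, 0 < ρ k) {i : Fin d} {k : Fin d → ℤ}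
    (h : k ∈ M.faces i) : 0 < dualDensity ρ i k := by
  have hK := mem_cells_of_mem_faces h
  have hL := add_e_mem_cells h
  rw [dualDensity, cv_of_mem _ hK, cv_of_mem _ hL]
  exact div_pos (add_pos (mul_pos (half_pos (vol_pos hK)) (hρ _))
    (mul_pos (half_pos (vol_pos hL)) (hρ _))) (dualVol_pos h)

lemma dualVol_mul_grad (p : M.CellField) {i : Fin d} {k : Fin d → ℤ} (h : k ∈ M.faces i) :
    M.dualVol i k * grad p i k = M.area i k * (cv p (k + e i) - cv p k) := by
  rw [grad, ← mul_assoc, mul_div_cancel₀ _ (dualVol_pos h).ne']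

lemma massFlux_of_notMem (ρ : M.CellField) (u : M.FaceField) {i : Fin d} {k : Fin d → ℤ}
    (h : k ∉ M.faces i) : massFlux ρ u i k = 0 := by
  rw [massFlux, fv_of_notMem u h, mul_zero]

lemma massFlux_one (u : M.FaceField) (i : Fin d) (k : Fin d → ℤ) :
    massFlux (fun _ => 1) u i k = M.area i k * fv u i k := by
  by_cases h : k ∈ M.faces i
  · rw [massFlux, cv_of_mem _ (mem_cells_of_mem_faces h), cv_of_mem _ (add_e_mem_cells h),
      ite_self, mul_one]
  · rw [massFlux_of_notMem _ _ h, fv_of_notMem _ h, mul_zero]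

lemma vol_mul_divMass (ρ : M.CellField) (u : M.FaceField) {k : Fin d → ℤ} (h : k ∈ M.cells) :
    M.vol k * divMass ρ u k = ∑ i, (massFlux ρ u i k - massFlux ρ u i (k - e i)) := by
  rw [divMass, ← mul_assoc, mul_one_div_cancel (vol_pos h).ne', one_mul]

/-! ### Discrete duality -/

lemma integral_eq_sum_cells (p : M.CellField) : integral p = ∑ k ∈ M.cells, M.vol k * cv p k := by
  rw [← Finset.sum_coe_sort M.cells, integral]
  exact Finset.sum_congr rfl fun k _ => by rw [cv_of_mem p k.2]

lemma integral_divMass_mul (ρ : M.CellField) (u : M.FaceField) (f : M.CellField) :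
    integral (fun k => divMass ρ u k * f k)
      = ∑ i, ∑ k ∈ M.faces i, massFlux ρ u i k * (cv f k - cv f (k + e i)) := by
  have cellwise : ∀ k ∈ M.cells, M.vol k * cv (fun k => divMass ρ u k * f k) k
      = ∑ i, (massFlux ρ u i k - massFlux ρ u i (k - e i)) * cv f k := fun k hk => by
    rw [cv_of_mem _ hk, cv_of_mem f hk, ← mul_assoc, vol_mul_divMass ρ u hk, Finset.sum_mul]
  rw [integral_eq_sum_cells, Finset.sum_congr rfl cellwise, Finset.sum_comm]
  refine Finset.sum_congr rfl fun i _ => ?_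
  rw [sum_sub_translate_mul M.cells (e i) (massFlux ρ u i) (cv f) fun k hk => cv_of_notMem f hk]
  exact (Finset.sum_subset
    (fun k hk => Finset.mem_union_left _ (mem_cells_of_mem_faces hk))
    fun k _ hk => by rw [massFlux_of_notMem _ _ hk, zero_mul]).symm

/-- The discrete `L²` scalar product `∑_σ |D_σ| f_σ v_σ` of a velocity field `v` with face values
`f`, such as those of `grad p`, `divTau μ lam w` or `conv ρ w u`. -/
noncomputable def facePairing (f : Fin d → (Fin d → ℤ) → ℝ) (v : M.FaceField) : ℝ :=
  ∑ i, ∑ k ∈ M.faces i, M.dualVol i k * (f i k * fv v i k)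

theorem facePairing_grad (p : M.CellField) (v : M.FaceField) :
    facePairing (grad p) v = -integral (fun k => divVel v k * p k) := by
  simp only [divVel, integral_divMass_mul, facePairing, ← Finset.sum_neg_distrib]
  refine Finset.sum_congr rfl fun i _ => Finset.sum_congr rfl fun k hk => ?_
  rw [← mul_assoc, dualVol_mul_grad p hk, massFlux_one]
  ring

lemma facePairing_laplacian_nonpos (v : M.FaceField) : facePairing (laplacian v) v ≤ 0 := by
  refine Finset.sum_nonpos fun i _ => ?_
  have facewise : ∀ k ∈ M.faces i, M.dualVol i k * (laplacian v i k * fv v i k)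
      = ∑ j, (diffFlux v i j k - diffFlux v i j (k - e j)) * fv v i k := fun k hk => by
    rw [laplacian, ← Finset.sum_mul, ← mul_assoc, ← mul_assoc,
      mul_one_div_cancel (dualVol_pos hk).ne', one_mul]
  rw [Finset.sum_congr rfl facewise, Finset.sum_comm]
  refine Finset.sum_nonpos fun j _ => ?_
  rw [sum_sub_translate_mul (M.faces i) (e j) (diffFlux v i j) (fv v i)
    fun k hk => fv_of_notMem v hk]
  refine Finset.sum_nonpos fun k _ => ?_
  have htrans : 0 ≤ M.dualArea i j k / M.dualDist i j k :=
    div_nonneg (dualArea_nonneg i j k) (dualDist_nonneg i j k)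
  rw [diffFlux]
  nlinarith [mul_nonneg htrans (sq_nonneg (fv v i (k + e j) - fv v i k))]

theorem facePairing_divTau_nonpos {μ lam : ℝ} (hμ : 0 ≤ μ) (hμlam : 0 ≤ μ + lam)
    (v : M.FaceField) : facePairing (divTau μ lam v) v ≤ 0 := by
  have hsplit : facePairing (divTau μ lam v) v = μ * facePairing (laplacian v) v
      + (μ + lam) * facePairing (grad (divVel v)) v := by
    simp only [facePairing, Finset.mul_sum, ← Finset.sum_add_distrib, divTau]
    exact Finset.sum_congr rfl fun i _ => Finset.sum_congr rfl fun k _ => by ring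
  have hdiv : 0 ≤ integral (fun k => divVel v k * divVel v k) :=
    Finset.sum_nonneg fun k _ => mul_nonneg (vol_pos k.2).le (mul_self_nonneg _)
  rw [hsplit, facePairing_grad]
  exact add_nonpos (mul_nonpos_of_nonneg_of_nonpos hμ (facePairing_laplacian_nonpos v))
    (mul_nonpos_of_nonneg_of_nonpos hμlam (neg_nonpos.2 hdiv))

/-- The divergence `|D_σ|⁻¹ ∑_ε F_{σ,ε}` of the mass fluxes on the dual cells. -/
noncomputable def dualDivMass (ρ : M.CellField) (u : M.FaceField) (i : Fin d) (k : Fin d → ℤ) :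
    ℝ :=
  (1 / M.dualVol i k) * ∑ j, (dualFlux ρ u i j k - dualFlux ρ u i j (k - e j))

lemma dualVol_mul_dualDivMass (ρ : M.CellField) (u : M.FaceField) {i : Fin d} {k : Fin d → ℤ}
    (h : k ∈ M.faces i) : M.dualVol i k * dualDivMass ρ u i k
      = M.vol k / 2 * divMass ρ u k + M.vol (k + e i) / 2 * divMass ρ u (k + e i) := by
  have hhalves : M.vol k / 2 * divMass ρ u k + M.vol (k + e i) / 2 * divMass ρ u (k + e i)
      = (M.vol k * divMass ρ u k + M.vol (k + e i) * divMass ρ u (k + e i)) / 2 := by ring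
  rw [hhalves, dualDivMass, ← mul_assoc, mul_one_div_cancel (dualVol_pos h).ne', one_mul,
    vol_mul_divMass _ _ (mem_cells_of_mem_faces h), vol_mul_divMass _ _ (add_e_mem_cells h),
    ← Finset.sum_add_distrib, Finset.sum_div]
  refine Finset.sum_congr rfl fun j _ => ?_
  rw [dualFlux, dualFlux, sub_add_eq_add_sub]
  ring

theorem facePairing_conv (ρ : M.CellField) (v u : M.FaceField) :
    facePairing (conv ρ v u) v = facePairing (fun i k => dualDivMass ρ u i k * fv v i k / 2) v := by
  refine Finset.sum_congr rfl fun i _ => ?_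
  have hconv : ∀ k ∈ M.faces i, M.dualVol i k * (conv ρ v u i k * fv v i k)
      = ∑ j, (dualFlux ρ u i j k * dualFaceVal v i j k
          - dualFlux ρ u i j (k - e j) * dualFaceVal v i j (k - e j)) * fv v i k := fun k hk => by
    rw [conv, ← Finset.sum_mul, ← mul_assoc, ← mul_assoc,
      mul_one_div_cancel (dualVol_pos hk).ne', one_mul]
  have hdiv : ∀ k ∈ M.faces i,
      M.dualVol i k * (dualDivMass ρ u i k * fv v i k / 2 * fv v i k)
        = ∑ j, (dualFlux ρ u i j k - dualFlux ρ u i j (k - e j)) * (fv v i k ^ 2 / 2) :=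
    fun k hk => by
      have := (dualVol_pos hk).ne'
      rw [dualDivMass, ← Finset.sum_mul]
      field_simp
  rw [Finset.sum_congr rfl hconv, Finset.sum_congr rfl hdiv, Finset.sum_comm,
    Finset.sum_comm (s := M.faces i)]
  refine Finset.sum_congr rfl fun j _ => ?_
  rw [sum_sub_translate_mul (M.faces i) (e j) (fun k => dualFlux ρ u i j k * dualFaceVal v i j k)
      (fv v i) (fun k hk => fv_of_notMem v hk),
    sum_sub_translate_mul (M.faces i) (e j) (dualFlux ρ u i j) (fun k => fv v i k ^ 2 / 2)
      (fun k hk => by rw [fv_of_notMem v hk, zero_pow two_ne_zero, zero_div])]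
  -- The centred choice of `dualFaceVal` makes the two jumps agree.
  refine Finset.sum_congr rfl fun k _ => ?_
  rw [dualFaceVal]
  ring

end MACMesh

/-! ### The elastic potential -/

/-- `Ψ` is a convex function on `(0, ∞)` with derivative `h`, it is minimal at `1` only, where it
vanishes, and its Legendre transform `x h(x) - Ψ(x)` is the pressure `x ^ γ` up to a constant: the
potential energy of a gas of density `x`, relative to the density `1`. -/
structure IsElasticPotential (γ : ℝ) (Ψ h : ℝ → ℝ) : Prop where
  convex : ∀ x y, 0 < x → 0 < y → Ψ x + h x * (y - x) ≤ Ψ y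
  legendre : ∀ x, 0 < x → x * h x - Ψ x = x ^ γ - 1
  value_one : Ψ 1 = 0
  deriv_one : h 1 = 0
  deriv_pos : ∀ x, 1 < x → 0 < h x
  deriv_neg : ∀ x, 0 < x → x < 1 → h x < 0
  continuousAt_deriv : ContinuousAt h 1

lemma isElasticPotential_log :
    IsElasticPotential 1 (fun x => x * Real.log x - x + 1) Real.log where
  convex x y hx hy := by
    have hlog := Real.log_le_sub_one_of_pos (div_pos hx hy)
    rw [Real.log_div hx.ne' hy.ne'] at hlog
    have hmul : y * (Real.log x - Real.log y) ≤ y * (x / y - 1) := by gcongr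
    rw [mul_sub y (x / y), mul_div_cancel₀ x hy.ne'] at hmul
    linarith
  legendre x _ := by rw [Real.rpow_one]; ring
  value_one := by simp
  deriv_one := Real.log_one
  deriv_pos x hx := Real.log_pos hx
  deriv_neg x hx hx' := Real.log_neg hx hx'
  continuousAt_deriv := Real.continuousAt_log one_ne_zero

lemma rpow_tangent_le_div_sub_one {γ x y : ℝ} (hγ : 0 < γ) (hγ1 : γ ≠ 1) (hx : 0 < x)
    (hy : 0 < y) :
    (x ^ γ + γ * x ^ (γ - 1) * (y - x)) / (γ - 1) ≤ y ^ γ / (γ - 1) := by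
  have hs : -1 ≤ y / x - 1 := by linarith [div_pos hy hx]
  have hpow : x ^ γ = x ^ (γ - 1) * x := by rw [Real.rpow_sub_one hx.ne', div_mul_cancel₀ _ hx.ne']
  have htangent : x ^ γ + γ * x ^ (γ - 1) * (y - x) = (1 + γ * (y / x - 1)) * x ^ γ := by
    rw [hpow]; field_simp
  have hquot : (1 + (y / x - 1)) ^ γ * x ^ γ = y ^ γ := by
    rw [add_sub_cancel, Real.div_rpow hy.le hx.le,
      div_mul_cancel₀ _ (Real.rpow_pos_of_pos hx γ).ne']
  rw [htangent, ← hquot]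
  have hxγ := (Real.rpow_pos_of_pos hx γ).le
  rcases hγ1.lt_or_gt with hlt | hgt
  · exact div_le_div_of_nonpos_of_le (by linarith) (mul_le_mul_of_nonneg_right
      (rpow_one_add_le_one_add_mul_self hs hγ.le hlt.le) hxγ)
  · exact div_le_div_of_nonneg_right (mul_le_mul_of_nonneg_right
      (one_add_mul_self_le_rpow_one_add hs hgt.le) hxγ) (by linarith)

lemma rpow_sub_one_div_pos {a x : ℝ} (ha : a ≠ 0) (hx : 1 < x) : 0 < (x ^ a - 1) / a := by
  rcases ha.lt_or_gt with ha | ha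
  · exact div_pos_of_neg_of_neg (by linarith [Real.rpow_lt_one_of_one_lt_of_neg hx ha]) ha
  · exact div_pos (by linarith [Real.one_lt_rpow hx ha]) ha

lemma rpow_sub_one_div_neg {a x : ℝ} (ha : a ≠ 0) (hx : 0 < x) (hx1 : x < 1) :
    (x ^ a - 1) / a < 0 := by
  rcases ha.lt_or_gt with ha | ha
  · exact div_neg_of_pos_of_neg
      (by linarith [Real.one_lt_rpow_of_pos_of_lt_one_of_neg hx hx1 ha]) ha
  · exact div_neg_of_neg_of_pos (by linarith [Real.rpow_lt_one hx.le hx1 ha]) ha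

lemma isElasticPotential_rpow {γ : ℝ} (hγ : 0 < γ) (hγ1 : γ ≠ 1) :
    IsElasticPotential γ (fun x => (x ^ γ - 1 - γ * (x - 1)) / (γ - 1))
      (fun x => γ * ((x ^ (γ - 1) - 1) / (γ - 1))) where
  convex x y hx hy := by
    have htangent := rpow_tangent_le_div_sub_one hγ hγ1 hx hy
    calc _ = (x ^ γ + γ * x ^ (γ - 1) * (y - x)) / (γ - 1) + (-1 - γ * (y - 1)) / (γ - 1) := by
          ring
      _ ≤ y ^ γ / (γ - 1) + (-1 - γ * (y - 1)) / (γ - 1) := by gcongr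
      _ = _ := by ring
  legendre x hx := by
    have := sub_ne_zero.2 hγ1
    have hpow : x ^ γ = x ^ (γ - 1) * x := by
      rw [Real.rpow_sub_one hx.ne', div_mul_cancel₀ _ hx.ne']
    rw [hpow]
    field_simp
    ring
  value_one := by simp
  deriv_one := by simp
  deriv_pos x hx := mul_pos hγ (rpow_sub_one_div_pos (sub_ne_zero.2 hγ1) hx)
  deriv_neg x hx hx1 := mul_neg_of_pos_of_neg hγ (rpow_sub_one_div_neg (sub_ne_zero.2 hγ1) hx hx1)
  continuousAt_deriv := by
    have := Real.continuousAt_rpow_const 1 (γ - 1) (Or.inl one_ne_zero)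
    fun_prop

lemma exists_isElasticPotential {γ : ℝ} (hγ : 0 < γ) : ∃ Ψ h, IsElasticPotential γ Ψ h := by
  obtain rfl | hγ1 := eq_or_ne γ 1
  · exact ⟨_, _, isElasticPotential_log⟩
  · exact ⟨_, _, isElasticPotential_rpow hγ hγ1⟩

namespace IsElasticPotential

variable {γ : ℝ} {Ψ h : ℝ → ℝ}

lemma nonneg (H : IsElasticPotential γ Ψ h) {x : ℝ} (hx : 0 < x) : 0 ≤ Ψ x := by
  simpa only [H.value_one, H.deriv_one, zero_mul, add_zero] using H.convex 1 x one_pos hx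

lemma le_abs_deriv_mul (H : IsElasticPotential γ Ψ h) {x : ℝ} (hx : 0 < x) :
    Ψ x ≤ |h x| * |x - 1| := by
  have htangent := H.convex x 1 hx one_pos
  rw [H.value_one] at htangent
  rw [← abs_mul]
  linarith [le_abs_self (h x * (x - 1))]

lemma coercive (H : IsElasticPotential γ Ψ h) {ε : ℝ} (hε : 0 < ε) :
    ∃ η > 0, ∀ x, 0 < x → Ψ x < η → |x - 1| < ε := by
  obtain ⟨δ, hδ, hδε, hδ1⟩ : ∃ δ, 0 < δ ∧ 2 * δ ≤ ε ∧ δ < 1 :=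
    ⟨min (ε / 2) (1 / 2), by positivity, by linarith [min_le_left (ε / 2) (1 / 2)],
      by linarith [min_le_right (ε / 2) (1 / 2)]⟩
  have hslope := H.deriv_pos (1 + δ) (by linarith)
  have hslope' := H.deriv_neg (1 - δ) (by linarith) (by linarith)
  refine ⟨min (h (1 + δ) * δ) (-h (1 - δ) * δ), lt_min (by positivity) (by nlinarith), ?_⟩
  intro x hx hlt
  obtain ⟨hlt_right, hlt_left⟩ := lt_min_iff.1 hlt
  by_contra! hfar
  rcases le_abs.1 hfar with hright | hleft
  · nlinarith [H.convex (1 + δ) x (by linarith) hx, H.nonneg (x := 1 + δ) (by linarith)]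
  · nlinarith [H.convex (1 - δ) x (by linarith) hx, H.nonneg (x := 1 - δ) (by linarith)]

lemma upwind_le (H : IsElasticPotential γ Ψ h) {a b : ℝ} (ha : 0 < a) (hb : 0 < b) (v : ℝ) :
    (if 0 ≤ v then a else b) * v * (h b - h a) ≤ (b ^ γ - a ^ γ) * v := by
  have hpressure : b ^ γ - a ^ γ = b * h b - Ψ b - (a * h a - Ψ a) := by
    rw [H.legendre a ha, H.legendre b hb]; ring
  rw [hpressure]
  split_ifs with hv
  · nlinarith [H.convex b a hb ha]
  · nlinarith [H.convex a b ha hb, not_le.1 hv]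

end IsElasticPotential

namespace MACMesh

variable {d : ℕ} {M : MACMesh d}

/-! ### The upwind mass balance -/

/-- The implicit upwind mass balance, for a time step leading from the density `ρ` to the density
`ρ'`, with the velocity `u`. -/
def MassBalance (δt : ℝ) (ρ ρ' : M.CellField) (u : M.FaceField) : Prop :=
  ∀ k : M.cells, (1 / δt) * (ρ' k - ρ k) + divMass ρ' u k = 0

namespace MassBalance

variable {δt : ℝ} {ρ ρ' : M.CellField} {u : M.FaceField}

lemma divMass_eq (h : MassBalance δt ρ ρ' u) (k : M.cells) :
    divMass ρ' u k = (1 / δt) * (ρ k - ρ' k) := by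
  linarith [h k]

lemma dualDivMass_eq (h : MassBalance δt ρ ρ' u) {i : Fin d} {k : Fin d → ℤ}
    (hk : k ∈ M.faces i) :
    dualDivMass ρ' u i k = (1 / δt) * (dualDensity ρ i k - dualDensity ρ' i k) := by
  have hK := mem_cells_of_mem_faces hk
  have hL := add_e_mem_cells hk
  refine mul_left_cancel₀ (dualVol_pos hk).ne' ?_
  rw [mul_left_comm, mul_sub, dualVol_mul_dualDivMass ρ' u hk, dualVol_mul_dualDensity ρ hk,
    dualVol_mul_dualDensity ρ' hk, h.divMass_eq ⟨k, hK⟩, h.divMass_eq ⟨_, hL⟩,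
    cv_of_mem ρ hK, cv_of_mem ρ hL, cv_of_mem ρ' hK, cv_of_mem ρ' hL]
  ring

/-- Testing the balance with the indicator of `{ρ' ≤ 0}`, the upwind fluxes bring no mass out of
this set. -/
theorem density_pos (h : MassBalance δt ρ ρ' u) (hδt : 0 < δt) (hρ : ∀ k, 0 < ρ k) :
    ∀ k, 0 < ρ' k := by
  by_contra! hcon
  obtain ⟨k₀, hk₀⟩ := hcon
  set f : M.CellField := fun k => if ρ' k ≤ 0 then 1 else 0 with hf
  have hflux : integral (fun k => divMass ρ' u k * f k) ≤ 0 := by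
    rw [integral_divMass_mul]
    refine Finset.sum_nonpos fun i _ => Finset.sum_nonpos fun k hk => ?_
    rw [massFlux, cv_of_mem _ (mem_cells_of_mem_faces hk), cv_of_mem _ (add_e_mem_cells hk),
      cv_of_mem _ (mem_cells_of_mem_faces hk), cv_of_mem _ (add_e_mem_cells hk), mul_assoc,
      mul_assoc]
    refine mul_nonpos_of_nonneg_of_nonpos (area_nonneg i k) ?_
    simp only [hf]
    split_ifs <;> nlinarith
  have hloss : ∀ k : M.cells, ρ' k ≤ 0 → 0 < M.vol k * divMass ρ' u k := fun k hk => by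
    rw [h.divMass_eq k]
    exact mul_pos (vol_pos k.2) (mul_pos (one_div_pos.2 hδt) (by linarith [hρ k]))
  have hmass : 0 < integral (fun k => divMass ρ' u k * f k) := by
    refine Finset.sum_pos' (fun k _ => ?_) ⟨k₀, Finset.mem_univ k₀, ?_⟩
    · rw [← mul_assoc]
      simp only [hf]
      split_ifs with hk
      · simpa only [mul_one] using (hloss k hk).le
      · rw [mul_zero]
    · rw [← mul_assoc]
      simpa only [hf, if_pos hk₀, mul_one] using hloss k₀ hk₀
  exact hmass.not_ge hflux

theorem integral_elastic_sub_le (hmass : MassBalance δt ρ ρ' u) (hδt : 0 < δt)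
    (hρ : ∀ k, 0 < ρ k) (hρ' : ∀ k, 0 < ρ' k) {γ : ℝ} {Ψ h : ℝ → ℝ}
    (hΨ : IsElasticPotential γ Ψ h) :
    integral (fun k : M.cells => Ψ (ρ' k)) - integral (fun k : M.cells => Ψ (ρ k))
      ≤ δt * facePairing (grad (pressure γ ρ')) u := by
  have hconvex : integral (fun k : M.cells => Ψ (ρ' k)) - integral (fun k : M.cells => Ψ (ρ k))
      ≤ δt * -integral (fun k => divMass ρ' u k * h (ρ' k)) := by
    rw [integral, integral, integral, ← Finset.sum_sub_distrib, ← Finset.sum_neg_distrib,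
      Finset.mul_sum]
    refine Finset.sum_le_sum fun k _ => ?_
    have hwork : δt * -(M.vol k * (divMass ρ' u k * h (ρ' k)))
        = M.vol k * (h (ρ' k) * (ρ' k - ρ k)) := by
      rw [hmass.divMass_eq k]; field_simp; ring
    rw [hwork, ← mul_sub]
    exact mul_le_mul_of_nonneg_left (by linarith [hΨ.convex (ρ' k) (ρ k) (hρ' k) (hρ k)])
      (vol_pos k.2).le
  have hupwind : -integral (fun k => divMass ρ' u k * h (ρ' k))
      ≤ facePairing (grad (pressure γ ρ')) u := by
    rw [integral_divMass_mul ρ' u (fun k => h (ρ' k)), ← Finset.sum_neg_distrib]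
    refine Finset.sum_le_sum fun i _ => ?_
    rw [← Finset.sum_neg_distrib]
    refine Finset.sum_le_sum fun k hk => ?_
    have hK := mem_cells_of_mem_faces hk
    have hL := add_e_mem_cells hk
    have := mul_le_mul_of_nonneg_left (hΨ.upwind_le (hρ' ⟨k, hK⟩) (hρ' ⟨_, hL⟩) (fv u i k))
      (area_nonneg (M := M) i k)
    rw [← mul_assoc, dualVol_mul_grad _ hk, massFlux, cv_of_mem _ hK, cv_of_mem _ hL,
      cv_of_mem _ hK, cv_of_mem _ hL, cv_of_mem _ hK, cv_of_mem _ hL]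
    simp only [pressure]
    linarith
  exact hconvex.trans (mul_le_mul_of_nonneg_left hupwind hδt.le)

end MassBalance

end MACMesh

/-! ### The energy inequality -/

lemma kinetic_energy_correction {δt r b c g' G : ℝ} (hδt : 0 < δt) (hr : 0 < r)
    (h : (1 / δt) * r * (b - c) + g' - G = 0) :
    r * b ^ 2 / 2 + δt ^ 2 * g' ^ 2 / (2 * r) + δt * (g' * b)
      = r * c ^ 2 / 2 + δt ^ 2 * G ^ 2 / (2 * r) + δt * (G * c) := by
  have hsum : r * b + δt * g' = r * c + δt * G := by
    field_simp at h
    linarith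
  have hsq : ∀ x y : ℝ, r * x ^ 2 / 2 + δt ^ 2 * y ^ 2 / (2 * r) + δt * (y * x)
      = (r * x + δt * y) ^ 2 / (2 * r) := fun x y => by field_simp; ring
  rw [hsq, hsq, hsum]

lemma kinetic_energy_prediction {δt r rm a c A G : ℝ} (hδt : 0 < δt) (hrm : 0 ≤ rm)
    (h : (1 / δt) * (r * c - rm * a) + A + G = 0) :
    r * c ^ 2 / 2 + δt * (G * c) + δt * ((A - (1 / δt) * (rm - r) * c / 2) * c)
      ≤ rm * a ^ 2 / 2 := by
  have hG : G = -((1 / δt) * (r * c - rm * a) + A) := by linarith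
  have hwork : r * c ^ 2 / 2 + δt * (G * c) + δt * ((A - (1 / δt) * (rm - r) * c / 2) * c)
      = rm * (a * c) - rm * c ^ 2 / 2 := by
    rw [hG]; field_simp; ring
  rw [hwork]
  nlinarith [mul_nonneg hrm (sq_nonneg (a - c))]

namespace MACMesh

variable {d : ℕ} {M : MACMesh d}

/-- One step of the compressible scheme, from `(ρm, ρ, u) = (ρ^{n-1}, ρ^n, u^n)` to
`(ρ', u') = (ρ^{n+1}, u^{n+1})`, with predicted velocity `w`. The field `prev_mass` is the mass
balance of the previous step (of the initialization if `n = 0`). -/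
structure IsCompressibleStep (γ μ lam δt Ma : ℝ) (ρm ρ ρ' : M.CellField) (u w u' : M.FaceField) :
    Prop where
  prev_mass : MassBalance δt ρm ρ u
  prediction : ∀ i (k : M.faces i),
    (1 / δt) * (dualDensity ρ i k * w i k - dualDensity ρm i k * u i k)
      + conv ρ w u i k - divTau μ lam w i k
      + (1 / Ma ^ 2) * (Real.sqrt (dualDensity ρ i k / dualDensity ρm i k)
          * grad (pressure γ ρ) i k) = 0
  correction : ∀ i (k : M.faces i), (1 / δt) * dualDensity ρ i k * (u' i k - w i k)
      + (1 / Ma ^ 2) * grad (pressure γ ρ') i k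
      - (1 / Ma ^ 2) * (Real.sqrt (dualDensity ρ i k / dualDensity ρm i k)
          * grad (pressure γ ρ) i k) = 0
  mass : MassBalance δt ρ ρ' u'

lemma IsCompressibleSol.massBalance {γ μ lam δt Ma : ℝ} {N : ℕ} {ρ₀ : (Fin d → ℝ) → ℝ}
    {u₀ : Fin d → (Fin d → ℝ) → ℝ} {ρ : ℤ → M.CellField} {u w : ℕ → M.FaceField}
    (hsol : IsCompressibleSol γ μ lam δt Ma N ρ₀ u₀ ρ u w) {n : ℕ} (hn : n ≤ N) :
    MassBalance δt (ρ (n - 1)) (ρ n) (u n) := by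
  intro k
  cases n with
  | zero => simpa only [Nat.cast_zero, zero_sub] using hsol.init_backward k
  | succ n => simpa only [Nat.cast_add, Nat.cast_one, add_sub_cancel_right] using hsol.mass n hn k

lemma IsCompressibleSol.isCompressibleStep {γ μ lam δt Ma : ℝ} {N : ℕ} {ρ₀ : (Fin d → ℝ) → ℝ}
    {u₀ : Fin d → (Fin d → ℝ) → ℝ} {ρ : ℤ → M.CellField} {u w : ℕ → M.FaceField}
    (hsol : IsCompressibleSol γ μ lam δt Ma N ρ₀ u₀ ρ u w) {n : ℕ} (hn : n < N) :
    IsCompressibleStep γ μ lam δt Ma (ρ (n - 1)) (ρ n) (ρ (n + 1)) (u n) (w (n + 1))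
      (u (n + 1)) where
  prev_mass := hsol.massBalance hn.le
  prediction := hsol.prediction n hn
  correction := hsol.correction n hn
  mass := hsol.mass n hn

/-- The energy density on a dual cell: the kinetic energy, plus the pressure gradient term that
the pressure correction step carries from one time step to the next. -/
noncomputable def faceEnergy (γ δt Ma : ℝ) (ρm ρ : M.CellField) (u : M.FaceField) (i : Fin d)
    (k : Fin d → ℤ) : ℝ :=
  dualDensity ρm i k * fv u i k ^ 2 / 2
    + δt ^ 2 * ((1 / Ma ^ 2) * grad (pressure γ ρ) i k) ^ 2 / (2 * dualDensity ρm i k)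

/-- The discrete total energy at the step `n`, with `(ρm, ρ, u) = (ρ^{n-1}, ρ^n, u^n)` and `Ψ`
an elastic potential. -/
noncomputable def energy (γ δt Ma : ℝ) (Ψ : ℝ → ℝ) (ρm ρ : M.CellField) (u : M.FaceField) : ℝ :=
  ∑ i, ∑ k ∈ M.faces i, M.dualVol i k * faceEnergy γ δt Ma ρm ρ u i k
    + (1 / Ma ^ 2) * integral (fun k : M.cells => Ψ (ρ k))

section Energy

variable {γ δt Ma : ℝ} {ρm ρ : M.CellField} {Ψ h : ℝ → ℝ}

lemma dualVol_mul_faceEnergy_nonneg (hρm : ∀ k, 0 < ρm k) (u : M.FaceField) {i : Fin d}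
    {k : Fin d → ℤ} (hk : k ∈ M.faces i) :
    0 ≤ M.dualVol i k * faceEnergy γ δt Ma ρm ρ u i k := by
  have := dualVol_pos hk
  have := dualDensity_pos hρm hk
  unfold faceEnergy
  positivity

lemma integral_elastic_nonneg (hΨ : IsElasticPotential γ Ψ h) (hρ : ∀ k, 0 < ρ k) :
    0 ≤ integral (fun k : M.cells => Ψ (ρ k)) :=
  Finset.sum_nonneg fun k _ => mul_nonneg (vol_pos k.2).le (hΨ.nonneg (hρ k))

lemma dualVol_mul_faceEnergy_le_energy (hΨ : IsElasticPotential γ Ψ h) (hρm : ∀ k, 0 < ρm k)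
    (hρ : ∀ k, 0 < ρ k) (u : M.FaceField) {i : Fin d} {k : Fin d → ℤ} (hk : k ∈ M.faces i) :
    M.dualVol i k * faceEnergy γ δt Ma ρm ρ u i k ≤ energy γ δt Ma Ψ ρm ρ u := by
  have hface : ∀ i, ∀ k ∈ M.faces i, 0 ≤ M.dualVol i k * faceEnergy γ δt Ma ρm ρ u i k :=
    fun _ _ => dualVol_mul_faceEnergy_nonneg hρm u
  calc M.dualVol i k * faceEnergy γ δt Ma ρm ρ u i k
      ≤ ∑ k ∈ M.faces i, M.dualVol i k * faceEnergy γ δt Ma ρm ρ u i k :=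
        Finset.single_le_sum (hface i) hk
    _ ≤ ∑ i, ∑ k ∈ M.faces i, M.dualVol i k * faceEnergy γ δt Ma ρm ρ u i k :=
        Finset.single_le_sum (f := fun i => ∑ k ∈ M.faces i,
          M.dualVol i k * faceEnergy γ δt Ma ρm ρ u i k)
          (fun i _ => Finset.sum_nonneg (hface i)) (Finset.mem_univ i)
    _ ≤ energy γ δt Ma Ψ ρm ρ u :=
        le_add_of_nonneg_right (mul_nonneg (by positivity) (integral_elastic_nonneg hΨ hρ))

lemma vol_mul_elastic_le_energy (hΨ : IsElasticPotential γ Ψ h) (hρm : ∀ k, 0 < ρm k)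
    (hρ : ∀ k, 0 < ρ k) (u : M.FaceField) (k : M.cells) :
    (1 / Ma ^ 2) * (M.vol k * Ψ (ρ k)) ≤ energy γ δt Ma Ψ ρm ρ u := by
  have hcell : M.vol k * Ψ (ρ k) ≤ integral (fun k : M.cells => Ψ (ρ k)) :=
    Finset.single_le_sum (f := fun k : M.cells => M.vol k * Ψ (ρ k))
      (fun k _ => mul_nonneg (vol_pos k.2).le (hΨ.nonneg (hρ k))) (Finset.mem_univ k)
  exact (mul_le_mul_of_nonneg_left hcell (by positivity)).trans (le_add_of_nonneg_left
    (Finset.sum_nonneg fun _ _ => Finset.sum_nonneg fun _ => dualVol_mul_faceEnergy_nonneg hρm u))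

end Energy

namespace IsCompressibleStep

variable {γ μ lam δt Ma : ℝ} {ρm ρ ρ' : M.CellField} {u w u' : M.FaceField}

lemma faceEnergy_le (hstep : IsCompressibleStep γ μ lam δt Ma ρm ρ ρ' u w u') (hδt : 0 < δt)
    (hρm : ∀ k, 0 < ρm k) (hρ : ∀ k, 0 < ρ k) {i : Fin d} {k : Fin d → ℤ} (hk : k ∈ M.faces i) :
    faceEnergy γ δt Ma ρ ρ' u' i k + (δt / Ma ^ 2) * (grad (pressure γ ρ') i k * fv u' i k)
        + δt * ((conv ρ w u i k - dualDivMass ρ u i k * fv w i k / 2) * fv w i k)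
      ≤ faceEnergy γ δt Ma ρm ρ u i k + δt * (divTau μ lam w i k * fv w i k) := by
  have hr := dualDensity_pos hρ hk
  have hrm := dualDensity_pos hρm hk
  have hprediction := hstep.prediction i ⟨k, hk⟩
  have hcorrection := hstep.correction i ⟨k, hk⟩
  rw [← fv_of_mem w hk, ← fv_of_mem u hk, add_sub_assoc] at hprediction
  rw [← fv_of_mem w hk, ← fv_of_mem u' hk] at hcorrection
  have hcorrected := kinetic_energy_correction hδt hr hcorrection
  have hpredicted := kinetic_energy_prediction hδt hrm.le hprediction
  -- The factor `√(ρ^n / ρ^{n-1})` of the scheme is the one for which the gradient terms cancel.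
  have hscaling : δt ^ 2 * ((1 / Ma ^ 2) * (Real.sqrt (dualDensity ρ i k / dualDensity ρm i k)
        * grad (pressure γ ρ) i k)) ^ 2 / (2 * dualDensity ρ i k)
      = δt ^ 2 * ((1 / Ma ^ 2) * grad (pressure γ ρ) i k) ^ 2 / (2 * dualDensity ρm i k) := by
    rw [mul_pow, mul_pow (Real.sqrt _), Real.sq_sqrt (div_pos hr hrm).le]
    field_simp
  rw [hscaling] at hcorrected
  simp only at hcorrected hpredicted
  rw [faceEnergy, faceEnergy, hstep.prev_mass.dualDivMass_eq hk, div_eq_mul_one_div δt]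
  linear_combination hcorrected + hpredicted

theorem energy_le (hstep : IsCompressibleStep γ μ lam δt Ma ρm ρ ρ' u w u') (hδt : 0 < δt)
    (hμ : 0 ≤ μ) (hμlam : 0 ≤ μ + lam) {Ψ h : ℝ → ℝ} (hΨ : IsElasticPotential γ Ψ h)
    (hρm : ∀ k, 0 < ρm k) (hρ : ∀ k, 0 < ρ k) :
    energy γ δt Ma Ψ ρ ρ' u' ≤ energy γ δt Ma Ψ ρm ρ u := by
  have hkinetic : ∑ i, ∑ k ∈ M.faces i, M.dualVol i k * faceEnergy γ δt Ma ρ ρ' u' i k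
        + δt / Ma ^ 2 * facePairing (grad (pressure γ ρ')) u'
        + δt * (facePairing (conv ρ w u) w
          - facePairing (fun i k => dualDivMass ρ u i k * fv w i k / 2) w)
      ≤ ∑ i, ∑ k ∈ M.faces i, M.dualVol i k * faceEnergy γ δt Ma ρm ρ u i k
        + δt * facePairing (divTau μ lam w) w := by
    simp only [facePairing, Finset.mul_sum, ← Finset.sum_add_distrib, ← Finset.sum_sub_distrib]
    refine Finset.sum_le_sum fun i _ => Finset.sum_le_sum fun k hk => ?_
    linarith [mul_le_mul_of_nonneg_left (hstep.faceEnergy_le hδt hρm hρ hk) (dualVol_pos hk).le]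
  have helastic := mul_le_mul_of_nonneg_left (hstep.mass.integral_elastic_sub_le hδt hρ
    (hstep.mass.density_pos hδt hρ) hΨ) (show 0 ≤ 1 / Ma ^ 2 by positivity)
  have hviscous := mul_nonpos_of_nonneg_of_nonpos hδt.le (facePairing_divTau_nonpos hμ hμlam w)
  rw [facePairing_conv, sub_self, mul_zero, add_zero] at hkinetic
  rw [energy, energy]
  linear_combination hkinetic + helastic + hviscous

end IsCompressibleStep

end MACMesh

namespace MACMesh

variable {d : ℕ} {M : MACMesh d}

/-! ### Fields with a bounded gradient -/

theorem cells_induction {P : (Fin d → ℤ) → Prop} (zero : P 0)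
    (add_e : ∀ i, ∀ k ∈ M.faces i, P k → P (k + e i)) : ∀ k ∈ M.cells, P k := by
  suffices H : ∀ s : ℕ, ∀ k ∈ M.cells, ∑ j, k j = s → P k by
    intro k hk
    have hsum : 0 ≤ ∑ j, k j := Finset.sum_nonneg fun j _ => (mem_cells.1 hk j).1
    exact H (∑ j, k j).toNat k hk (Int.toNat_of_nonneg hsum).symm
  intro s
  induction s with
  | zero =>
    intro k hk hs
    have hk0 : k = 0 := funext fun j => (Finset.sum_eq_zero_iff_of_nonneg
      fun j _ => (mem_cells.1 hk j).1).1 hs j (Finset.mem_univ j)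
    rwa [hk0]
  | succ s ih =>
    intro k hk hs
    obtain ⟨j, -, hj⟩ : ∃ j ∈ Finset.univ, 0 < k j := Finset.exists_lt_of_sum_lt <| by
      rw [Finset.sum_const_zero, hs]; positivity
    have hpred : k - e j ∈ M.cells := mem_cells.2 fun l => by
      rcases eq_or_ne l j with rfl | hl
      · rw [sub_e_apply_self]
        exact ⟨by omega, by linarith [(mem_cells.1 hk l).2]⟩
      · rw [sub_e_apply_of_ne _ hl]
        exact mem_cells.1 hk l
    have hface : k - e j ∈ M.faces j := mem_faces.2 ⟨hpred, by rwa [sub_add_cancel]⟩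
    have hs' : ∑ l, (k - e j) l = s := by
      have he : ∑ l, e j l = 1 := by simp only [e, Finset.sum_pi_single', Finset.mem_univ, if_true]
      simp only [Pi.sub_apply, Finset.sum_sub_distrib, hs, he, Nat.cast_add, Nat.cast_one,
        add_sub_cancel_right]
    simpa only [sub_add_cancel] using add_e j _ hface (ih _ hpred hs')

lemma sum_vol_mul_eq_sum_sub {p : M.CellField} (hp : integral p = 0) (k : M.cells) :
    (∑ l : M.cells, M.vol l) * p k = ∑ l : M.cells, M.vol l * (p k - p l) := by
  rw [integral] at hp
  simp only [mul_sub, Finset.sum_sub_distrib, hp, Finset.sum_mul, sub_zero]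

lemma cv_add_e_eq (p : M.CellField) {i : Fin d} {k : Fin d → ℤ} (hk : k ∈ M.faces i) :
    cv p (k + e i) = cv p k + M.dualVol i k / M.area i k * grad p i k := by
  have hA := area_pos i (mem_cells_of_mem_faces hk)
  have hD := dualVol_pos hk
  rw [grad]
  field_simp
  ring

theorem eq_zero_of_grad_eq_zero {p : M.CellField} (hmean : integral p = 0)
    (hgrad : ∀ i, ∀ k ∈ M.faces i, grad p i k = 0) : p = 0 := by
  have hconst : ∀ k ∈ M.cells, cv p k = cv p 0 := cells_induction rfl fun i k hk ih => by
    rw [cv_add_e_eq p hk, hgrad i k hk, mul_zero, add_zero, ih]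
  funext k
  refine (mul_eq_zero.1 ?_).resolve_left (sum_vol_pos (M := M)).ne'
  rw [sum_vol_mul_eq_sum_sub hmean k]
  refine Finset.sum_eq_zero fun l _ => ?_
  rw [← cv_of_mem p k.2, ← cv_of_mem p l.2, hconst k k.2, hconst l l.2, sub_self, mul_zero]

theorem isBigO_one_of_isBigO_grad {ι : Type*} {l : Filter ι} {p : ι → M.CellField}
    (hmean : ∀ m, integral (p m) = 0)
    (hgrad : ∀ i, ∀ k ∈ M.faces i, (fun m => grad (p m) i k) =O[l] fun _ => (1 : ℝ)) :
    p =O[l] fun _ => (1 : ℝ) := by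
  have hsub : ∀ k ∈ M.cells, (fun m => cv (p m) k - cv (p m) 0) =O[l] fun _ => (1 : ℝ) := by
    refine cells_induction ?_ fun i k hk ih => ?_
    · simp only [sub_self]
      exact Asymptotics.isBigO_zero _ _
    · simp only [cv_add_e_eq _ hk, add_sub_right_comm]
      exact ih.add ((hgrad i k hk).const_mul_left _)
  refine Asymptotics.isBigO_pi.2 fun k => ?_
  have hmul : (fun m => (∑ l : M.cells, M.vol l) * p m k) =O[l] fun _ => (1 : ℝ) := by
    simp only [sum_vol_mul_eq_sum_sub (hmean _) k]
    refine Asymptotics.IsBigO.fun_sum fun j _ => Asymptotics.IsBigO.const_mul_left ?_ _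
    refine ((hsub k k.2).sub (hsub j j.2)).congr_left fun m => ?_
    rw [sub_sub_sub_cancel_right, cv_of_mem _ k.2, cv_of_mem _ j.2]
  exact (Asymptotics.isBigO_const_mul_left_iff (sum_vol_pos (M := M)).ne').1 hmul

/-! ### Uniqueness for the incompressible scheme -/

lemma fv_sub (u v : M.FaceField) (i : Fin d) (k : Fin d → ℤ) :
    fv (u - v) i k = fv u i k - fv v i k := by
  by_cases h : k ∈ M.faces i
  · simp only [fv_of_mem _ h, Pi.sub_apply]
  · simp only [fv_of_notMem _ h, sub_zero]

lemma cv_sub (p q : M.CellField) (k : Fin d → ℤ) : cv (p - q) k = cv p k - cv q k := by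
  by_cases h : k ∈ M.cells
  · simp only [cv_of_mem _ h, Pi.sub_apply]
  · simp only [cv_of_notMem _ h, sub_zero]

lemma integral_sub (p q : M.CellField) : integral (p - q) = integral p - integral q := by
  simp only [integral, Pi.sub_apply, mul_sub, Finset.sum_sub_distrib]

lemma grad_sub (p q : M.CellField) (i : Fin d) (k : Fin d → ℤ) :
    grad (p - q) i k = grad p i k - grad q i k := by
  simp only [grad, cv_sub]
  ring

lemma divVel_apply (u : M.FaceField) (k : M.cells) : divVel u k
    = (1 / M.vol k) * ∑ i, (M.area i k * fv u i k - M.area i (k - e i) * fv u i (k - e i)) := by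
  simp only [divVel, divMass, massFlux_one]

lemma divVel_sub (u v : M.FaceField) : divVel (u - v) = divVel u - divVel v := by
  funext k
  simp only [Pi.sub_apply, divVel_apply, ← mul_sub, ← Finset.sum_sub_distrib, fv_sub]
  congr! 2
  ring

lemma laplacian_sub (u v : M.FaceField) (i : Fin d) (k : Fin d → ℤ) :
    laplacian (u - v) i k = laplacian u i k - laplacian v i k := by
  simp only [laplacian, diffFlux, fv_sub, ← mul_sub, ← Finset.sum_sub_distrib]
  congr! 2
  ring

lemma divTau_sub (μ lam : ℝ) (u v : M.FaceField) (i : Fin d) (k : Fin d → ℤ) :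
    divTau μ lam (u - v) i k = divTau μ lam u i k - divTau μ lam v i k := by
  rw [divTau, divTau, divTau, laplacian_sub, divVel_sub, grad_sub]
  ring

lemma conv_sub (ρ : M.CellField) (v v' u : M.FaceField) (i : Fin d) (k : Fin d → ℤ) :
    conv ρ (v - v') u i k = conv ρ v u i k - conv ρ v' u i k := by
  simp only [conv, dualFaceVal, fv_sub, ← mul_sub, ← Finset.sum_sub_distrib]
  congr! 2
  ring

lemma facePairing_congr {f g : Fin d → (Fin d → ℤ) → ℝ}
    (hfg : ∀ i, ∀ k : M.faces i, f i k = g i k) (v : M.FaceField) :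
    facePairing f v = facePairing g v :=
  Finset.sum_congr rfl fun i _ => Finset.sum_congr rfl fun k hk => by rw [hfg i ⟨k, hk⟩]

lemma facePairing_smul (c : ℝ) (f : Fin d → (Fin d → ℤ) → ℝ) (v : M.FaceField) :
    facePairing (c • f) v = c * facePairing f v := by
  simp only [facePairing, Finset.mul_sum, Pi.smul_apply, smul_eq_mul]
  congr! 2
  ring

lemma facePairing_sub (f g : Fin d → (Fin d → ℤ) → ℝ) (v : M.FaceField) :
    facePairing (f - g) v = facePairing f v - facePairing g v := by
  simp only [facePairing, Pi.sub_apply, sub_mul, mul_sub, Finset.sum_sub_distrib]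

lemma eq_zero_of_facePairing_fv_nonpos {z : M.FaceField} (hz : facePairing (fv z) z ≤ 0) :
    z = 0 := by
  have hface : ∀ i, ∀ k ∈ M.faces i, 0 ≤ M.dualVol i k * (fv z i k * fv z i k) :=
    fun i k hk => mul_nonneg (dualVol_pos hk).le (mul_self_nonneg _)
  have hsum := fun i => Finset.sum_nonneg (hface i)
  have hzero := hz.antisymm (Finset.sum_nonneg fun i _ => hsum i)
  rw [facePairing, Finset.sum_eq_zero_iff_of_nonneg fun i _ => hsum i] at hzero
  funext i k
  have hk := (Finset.sum_eq_zero_iff_of_nonneg (hface i)).1 (hzero i (Finset.mem_univ i)) k k.2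
  have hfv := mul_self_eq_zero.1 ((mul_eq_zero.1 hk).resolve_left (dualVol_pos k.2).ne')
  exact (fv_of_mem z k.2).symm.trans hfv

lemma facePairing_conv_one_eq_zero {u : M.FaceField} (hu : divVel u = 0) (v : M.FaceField) :
    facePairing (conv (fun _ => 1) v u) v = 0 := by
  rw [facePairing_conv]
  refine Finset.sum_eq_zero fun i _ => Finset.sum_eq_zero fun k hk => ?_
  have hK : divMass (fun _ => 1) u k = 0 := congrFun hu ⟨k, mem_cells_of_mem_faces hk⟩
  have hL : divMass (fun _ => 1) u (k + e i) = 0 := congrFun hu ⟨_, add_e_mem_cells hk⟩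
  have hdual : dualDivMass (fun _ => 1) u i k = 0 := by
    refine (mul_eq_zero.1 ?_).resolve_left (dualVol_pos hk).ne'
    rw [dualVol_mul_dualDivMass _ _ hk, hK, hL, mul_zero, mul_zero, add_zero]
  simp only [hdual, zero_mul, zero_div, mul_zero]

theorem eq_zero_of_prediction {μ lam δt : ℝ} (hδt : 0 < δt) (hμ : 0 ≤ μ) (hμlam : 0 ≤ μ + lam)
    {u z : M.FaceField} (hu : divVel u = 0)
    (hz : ∀ i (k : M.faces i), (1 / δt) * z i k + conv (fun _ => 1) z u i k
      - divTau μ lam z i k = 0) : z = 0 := by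
  refine eq_zero_of_facePairing_fv_nonpos ?_
  rw [facePairing_congr (g := δt • (divTau μ lam z - conv (fun _ => 1) z u)) fun i k => ?_,
    facePairing_smul, facePairing_sub, facePairing_conv_one_eq_zero hu, sub_zero]
  · exact mul_nonpos_of_nonneg_of_nonpos hδt.le (facePairing_divTau_nonpos hμ hμlam z)
  · have := hz i k
    simp only [fv_of_mem z k.2, Pi.smul_apply, Pi.sub_apply, smul_eq_mul]
    field_simp at this
    linarith

/-- The two terms of the equation `z / δt + ∇ q = 0` are orthogonal. -/
theorem eq_zero_of_correction {δt : ℝ} (hδt : δt ≠ 0) {z : M.FaceField} {q : M.CellField}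
    (hz : divVel z = 0) (hq : integral q = 0)
    (h : ∀ i (k : M.faces i), (1 / δt) * z i k + grad q i k = 0) : z = 0 ∧ q = 0 := by
  have hz0 : z = 0 := by
    refine eq_zero_of_facePairing_fv_nonpos (le_of_eq ?_)
    rw [facePairing_congr (g := (-δt) • grad q) fun i k => ?_, facePairing_smul,
      facePairing_grad, hz]
    · simp only [integral, Pi.zero_apply, zero_mul, mul_zero, Finset.sum_const_zero, neg_zero]
    · have := h i k
      simp only [fv_of_mem z k.2, Pi.smul_apply, smul_eq_mul]
      field_simp at this
      linarith
  refine ⟨hz0, eq_zero_of_grad_eq_zero hq fun i k hk => ?_⟩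
  simpa only [hz0, Pi.zero_apply, mul_zero, zero_add] using h i ⟨k, hk⟩

namespace IsIncompressibleSol

variable {μ lam δt : ℝ} {N : ℕ} {V₀ : M.FaceField} {P₀ : M.CellField}
  {v w v' w' : ℕ → M.FaceField} {π π' : ℕ → M.CellField}

lemma divVel_eq_zero (H : IsIncompressibleSol μ lam δt N V₀ P₀ v w π) (hV₀ : divVel V₀ = 0)
    {n : ℕ} (hn : n ≤ N) : divVel (v n) = 0 := by
  cases n with
  | zero => rwa [H.init_velocity]
  | succ n => exact funext (H.div_free n hn)

lemma predicted_unique (hδt : 0 < δt) (hμ : 0 ≤ μ) (hμlam : 0 ≤ μ + lam) (hV₀ : divVel V₀ = 0)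
    (H : IsIncompressibleSol μ lam δt N V₀ P₀ v w π)
    (H' : IsIncompressibleSol μ lam δt N V₀ P₀ v' w' π') {n : ℕ} (hn : n < N) (hv : v' n = v n)
    (hπ : π' n = π n) : w' (n + 1) = w (n + 1) := by
  refine sub_eq_zero.1 (eq_zero_of_prediction hδt hμ hμlam (H.divVel_eq_zero hV₀ hn.le)
    fun i k => ?_)
  have h := H.prediction n hn i k
  have h' := H'.prediction n hn i k
  rw [hv, hπ] at h'
  rw [conv_sub, divTau_sub, Pi.sub_apply, Pi.sub_apply]
  linear_combination h' - h

lemma corrected_unique (hδt : δt ≠ 0) (H : IsIncompressibleSol μ lam δt N V₀ P₀ v w π)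
    (H' : IsIncompressibleSol μ lam δt N V₀ P₀ v' w' π') {n : ℕ} (hn : n < N) (hπ : π' n = π n)
    (hw : w' (n + 1) = w (n + 1)) : v' (n + 1) = v (n + 1) ∧ π' (n + 1) = π (n + 1) := by
  have hdiv : divVel (v' (n + 1) - v (n + 1)) = 0 := by
    rw [divVel_sub, funext (H.div_free n hn), funext (H'.div_free n hn)]
    exact sub_self 0
  have hmean : integral (π' (n + 1) - π (n + 1)) = 0 := by
    rw [integral_sub, H.mean_zero _ hn, H'.mean_zero _ hn, sub_zero]
  rw [← sub_eq_zero, ← sub_eq_zero (a := π' (n + 1))]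
  refine eq_zero_of_correction hδt hdiv hmean fun i k => ?_
  have h := H.correction n hn i k
  have h' := H'.correction n hn i k
  rw [hπ, hw] at h'
  rw [grad_sub, Pi.sub_apply, Pi.sub_apply]
  linear_combination h' - h

theorem unique (hδt : 0 < δt) (hμ : 0 ≤ μ) (hμlam : 0 ≤ μ + lam) (hV₀ : divVel V₀ = 0)
    (H : IsIncompressibleSol μ lam δt N V₀ P₀ v w π)
    (H' : IsIncompressibleSol μ lam δt N V₀ P₀ v' w' π') :
    (∀ n ≤ N, v' n = v n ∧ π' n = π n) ∧ ∀ n < N, w' (n + 1) = w (n + 1) := by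
  have hvπ : ∀ n ≤ N, v' n = v n ∧ π' n = π n := by
    intro n
    induction n with
    | zero =>
      exact fun _ => ⟨H'.init_velocity.trans H.init_velocity.symm,
        H'.init_pressure.trans H.init_pressure.symm⟩
    | succ n ih =>
      intro hn
      obtain ⟨hv, hπ⟩ := ih (Nat.le_of_succ_le hn)
      exact corrected_unique hδt.ne' H H' hn hπ (predicted_unique hδt hμ hμlam hV₀ H H' hn hv hπ)
  exact ⟨hvπ, fun n hn =>
    predicted_unique hδt hμ hμlam hV₀ H H' hn (hvπ n hn.le).1 (hvπ n hn.le).2⟩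

end IsIncompressibleSol

end MACMesh

/-! ### Integration over boxes -/

/-- The open box `∏_j (lo j, hi j)`. -/
def openBox {ι : Type*} (lo hi : ι → ℝ) : Set (ι → ℝ) :=
  Set.pi Set.univ fun j => Set.Ioo (lo j) (hi j)

section OpenBox

variable {ι : Type*} {lo hi : ι → ℝ}

lemma openBox_subset_Icc : openBox lo hi ⊆ Set.Icc lo hi :=
  fun _ hz => ⟨fun j => (hz j trivial).1.le, fun j => (hz j trivial).2.le⟩

lemma measurableSet_openBox [Finite ι] : MeasurableSet (openBox lo hi) :=
  MeasurableSet.univ_pi fun _ => measurableSet_Ioo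

variable [Fintype ι]

lemma integrableOn_openBox {F : (ι → ℝ) → ℝ} (hF : Continuous F) :
    IntegrableOn F (openBox lo hi) :=
  hF.integrableOn_Icc.mono_set openBox_subset_Icc

lemma volume_openBox_toReal (h : ∀ j, lo j ≤ hi j) :
    (volume (openBox lo hi)).toReal = ∏ j, (hi j - lo j) :=
  Real.volume_pi_Ioo_toReal h

lemma volume_openBox_ne_top : volume (openBox lo hi) ≠ ⊤ := by
  rw [openBox, Real.volume_pi_Ioo]
  exact ENNReal.prod_ne_top fun _ _ => ENNReal.ofReal_ne_top

end OpenBox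

section InsertCoord

variable {d : ℕ} (i : Fin d)

/-- The point whose `i`-th coordinate is `c`, the other ones being given by `z`. -/
def insertCoord (c : ℝ) (z : {j : Fin d // j ≠ i} → ℝ) : Fin d → ℝ :=
  fun j => if h : j = i then c else z ⟨j, h⟩

/-- The integral of `φ` over the section `y_i = c` of the box `openBox lo hi`. -/
noncomputable def sectionIntegral (φ : (Fin d → ℝ) → ℝ) (lo hi : Fin d → ℝ) (c : ℝ) : ℝ :=
  ∫ z in openBox (fun j : {j : Fin d // j ≠ i} => lo j) (fun j => hi j), φ (insertCoord i c z)

variable {i}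

lemma insertCoord_apply_self (c : ℝ) (z : {j : Fin d // j ≠ i} → ℝ) : insertCoord i c z i = c := by
  simp [insertCoord]

lemma insertCoord_eq_add_smul (c : ℝ) (z : {j : Fin d // j ≠ i} → ℝ) :
    insertCoord i c z = insertCoord i 0 z + c • Pi.single i 1 := by
  funext j
  by_cases h : j = i
  · subst h; simp [insertCoord]
  · simp [insertCoord, h]

lemma continuous_insertCoord :
    Continuous fun x : ({j : Fin d // j ≠ i} → ℝ) × ℝ => insertCoord i x.2 x.1 := by
  refine continuous_pi fun j => ?_
  by_cases h : j = i
  · simp only [insertCoord, h, dite_true]; fun_prop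
  · simp only [insertCoord, h, dite_false]; fun_prop

lemma hasDerivAt_insertCoord (z : {j : Fin d // j ≠ i} → ℝ) (t : ℝ) :
    HasDerivAt (fun t => insertCoord i t z) (Pi.single i 1) t := by
  rw [funext fun t => insertCoord_eq_add_smul t z]
  simpa using ((hasDerivAt_id t).smul_const (Pi.single i 1 : Fin d → ℝ)).const_add
    (insertCoord i 0 z)

lemma exists_measurePreserving_insertCoord :
    ∃ e : (({j : Fin d // j ≠ i} → ℝ) × ℝ) ≃ᵐ (Fin d → ℝ),
      MeasurePreserving e (volume.prod volume) volume ∧ ∀ x, e x = insertCoord i x.2 x.1 := by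
  let split := MeasurableEquiv.piEquivPiSubtypeProd (fun _ : Fin d => ℝ) (fun j => j = i)
  let single := MeasurableEquiv.funUnique {j : Fin d // j = i} ℝ
  have hsplit : MeasurePreserving split.symm volume volume := by
    convert (volume_preserving_piEquivPiSubtypeProd (fun _ : Fin d => ℝ) (· = i)).symm split
    all_goals rfl
  have hsingle : MeasurePreserving single.symm volume volume :=
    (volume_preserving_funUnique {j : Fin d // j = i} ℝ).symm single
  refine ⟨(MeasurableEquiv.prodComm.trans
      (single.symm.prodCongr (MeasurableEquiv.refl _))).trans split.symm,
    hsplit.comp ((hsingle.prod (MeasurePreserving.id _)).comp Measure.measurePreserving_swap),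
    fun x => funext fun j => ?_⟩
  by_cases h : j = i
  · subst h
    simp [insertCoord, split, single, MeasurableEquiv.piEquivPiSubtypeProd,
      Equiv.piEquivPiSubtypeProd, MeasurableEquiv.prodCongr, MeasurableEquiv.prodComm]
  · simp [insertCoord, h, split, single, MeasurableEquiv.piEquivPiSubtypeProd,
      Equiv.piEquivPiSubtypeProd, MeasurableEquiv.prodCongr, MeasurableEquiv.prodComm]

lemma insertCoord_mem_openBox_iff {lo hi : Fin d → ℝ} {c : ℝ} {z : {j : Fin d // j ≠ i} → ℝ} :
    insertCoord i c z ∈ openBox lo hi ↔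
      z ∈ openBox (fun j : {j : Fin d // j ≠ i} => lo j) (fun j => hi j)
        ∧ c ∈ Set.Ioo (lo i) (hi i) := by
  simp only [openBox, Set.mem_univ_pi]
  constructor
  · intro h
    exact ⟨fun j => by simpa [insertCoord, j.2] using h j, by simpa [insertCoord] using h i⟩
  · rintro ⟨hz, hc⟩ j
    by_cases hj : j = i
    · subst hj; simpa [insertCoord] using hc
    · simpa [insertCoord, hj] using hz ⟨j, hj⟩

lemma setIntegral_openBox {F : (Fin d → ℝ) → ℝ} (hF : Continuous F) (i : Fin d)
    (lo hi : Fin d → ℝ) :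
    ∫ y in openBox lo hi, F y
      = ∫ z in openBox (fun j : {j : Fin d // j ≠ i} => lo j) (fun j => hi j),
          ∫ t in Set.Ioo (lo i) (hi i), F (insertCoord i t z) := by
  obtain ⟨e, he, he_apply⟩ := exists_measurePreserving_insertCoord (i := i)
  have hpreimage : e ⁻¹' openBox lo hi
      = openBox (fun j : {j : Fin d // j ≠ i} => lo j) (fun j => hi j)
        ×ˢ Set.Ioo (lo i) (hi i) := by
    ext x
    rw [Set.mem_preimage, he_apply, insertCoord_mem_openBox_iff, Set.mem_prod]
  rw [← he.setIntegral_preimage_emb e.measurableEmbedding F, hpreimage]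
  simp only [he_apply]
  refine setIntegral_prod (fun x : ({j : Fin d // j ≠ i} → ℝ) × ℝ => F (insertCoord i x.2 x.1)) ?_
  exact ((hF.comp continuous_insertCoord).continuousOn.integrableOn_compact
    (isCompact_Icc.prod isCompact_Icc)).mono_set
    (Set.prod_mono openBox_subset_Icc Set.Ioo_subset_Icc_self)

lemma continuous_partialDeriv {φ : (Fin d → ℝ) → ℝ} (hφ : ContDiff ℝ 1 φ) (j : Fin d) :
    Continuous (partialDeriv j φ) :=
  (hφ.continuous_fderiv one_ne_zero).clm_apply continuous_const

lemma integral_affine_mul_partialDeriv {φ : (Fin d → ℝ) → ℝ} (hφ : ContDiff ℝ 1 φ)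
    {a b : ℝ} (hab : a ≤ b) (α β : ℝ) (z : {j : Fin d // j ≠ i} → ℝ) :
    ∫ t in Set.Ioo a b,
        (β * φ (insertCoord i t z) + (α + β * t) * partialDeriv i φ (insertCoord i t z))
      = (α + β * b) * φ (insertCoord i b z) - (α + β * a) * φ (insertCoord i a z) := by
  have hline : Continuous fun t => insertCoord i t z :=
    continuous_insertCoord.comp (Continuous.prodMk_right z)
  have hcont : Continuous fun t =>
      β * φ (insertCoord i t z) + (α + β * t) * partialDeriv i φ (insertCoord i t z) :=
    (continuous_const.mul (hφ.continuous.comp hline)).add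
      ((by fun_prop : Continuous fun t : ℝ => α + β * t).mul
        ((continuous_partialDeriv hφ i).comp hline))
  rw [← integral_Ioc_eq_integral_Ioo, ← intervalIntegral.integral_of_le hab]
  refine intervalIntegral.integral_eq_sub_of_hasDerivAt
    (f := fun t => (α + β * t) * φ (insertCoord i t z)) (fun t _ => ?_)
    (hcont.intervalIntegrable _ _)
  have haffine : HasDerivAt (fun t : ℝ => α + β * t) β t := by
    simpa using ((hasDerivAt_id t).const_mul β).const_add α
  exact haffine.mul (((hφ.differentiable one_ne_zero).differentiableAt.hasFDerivAt).comp_hasDerivAt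
    t (hasDerivAt_insertCoord z t))

theorem setIntegral_affine_mul_partialDeriv {φ : (Fin d → ℝ) → ℝ} (hφ : ContDiff ℝ 1 φ)
    {lo hi : Fin d → ℝ} (h : lo i ≤ hi i) (α β : ℝ) :
    ∫ y in openBox lo hi, (β * φ y + (α + β * y i) * partialDeriv i φ y)
      = (α + β * hi i) * sectionIntegral i φ lo hi (hi i)
        - (α + β * lo i) * sectionIntegral i φ lo hi (lo i) := by
  have hφc := hφ.continuous
  have hpartial := continuous_partialDeriv hφ i
  have hsection (c : ℝ) : Continuous fun z => φ (insertCoord i c z) :=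
    hφc.comp (continuous_insertCoord.comp (Continuous.prodMk_left c))
  rw [setIntegral_openBox (by fun_prop) i]
  simp only [insertCoord_apply_self, integral_affine_mul_partialDeriv hφ h α β]
  rw [integral_sub ((integrableOn_openBox (hsection _)).const_mul _)
    ((integrableOn_openBox (hsection _)).const_mul _), integral_const_mul, integral_const_mul]
  rfl

lemma sectionIntegral_congr (φ : (Fin d → ℝ) → ℝ) {lo hi lo' hi' : Fin d → ℝ}
    (hlo : ∀ j, j ≠ i → lo j = lo' j) (hhi : ∀ j, j ≠ i → hi j = hi' j) (c : ℝ) :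
    sectionIntegral i φ lo hi c = sectionIntegral i φ lo' hi' c := by
  have hbox : openBox (fun j : {j : Fin d // j ≠ i} => lo j) (fun j => hi j)
      = openBox (fun j : {j : Fin d // j ≠ i} => lo' j) (fun j => hi' j) := by
    rw [funext fun j : {j : Fin d // j ≠ i} => hlo j j.2,
      funext fun j : {j : Fin d // j ≠ i} => hhi j j.2]
  rw [sectionIntegral, hbox, sectionIntegral]

end InsertCoord

/-! ### `L²` convergence and Sobolev approximation -/

section L2

variable {d : ℕ} {Ω B : Set (Fin d → ℝ)} {f g ψ : (Fin d → ℝ) → ℝ} {W : ℝ}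

lemma l2Norm_nonneg (Ω : Set (Fin d → ℝ)) (f : (Fin d → ℝ) → ℝ) : 0 ≤ l2Norm Ω f :=
  ENNReal.toReal_nonneg

lemma l2Norm_sub_le (hf : MemLp f 2 (volume.restrict Ω)) (hg : MemLp g 2 (volume.restrict Ω)) :
    l2Norm Ω (fun y => f y - g y) ≤ l2Norm Ω f + l2Norm Ω g := by
  rw [l2Norm, l2Norm, l2Norm, ← ENNReal.toReal_add hf.2.ne hg.2.ne]
  exact ENNReal.toReal_mono (ENNReal.add_ne_top.2 ⟨hf.2.ne, hg.2.ne⟩)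
    (eLpNorm_sub_le hf.1 hg.1 (by norm_num))

lemma tendsto_l2Norm_zero {ι : Type*} {l : Filter ι} {f : ι → (Fin d → ℝ) → ℝ}
    (h : Tendsto (fun m => eLpNorm (f m) 2 (volume.restrict Ω)) l (𝓝 0)) :
    Tendsto (fun m => l2Norm Ω (f m)) l (𝓝 0) :=
  (ENNReal.tendsto_toReal ENNReal.zero_ne_top).comp h

lemma integrable_mul_of_memLp_two (hB : MeasurableSet B) (hBΩ : B ⊆ Ω) (hBfin : volume B ≠ ⊤)
    (hf : MemLp f 2 (volume.restrict Ω)) (hψm : Measurable ψ) (hψ : ∀ y ∈ B, |ψ y| ≤ W) :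
    Integrable (fun y => ψ y * f y) (volume.restrict B) := by
  have : IsFiniteMeasure (volume.restrict B) := ⟨by simpa using hBfin.lt_top⟩
  have hfB : Integrable f (volume.restrict B) :=
    (hf.mono_measure (Measure.restrict_mono hBΩ le_rfl)).integrable one_le_two
  exact hfB.bdd_mul (c := W) hψm.aestronglyMeasurable
    ((ae_restrict_iff' hB).2 (Eventually.of_forall hψ))

lemma setIntegral_abs_le (hBΩ : B ⊆ Ω) (hBfin : volume B ≠ ⊤)
    (hf : MemLp f 2 (volume.restrict Ω)) :
    ∫ y in B, |f y| ≤ √(volume B).toReal * l2Norm Ω f := by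
  have hrestrict : volume.restrict B ≤ volume.restrict Ω := Measure.restrict_mono hBΩ le_rfl
  have hfm : AEStronglyMeasurable f (volume.restrict B) := hf.1.mono_measure hrestrict
  have hL1 : ∫ y in B, |f y| = (eLpNorm f 1 (volume.restrict B)).toReal := by
    rw [eLpNorm_one_eq_lintegral_enorm, ← integral_norm_eq_lintegral_enorm hfm]
    rfl
  have hholder : eLpNorm f 1 (volume.restrict B)
      ≤ eLpNorm f 2 (volume.restrict Ω) * volume B ^ (1 / 2 : ℝ) := by
    refine (eLpNorm_le_eLpNorm_mul_rpow_measure_univ one_le_two hfm).trans ?_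
    rw [Measure.restrict_apply_univ]
    norm_num
    gcongr
  rw [hL1, l2Norm, mul_comm, Real.sqrt_eq_rpow, ENNReal.toReal_rpow, ← ENNReal.toReal_mul]
  exact ENNReal.toReal_mono
    (ENNReal.mul_ne_top hf.2.ne (ENNReal.rpow_ne_top_of_nonneg (by norm_num) hBfin)) hholder

lemma abs_setIntegral_mul_le (hB : MeasurableSet B) (hBΩ : B ⊆ Ω) (hBfin : volume B ≠ ⊤)
    (hf : MemLp f 2 (volume.restrict Ω)) (hW : 0 ≤ W) (hψ : ∀ y ∈ B, |ψ y| ≤ W) :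
    |∫ y in B, ψ y * f y| ≤ W * (√(volume B).toReal * l2Norm Ω f) := by
  have hfB : Integrable f (volume.restrict B) := by
    simpa using integrable_mul_of_memLp_two (ψ := 1) (W := 1) hB hBΩ hBfin hf measurable_one
      (by simp)
  calc |∫ y in B, ψ y * f y| ≤ ∫ y in B, W * |f y| := by
        rw [← Real.norm_eq_abs]
        refine norm_integral_le_of_norm_le (hfB.abs.const_mul W)
          ((ae_restrict_iff' hB).2 (Eventually.of_forall fun y hy => ?_))
        rw [Real.norm_eq_abs, abs_mul]
        gcongr
        exact hψ y hy
    _ = W * ∫ y in B, |f y| := integral_const_mul _ _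
    _ ≤ W * (√(volume B).toReal * l2Norm Ω f) := by
        gcongr
        exact setIntegral_abs_le hBΩ hBfin hf

lemma tendsto_setIntegral_mul (hB : MeasurableSet B) (hBΩ : B ⊆ Ω) (hBfin : volume B ≠ ⊤)
    (hf : MemLp f 2 (volume.restrict Ω)) {ι : Type*} {l : Filter ι} {F : ι → (Fin d → ℝ) → ℝ}
    (hF : ∀ m, MemLp (F m) 2 (volume.restrict Ω))
    (h : Tendsto (fun m => eLpNorm (fun y => F m y - f y) 2 (volume.restrict Ω)) l (𝓝 0))
    (hψm : Measurable ψ) (hW : 0 ≤ W) (hψ : ∀ y ∈ B, |ψ y| ≤ W) :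
    Tendsto (fun m => ∫ y in B, ψ y * F m y) l (𝓝 (∫ y in B, ψ y * f y)) := by
  rw [tendsto_iff_norm_sub_tendsto_zero]
  have hbound : Tendsto (fun m => W * (√(volume B).toReal * l2Norm Ω (fun y => F m y - f y)))
      l (𝓝 0) := by
    simpa using ((tendsto_l2Norm_zero h).const_mul √(volume B).toReal).const_mul W
  refine squeeze_zero (fun _ => norm_nonneg _) (fun m => ?_) hbound
  rw [← integral_sub (integrable_mul_of_memLp_two hB hBΩ hBfin (hF m) hψm hψ)
    (integrable_mul_of_memLp_two hB hBΩ hBfin hf hψm hψ), Real.norm_eq_abs]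
  simp only [← mul_sub]
  exact abs_setIntegral_mul_le hB hBΩ hBfin ((hF m).sub hf) hW hψ

end L2

section Sobolev

variable {d : ℕ} {Ω : Set (Fin d → ℝ)}

lemma hasCompactSupport_partialDeriv {φ : (Fin d → ℝ) → ℝ} (hφ : HasCompactSupport φ) (j : Fin d) :
    HasCompactSupport (partialDeriv j φ) :=
  (hφ.fderiv (𝕜 := ℝ)).comp_left (g := fun L : (Fin d → ℝ) →L[ℝ] ℝ => L (Pi.single j 1)) (by simp)

variable {f : (Fin d → ℝ) → ℝ} {g : Fin d → (Fin d → ℝ) → ℝ} {φ : ℕ → (Fin d → ℝ) → ℝ}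

namespace IsH10Approx

lemma contDiff_one (h : IsH10Approx Ω f g φ) (l : ℕ) : ContDiff ℝ 1 (φ l) :=
  (h.smooth l).of_le (by simp)

lemma memLp_val (h : IsH10Approx Ω f g φ) (l : ℕ) : MemLp (φ l) 2 (volume.restrict Ω) :=
  ((h.smooth l).continuous.memLp_of_hasCompactSupport (h.compactSupport l)).restrict _

lemma memLp_grad (h : IsH10Approx Ω f g φ) (j : Fin d) (l : ℕ) :
    MemLp (partialDeriv j (φ l)) 2 (volume.restrict Ω) :=
  ((continuous_partialDeriv (h.contDiff_one l) j).memLp_of_hasCompactSupport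
    (hasCompactSupport_partialDeriv (h.compactSupport l) j)).restrict _

end IsH10Approx

end Sobolev

/-! ### Face means of functions of `H¹₀(Ω)` -/

namespace MACMesh

variable {d : ℕ} {M : MACMesh d} {i : Fin d} {k : Fin d → ℤ}

variable (M) in
/-- The lower corner of the cell `k`. -/
def lowerCorner (k : Fin d → ℤ) : Fin d → ℝ := fun j => M.x j (k j)

variable (M) in
/-- The upper corner of the cell `k`. -/
def upperCorner (k : Fin d → ℤ) : Fin d → ℝ := fun j => M.x j (k j + 1)

variable (M) in
/-- The part of the cell `k` at a distance less than `ε` from its upper face in direction `i`. -/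
def slab (i : Fin d) (k : Fin d → ℤ) (ε : ℝ) : Set (Fin d → ℝ) :=
  openBox (Function.update (M.lowerCorner k) i (M.x i (k i + 1) - ε)) (M.upperCorner k)

variable (M) in
/-- The mean of `f` over the upper face of the cell `k` in the direction `i`, computed from the
values of `f` and of `g = ∂_i f` in the slab of width `ε` below that face: this makes sense for
`L²` functions, and agrees with the mean over the face when `f` is smooth. -/
noncomputable def slabMean (f g : (Fin d → ℝ) → ℝ) (i : Fin d) (k : Fin d → ℤ) (ε : ℝ) : ℝ :=
  (ε * M.area i k)⁻¹ * ((∫ y in M.slab i k ε, 1 * f y)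
    + ∫ y in M.slab i k ε, (ε - M.x i (k i + 1) + y i) * g y)

lemma upperCorner_sub_lowerCorner {j : Fin d} (h : 0 ≤ k j ∧ k j < M.n j) :
    M.upperCorner k j - M.lowerCorner k j = M.width j k := (width_of_mem h).symm

lemma lowerCorner_le_upperCorner {j : Fin d} (h : 0 ≤ k j ∧ k j < M.n j) :
    M.lowerCorner k j ≤ M.upperCorner k j :=
  (M.x_lt j (k j) h.1 h.2).le

lemma x_le_x (j : Fin d) {a b : ℤ} (ha : 0 ≤ a) (hab : a ≤ b) (hb : b ≤ M.n j) :
    M.x j a ≤ M.x j b := by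
  induction b, hab using Int.leInduction with
  | base => exact le_rfl
  | succ b hab ih => exact (ih (by omega)).trans (M.x_lt j b (by omega) (by omega)).le

lemma cellBox_subset_domain (hk : k ∈ M.cells) : M.cellBox k ⊆ M.domain := by
  intro y hy j _
  obtain ⟨h0, hn⟩ := mem_cells.1 hk j
  obtain ⟨hlo, hhi⟩ := hy j trivial
  exact ⟨(x_le_x j le_rfl h0 hn.le).trans_lt hlo,
    hhi.trans_le (x_le_x j (by omega) (by omega) le_rfl)⟩

lemma measurableSet_cellBox (k : Fin d → ℤ) : MeasurableSet (M.cellBox k) :=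
  measurableSet_openBox

lemma volume_cellBox_ne_top (k : Fin d → ℤ) : volume (M.cellBox k) ≠ ⊤ := volume_openBox_ne_top

lemma volume_cellBox (hk : k ∈ M.cells) : (volume (M.cellBox k)).toReal = M.vol k :=
  (volume_openBox_toReal fun j => lowerCorner_le_upperCorner (mem_cells.1 hk j)).trans
    (Finset.prod_congr rfl fun j _ => upperCorner_sub_lowerCorner (mem_cells.1 hk j))

lemma slab_subset_domain (hk : k ∈ M.cells) {ε : ℝ} (hε : ε ≤ M.width i k) :
    M.slab i k ε ⊆ M.domain := by
  refine Set.Subset.trans (b := M.cellBox k) (fun y hy j _ => ?_) (cellBox_subset_domain hk)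
  have hyj : Function.update (M.lowerCorner k) i (M.x i (k i + 1) - ε) j < y j
      ∧ y j < M.upperCorner k j := hy j trivial
  by_cases hj : j = i
  · subst hj
    rw [width_of_mem (mem_cells.1 hk j)] at hε
    rw [Function.update_self] at hyj
    exact ⟨by linarith [hyj.1], hyj.2⟩
  · rwa [Function.update_of_ne hj] at hyj

lemma volume_slab (hk : k ∈ M.cells) {ε : ℝ} (hε : 0 ≤ ε) :
    (volume (M.slab i k ε)).toReal = ε * M.area i k := by
  rw [slab, volume_openBox_toReal, ← Finset.mul_prod_erase _ _ (Finset.mem_univ i), area]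
  · congr 1
    · simp [upperCorner]
    · refine Finset.prod_congr rfl fun j hj => ?_
      rw [Function.update_of_ne (Finset.ne_of_mem_erase hj),
        upperCorner_sub_lowerCorner (mem_cells.1 hk j)]
  · intro j
    by_cases hj : j = i
    · subst hj
      simp [upperCorner, hε]
    · rw [Function.update_of_ne hj]
      exact lowerCorner_le_upperCorner (mem_cells.1 hk j)

lemma abs_slab_weight_le {ε : ℝ} {y : Fin d → ℝ} (hy : y ∈ M.slab i k ε) :
    |ε - M.x i (k i + 1) + y i| ≤ ε := by
  have hyi : Function.update (M.lowerCorner k) i (M.x i (k i + 1) - ε) i < y i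
      ∧ y i < M.x i (k i + 1) := hy i trivial
  rw [Function.update_self] at hyi
  rw [abs_le]
  constructor <;> linarith [hyi.1, hyi.2]

lemma smoothFaceMean_eq_sectionIntegral (φ : (Fin d → ℝ) → ℝ)
    (hk : ∀ j, j ≠ i → 0 ≤ k j ∧ k j < M.n j) :
    M.smoothFaceMean φ i k = (M.area i k)⁻¹
      * sectionIntegral i φ (M.lowerCorner k) (M.upperCorner k) (M.x i (k i + 1)) := by
  have hvol : (volume (openBox (fun j : {j : Fin d // j ≠ i} => M.lowerCorner k j)
      (fun j => M.upperCorner k j))).toReal = M.area i k := by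
    rw [volume_openBox_toReal fun j : {j // j ≠ i} => lowerCorner_le_upperCorner (hk j j.2), area,
      Finset.prod_subtype (p := fun j => j ≠ i) _ (by simp)]
    exact Finset.prod_congr rfl fun j _ => upperCorner_sub_lowerCorner (hk j j.2)
  rw [smoothFaceMean, setAverage_eq, ← hvol]
  rfl

lemma smoothFaceMean_eq_slabMean {φ : (Fin d → ℝ) → ℝ} (hφ : ContDiff ℝ 1 φ) (hk : k ∈ M.cells)
    {ε : ℝ} (hε : 0 < ε) :
    M.smoothFaceMean φ i k = M.slabMean φ (partialDeriv i φ) i k ε := by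
  have hφc := hφ.continuous
  have hpartial := continuous_partialDeriv hφ i
  -- The weight `y_i - (x_i - ε)` vanishes on the lower side of the slab and equals `ε` on the face.
  have hparts := setIntegral_affine_mul_partialDeriv hφ (i := i)
    (lo := Function.update (M.lowerCorner k) i (M.x i (k i + 1) - ε)) (hi := M.upperCorner k)
    (by simp [upperCorner, hε.le]) (ε - M.x i (k i + 1)) 1
  rw [integral_add (integrableOn_openBox (by fun_prop)) (integrableOn_openBox (by fun_prop))]
    at hparts
  simp only [one_mul, Function.update_self] at hparts
  simp only [slabMean, slab, one_mul]
  rw [hparts, smoothFaceMean_eq_sectionIntegral φ fun j _ => mem_cells.1 hk j,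
    sectionIntegral_congr φ
      (lo := Function.update (M.lowerCorner k) i (M.x i (k i + 1) - ε)) (lo' := M.lowerCorner k)
      (fun j hj => Function.update_of_ne hj _ _) fun j _ => rfl]
  have hA := (area_pos i hk).ne'
  simp only [upperCorner]
  field_simp
  ring

lemma slabMean_sub {f f' g g' : (Fin d → ℝ) → ℝ}
    (hf : MemLp f 2 (volume.restrict M.domain)) (hf' : MemLp f' 2 (volume.restrict M.domain))
    (hg : MemLp g 2 (volume.restrict M.domain)) (hg' : MemLp g' 2 (volume.restrict M.domain))
    (hk : k ∈ M.cells) {ε : ℝ} (hε : ε ≤ M.width i k) :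
    M.slabMean f g i k ε - M.slabMean f' g' i k ε
      = M.slabMean (fun y => f y - f' y) (fun y => g y - g' y) i k ε := by
  have hint {h ψ : (Fin d → ℝ) → ℝ} {W : ℝ} (hh : MemLp h 2 (volume.restrict M.domain))
      (hψ : Measurable ψ) (hW : ∀ y ∈ M.slab i k ε, |ψ y| ≤ W) :
      IntegrableOn (fun y => ψ y * h y) (M.slab i k ε) :=
    integrable_mul_of_memLp_two measurableSet_openBox (slab_subset_domain hk hε)
      volume_openBox_ne_top hh hψ hW
  have hone : ∀ y ∈ M.slab i k ε, |(1 : ℝ)| ≤ 1 := fun y _ => by simp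
  have hweight : ∀ y ∈ M.slab i k ε, |ε - M.x i (k i + 1) + y i| ≤ ε :=
    fun y => abs_slab_weight_le
  simp only [slabMean, mul_sub (1 : ℝ), mul_sub (ε - M.x i (k i + 1) + _)]
  rw [MeasureTheory.integral_sub (hint hf measurable_const hone) (hint hf' measurable_const hone),
    MeasureTheory.integral_sub (hint hg (by fun_prop) hweight) (hint hg' (by fun_prop) hweight)]
  ring

lemma abs_slabMean_le {f g : (Fin d → ℝ) → ℝ} (hf : MemLp f 2 (volume.restrict M.domain))
    (hg : MemLp g 2 (volume.restrict M.domain)) (hk : k ∈ M.cells) {ε : ℝ} (hε : 0 < ε)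
    (hε' : ε ≤ M.width i k) :
    |M.slabMean f g i k ε|
      ≤ (√(ε * M.area i k))⁻¹ * (l2Norm M.domain f + ε * l2Norm M.domain g) := by
  have hsub := slab_subset_domain hk hε'
  have hval := abs_setIntegral_mul_le (B := M.slab i k ε) measurableSet_openBox hsub
    volume_openBox_ne_top hf (ψ := fun _ => 1) zero_le_one fun y _ => by simp
  have hgrad := abs_setIntegral_mul_le (B := M.slab i k ε) measurableSet_openBox hsub
    volume_openBox_ne_top hg hε.le fun y => abs_slab_weight_le
  rw [volume_slab hk hε.le] at hval hgrad
  have hpos : 0 < ε * M.area i k := mul_pos hε (area_pos i hk)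
  rw [slabMean, abs_mul, abs_of_pos (inv_pos.2 hpos)]
  refine (mul_le_mul_of_nonneg_left ((abs_add_le _ _).trans (add_le_add hval hgrad))
    (inv_pos.2 hpos).le).trans (le_of_eq ?_)
  nth_rw 1 [← Real.mul_self_sqrt hpos.le]
  field_simp [(Real.sqrt_pos.2 hpos).ne']

lemma tendsto_smoothFaceMean_slabMean {f : (Fin d → ℝ) → ℝ} {g : Fin d → (Fin d → ℝ) → ℝ}
    {φ : ℕ → (Fin d → ℝ) → ℝ} (hfg : HasH10Grad M.domain f g) (hφ : IsH10Approx M.domain f g φ)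
    (hk : k ∈ M.cells) {ε : ℝ} (hε : 0 < ε) (hε' : ε ≤ M.width i k) :
    Tendsto (fun l => M.smoothFaceMean (φ l) i k) atTop (𝓝 (M.slabMean f (g i) i k ε)) := by
  simp only [fun l => smoothFaceMean_eq_slabMean (hφ.contDiff_one l) hk (i := i) hε]
  have hsub := slab_subset_domain hk hε'
  refine Tendsto.const_mul _ (Tendsto.add ?_ ?_)
  · exact tendsto_setIntegral_mul measurableSet_openBox hsub volume_openBox_ne_top
      hfg.memLp_val hφ.memLp_val hφ.tendsto_val measurable_const zero_le_one (fun y _ => by simp)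
  · exact tendsto_setIntegral_mul measurableSet_openBox hsub volume_openBox_ne_top
      (hfg.memLp_grad i) (hφ.memLp_grad i) (hφ.tendsto_grad i) (by fun_prop) hε.le
      (fun y => abs_slab_weight_le)

lemma slabMean_eq_slabMean_width {f : (Fin d → ℝ) → ℝ} {g : Fin d → (Fin d → ℝ) → ℝ}
    (hfg : HasH10Grad M.domain f g) (hk : k ∈ M.cells) {ε : ℝ} (hε : 0 < ε)
    (hε' : ε ≤ M.width i k) :
    M.slabMean f (g i) i k ε = M.slabMean f (g i) i k (M.width i k) := by
  obtain ⟨φ, hφ⟩ := hfg.approx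
  exact tendsto_nhds_unique (tendsto_smoothFaceMean_slabMean hfg hφ hk hε hε')
    (tendsto_smoothFaceMean_slabMean hfg hφ hk (width_pos (mem_cells.1 hk i)) le_rfl)

lemma isFaceMean_slabMean {f : (Fin d → ℝ) → ℝ} {g : Fin d → (Fin d → ℝ) → ℝ}
    (hfg : HasH10Grad M.domain f g) (hk : k ∈ M.cells) :
    M.IsFaceMean f i k (M.slabMean f (g i) i k (M.width i k)) := by
  obtain ⟨φ, hφ⟩ := hfg.approx
  exact ⟨g, hfg, φ, hφ,
    tendsto_smoothFaceMean_slabMean hfg hφ hk (width_pos (mem_cells.1 hk i)) le_rfl⟩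

lemma tendsto_sqrt_mul_zero (B : ℝ) : Tendsto (fun ε => √ε * B) (𝓝[>] 0) (𝓝 0) := by
  have : Tendsto (fun ε => √ε * B) (𝓝 0) (𝓝 (√0 * B)) :=
    (Real.continuous_sqrt.tendsto 0).mul_const _
  rw [Real.sqrt_zero, zero_mul] at this
  exact this.mono_left nhdsWithin_le_nhds

lemma tendsto_slabMean_width {f g : ℕ → (Fin d → ℝ) → ℝ} {f' g' : (Fin d → ℝ) → ℝ} {C : ℝ}
    (hf : ∀ m, MemLp (f m) 2 (volume.restrict M.domain))
    (hf' : MemLp f' 2 (volume.restrict M.domain))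
    (hg : ∀ m, MemLp (g m) 2 (volume.restrict M.domain))
    (hg' : MemLp g' 2 (volume.restrict M.domain)) (hk : k ∈ M.cells)
    (hslab : ∀ m ε, 0 < ε → ε ≤ M.width i k →
      M.slabMean (f m) (g m) i k ε = M.slabMean (f m) (g m) i k (M.width i k))
    (hslab' : ∀ ε, 0 < ε → ε ≤ M.width i k →
      M.slabMean f' g' i k ε = M.slabMean f' g' i k (M.width i k))
    (hlim : Tendsto (fun m => eLpNorm (fun y => f m y - f' y) 2 (volume.restrict M.domain))
      atTop (𝓝 0)) (hC : ∀ m, l2Norm M.domain (g m) ≤ C) :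
    Tendsto (fun m => M.slabMean (f m) (g m) i k (M.width i k)) atTop
      (𝓝 (M.slabMean f' g' i k (M.width i k))) := by
  set G := C + l2Norm M.domain g'
  -- The gradients contribute `O(√ε)`, uniformly in `m`, and the values `o(1)` for each fixed `ε`.
  have hbound (m : ℕ) (ε : ℝ) (hε : 0 < ε) (hε' : ε ≤ M.width i k) :
      |M.slabMean (f m) (g m) i k (M.width i k) - M.slabMean f' g' i k (M.width i k)|
        ≤ (√(ε * M.area i k))⁻¹ * l2Norm M.domain (fun y => f m y - f' y)
          + √ε * ((√(M.area i k))⁻¹ * G) := by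
    rw [← hslab m ε hε hε', ← hslab' ε hε hε', slabMean_sub (hf m) hf' (hg m) hg' hk hε']
    refine (abs_slabMean_le ((hf m).sub hf') ((hg m).sub hg') hk hε hε').trans ?_
    have hG : l2Norm M.domain (fun y => g m y - g' y) ≤ G :=
      (l2Norm_sub_le (hg m) hg').trans (by linarith [hC m])
    have hscale : (√(ε * M.area i k))⁻¹ * (ε * G) = √ε * ((√(M.area i k))⁻¹ * G) := by
      have hA := Real.sqrt_pos.2 (area_pos i hk)
      rw [Real.sqrt_mul hε.le]
      nth_rw 2 [← Real.mul_self_sqrt hε.le]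
      field_simp [hA.ne']
    rw [mul_add, ← hscale]
    gcongr
    · exact le_rfl
    · exact hG
  rw [Metric.tendsto_atTop]
  intro η hη
  obtain ⟨ε, hsmall, hε⟩ := (((tendsto_sqrt_mul_zero ((√(M.area i k))⁻¹ * G)).eventually
    (gt_mem_nhds (half_pos hη))).and (Ioc_mem_nhdsGT (width_pos (mem_cells.1 hk i)))).exists
  have hval := (tendsto_l2Norm_zero hlim).const_mul (√(ε * M.area i k))⁻¹
  rw [mul_zero] at hval
  obtain ⟨m₀, hm₀⟩ := eventually_atTop.1 (hval.eventually (gt_mem_nhds (half_pos hη)))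
  refine ⟨m₀, fun m hm => ?_⟩
  rw [Real.dist_eq]
  linarith [hbound m ε hε.1 hε.2, hm₀ m hm]

lemma IsFaceMean.eq_slabMean {f : (Fin d → ℝ) → ℝ} {g : Fin d → (Fin d → ℝ) → ℝ} {c : ℝ}
    (hc : M.IsFaceMean f i k c) (hfg : HasH10Grad M.domain f g) (hk : k ∈ M.cells) :
    c = M.slabMean f (g i) i k (M.width i k) := by
  obtain ⟨g', hfg', φ, hφ, hlim⟩ := hc
  rw [tendsto_nhds_unique hlim (tendsto_smoothFaceMean_slabMean hfg' hφ hk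
    (width_pos (mem_cells.1 hk i)) le_rfl)]
  exact tendsto_nhds_unique tendsto_const_nhds <|
    tendsto_slabMean_width (f := fun _ => f) (g := fun _ => g' i) (fun _ => hfg'.memLp_val)
      hfg.memLp_val (fun _ => hfg'.memLp_grad i) (hfg.memLp_grad i) hk
      (fun _ _ => slabMean_eq_slabMean_width hfg' hk) (fun _ => slabMean_eq_slabMean_width hfg hk)
      (by simp) fun _ => le_rfl

theorem tendsto_faceMean {f : ℕ → (Fin d → ℝ) → ℝ} {g : ℕ → Fin d → (Fin d → ℝ) → ℝ}
    {f' : (Fin d → ℝ) → ℝ} {g' : Fin d → (Fin d → ℝ) → ℝ}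
    (hfg : ∀ m, HasH10Grad M.domain (f m) (g m)) (hfg' : HasH10Grad M.domain f' g')
    {C : ℝ} (hC : ∀ m, l2Norm M.domain (g m i) ≤ C)
    (hlim : Tendsto (fun m => eLpNorm (fun y => f m y - f' y) 2 (volume.restrict M.domain))
      atTop (𝓝 0)) (hk : k ∈ M.cells) {c : ℕ → ℝ} {c' : ℝ}
    (hc : ∀ m, M.IsFaceMean (f m) i k (c m)) (hc' : M.IsFaceMean f' i k c') :
    Tendsto c atTop (𝓝 c') := by
  rw [hc'.eq_slabMean hfg' hk, funext fun m => (hc m).eq_slabMean (hfg m) hk]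
  exact tendsto_slabMean_width (fun m => (hfg m).memLp_val) hfg'.memLp_val
    (fun m => (hfg m).memLp_grad i) (hfg'.memLp_grad i) hk
    (fun m _ => slabMean_eq_slabMean_width (hfg m) hk) (fun _ => slabMean_eq_slabMean_width hfg' hk)
    hlim hC

/-! ### The divergence of the face means -/

lemma area_sub_e (i : Fin d) (k : Fin d → ℤ) : M.area i (k - e i) = M.area i k := by
  refine Finset.prod_congr rfl fun j hj => ?_
  rw [width, width, sub_e_apply_of_ne _ (Finset.ne_of_mem_erase hj)]

lemma smoothFaceMean_eq_zero {φ : (Fin d → ℝ) → ℝ} (hφ : tsupport φ ⊆ M.domain)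
    (h : M.x i (k i + 1) ∉ Set.Ioo (M.x i 0) (M.x i (M.n i))) : M.smoothFaceMean φ i k = 0 := by
  have hzero (z) : φ (insertCoord i (M.x i (k i + 1)) z) = 0 := by
    refine image_eq_zero_of_notMem_tsupport fun hz => h ?_
    simpa only [insertCoord_apply_self] using hφ hz i trivial
  rw [smoothFaceMean, setAverage_eq]
  exact smul_eq_zero_of_right _ (integral_eq_zero_of_ae (Eventually.of_forall hzero))

lemma tendsto_smoothFaceMean {f : (Fin d → ℝ) → ℝ} {g : Fin d → (Fin d → ℝ) → ℝ}
    {φ : ℕ → (Fin d → ℝ) → ℝ} (hfg : HasH10Grad M.domain f g) (hφ : IsH10Approx M.domain f g φ)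
    {U : M.FaceField} (hU : ∀ k : M.faces i, M.IsFaceMean f i k (U i k))
    (hk : k ∈ M.cells ∨ k + e i ∈ M.cells) :
    Tendsto (fun l => M.smoothFaceMean (φ l) i k) atTop (𝓝 (fv U i k)) := by
  by_cases hface : k ∈ M.faces i
  · have hcell := mem_cells_of_mem_faces hface
    rw [fv_of_mem U hface, (hU ⟨k, hface⟩).eq_slabMean hfg hcell]
    exact tendsto_smoothFaceMean_slabMean hfg hφ hcell (width_pos (mem_cells.1 hcell i)) le_rfl
  · have hboundary : k i + 1 = 0 ∨ k i + 1 = M.n i := by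
      by_contra! hne
      have hbounds : 0 ≤ k i ∧ k i + 1 < M.n i := by
        rcases hk with hk | hk
        · have := mem_cells.1 hk i; omega
        · have := mem_cells.1 hk i; rw [add_e_apply_self] at this; omega
      refine hface (mem_faces.2 ⟨mem_cells.2 fun j => ?_, mem_cells.2 fun j => ?_⟩) <;>
        rcases eq_or_ne j i with rfl | hj
      · omega
      · rcases hk with hk | hk
        · exact mem_cells.1 hk j
        · simpa only [add_e_apply_of_ne k hj] using mem_cells.1 hk j
      · rw [add_e_apply_self]; omega
      · rw [add_e_apply_of_ne k hj]
        rcases hk with hk | hk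
        · exact mem_cells.1 hk j
        · simpa only [add_e_apply_of_ne k hj] using mem_cells.1 hk j
    rw [fv_of_notMem U hface]
    exact tendsto_const_nhds.congr fun l => (smoothFaceMean_eq_zero (hφ.support_subset l)
      (by rcases hboundary with h | h <;> simp [h])).symm

lemma setIntegral_cellBox_partialDeriv {φ : (Fin d → ℝ) → ℝ} (hφ : ContDiff ℝ 1 φ)
    (hk : k ∈ M.cells) :
    ∫ y in M.cellBox k, partialDeriv i φ y
      = M.area i k * M.smoothFaceMean φ i k
        - M.area i (k - e i) * M.smoothFaceMean φ i (k - e i) := by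
  have hk' := mem_cells.1 hk
  have hparts := setIntegral_affine_mul_partialDeriv hφ (lowerCorner_le_upperCorner (hk' i)) 1 0
  simp only [zero_mul, zero_add, add_zero, one_mul] at hparts
  have hA := (area_pos i hk).ne'
  rw [smoothFaceMean_eq_sectionIntegral _ fun j _ => hk' j, smoothFaceMean_eq_sectionIntegral _
      fun j hj => by rw [sub_e_apply_of_ne k hj]; exact hk' j,
    area_sub_e, sub_e_apply_self, sub_add_cancel,
    sectionIntegral_congr φ (lo := M.lowerCorner (k - e i)) (lo' := M.lowerCorner k)
      (hi := M.upperCorner (k - e i)) (hi' := M.upperCorner k)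
      (fun j hj => by simp only [lowerCorner, sub_e_apply_of_ne k hj])
      (fun j hj => by simp only [upperCorner, sub_e_apply_of_ne k hj]),
    mul_inv_cancel_left₀ hA, mul_inv_cancel_left₀ hA]
  exact hparts

lemma area_mul_fv_sub_eq_setIntegral {f : (Fin d → ℝ) → ℝ} {g : Fin d → (Fin d → ℝ) → ℝ}
    (hfg : HasH10Grad M.domain f g) {U : M.FaceField}
    (hU : ∀ k : M.faces i, M.IsFaceMean f i k (U i k)) (hk : k ∈ M.cells) :
    M.area i k * fv U i k - M.area i (k - e i) * fv U i (k - e i)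
      = ∫ y in M.cellBox k, g i y := by
  obtain ⟨φ, hφ⟩ := hfg.approx
  have hcell := tendsto_setIntegral_mul (measurableSet_cellBox k) (cellBox_subset_domain hk)
    (volume_cellBox_ne_top k) (hfg.memLp_grad i) (hφ.memLp_grad i) (hφ.tendsto_grad i)
    (measurable_const (a := (1 : ℝ))) zero_le_one fun y _ => by simp
  simp only [one_mul] at hcell
  rw [funext fun l => setIntegral_cellBox_partialDeriv (i := i) (hφ.contDiff_one l) hk] at hcell
  exact tendsto_nhds_unique (((tendsto_smoothFaceMean hfg hφ hU (.inl hk)).const_mul _).sub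
    ((tendsto_smoothFaceMean hfg hφ hU (.inr (by rwa [sub_add_cancel]))).const_mul _)) hcell

theorem divVel_eq_setIntegral {f : Fin d → (Fin d → ℝ) → ℝ}
    {g : Fin d → Fin d → (Fin d → ℝ) → ℝ} (hfg : ∀ i, HasH10Grad M.domain (f i) (g i))
    {U : M.FaceField} (hU : M.IsFaceInterpolate f U) (k : M.cells) :
    divVel U k = (1 / M.vol k) * ∫ y in M.cellBox k, ∑ i, g i i y := by
  rw [divVel_apply, integral_finsetSum]
  · simp only [fun i => area_mul_fv_sub_eq_setIntegral (hfg i) (hU i) k.2]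
  · intro i _
    simpa only [one_mul] using integrable_mul_of_memLp_two (measurableSet_cellBox _)
      (cellBox_subset_domain k.2) (volume_cellBox_ne_top _) ((hfg i).memLp_grad i)
      (measurable_const (a := (1 : ℝ))) (W := 1) fun y _ => by simp

lemma abs_divVel_le {f : Fin d → (Fin d → ℝ) → ℝ} {g : Fin d → Fin d → (Fin d → ℝ) → ℝ}
    (hfg : ∀ i, HasH10Grad M.domain (f i) (g i)) {U : M.FaceField}
    (hU : M.IsFaceInterpolate f U) (k : M.cells) :
    |divVel U k| ≤ (1 / M.vol k) * (√(M.vol k) * l2Norm M.domain fun y => ∑ i, g i i y) := by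
  have hv := vol_pos k.2
  rw [divVel_eq_setIntegral hfg hU k, abs_mul, abs_of_pos (one_div_pos.2 hv), ← volume_cellBox k.2]
  gcongr
  exact abs_integral_le_integral_abs.trans (setIntegral_abs_le (cellBox_subset_domain k.2)
    (volume_cellBox_ne_top _) (memLp_finsetSum _ fun i _ => (hfg i).memLp_grad i))

end MACMesh

/-! ### Stability of `H¹₀(Ω)` under bounded `L²` limits -/

section Hilbert

variable {E : Type*} [NormedAddCommGroup E]

lemma cauchySeq_of_sq_norm_sub_le {p : ℕ → E} {R : ℝ} (hR : ∀ n, ‖p n‖ ≤ R)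
    (h : ∀ m n, m ≤ n → ‖p n - p m‖ ^ 2 ≤ ‖p n‖ ^ 2 - ‖p m‖ ^ 2) : CauchySeq p := by
  have hmono : Monotone fun m => ‖p m‖ ^ 2 := fun m n hmn =>
    sub_nonneg.1 ((sq_nonneg _).trans (h m n hmn))
  have hbdd : BddAbove (Set.range fun m => ‖p m‖ ^ 2) :=
    ⟨R ^ 2, Set.forall_mem_range.2 fun m => pow_le_pow_left₀ (norm_nonneg _) (hR m) 2⟩
  rw [Metric.cauchySeq_iff']
  intro ε hε
  obtain ⟨m, hm⟩ := Metric.cauchySeq_iff'.1 (tendsto_atTop_ciSup hmono hbdd).cauchySeq (ε ^ 2)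
    (by positivity)
  refine ⟨m, fun n hn => ?_⟩
  rw [dist_eq_norm]
  exact lt_of_pow_lt_pow_left₀ 2 hε.le
    ((h m n hn).trans_lt ((le_abs_self _).trans_lt (hm n hn)))

variable [InnerProductSpace ℝ E] [CompleteSpace E]

lemma exists_forall_sq_norm_le_inner {K : Set E} (hne : K.Nonempty) (hclosed : IsClosed K)
    (hconv : Convex ℝ K) : ∃ p ∈ K, ∀ w ∈ K, ‖p‖ ^ 2 ≤ inner ℝ p w := by
  obtain ⟨p, hp, hmin⟩ :=
    exists_norm_eq_iInf_of_complete_convex hne hclosed.isComplete hconv 0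
  refine ⟨p, hp, fun w hw => ?_⟩
  have := (norm_eq_iInf_iff_real_inner_le_zero hconv hp).1 hmin w hw
  rw [zero_sub, inner_neg_left, inner_sub_right, real_inner_self_eq_norm_sq] at this
  linarith

theorem nonempty_iInter_of_antitone_convex {K : ℕ → Set E} (hK : Antitone K)
    (hne : ∀ m, (K m).Nonempty) (hclosed : ∀ m, IsClosed (K m)) (hconv : ∀ m, Convex ℝ (K m))
    {R : ℝ} (hR : K 0 ⊆ Metric.closedBall 0 R) : (⋂ m, K m).Nonempty := by
  -- The points of least norm of the `K m` form a Cauchy sequence.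
  choose p hp hmin using fun m =>
    exists_forall_sq_norm_le_inner (hne m) (hclosed m) (hconv m)
  have hcauchy : CauchySeq p := by
    refine cauchySeq_of_sq_norm_sub_le (R := R)
      (fun n => by simpa using hR (hK (Nat.zero_le n) (hp n))) fun m n hmn => ?_
    rw [norm_sub_sq_real, real_inner_comm]
    linarith [hmin m (p n) (hK hmn (hp n))]
  obtain ⟨y, hy⟩ := cauchySeq_tendsto_of_complete hcauchy
  refine ⟨y, Set.mem_iInter.2 fun m => (hclosed m).mem_of_tendsto hy ?_⟩
  filter_upwards [eventually_ge_atTop m] with n hn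
  exact hK hn (hp n)

theorem exists_forall_mem_closure_convexHull_tail {x : ℕ → E} {R : ℝ} (hx : ∀ m, ‖x m‖ ≤ R) :
    ∃ y, ∀ m, y ∈ closure (convexHull ℝ (x '' Set.Ici m)) := by
  obtain ⟨y, hy⟩ := nonempty_iInter_of_antitone_convex
    (K := fun m => closure (convexHull ℝ (x '' Set.Ici m))) (R := R)
    (fun m n h => closure_mono (convexHull_mono (Set.image_mono (Set.Ici_subset_Ici.2 h))))
    (fun m => ⟨x m, subset_closure (subset_convexHull ℝ _ ⟨m, Set.mem_Ici.2 le_rfl, rfl⟩)⟩)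
    (fun _ => isClosed_closure) (fun _ => (convex_convexHull ℝ _).closure)
    (closure_minimal (convexHull_min
      (Set.image_subset_iff.2 fun l _ => mem_closedBall_zero_iff.2 (hx l))
      (convex_closedBall _ _)) Metric.isClosed_closedBall)
  exact ⟨y, Set.mem_iInter.1 hy⟩

end Hilbert

lemma map_eq_of_forall_mem_closure_convexHull_tail {E F : Type*} [NormedAddCommGroup E]
    [NormedSpace ℝ E] [NormedAddCommGroup F] [NormedSpace ℝ F] (T : E →L[ℝ] F) {x : ℕ → E} {y : E}
    {b : F} (hy : ∀ m, y ∈ closure (convexHull ℝ (x '' Set.Ici m)))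
    (hlim : Tendsto (fun m => T (x m)) atTop (𝓝 b)) : T y = b := by
  refine eq_of_forall_dist_le fun η hη => ?_
  obtain ⟨m, hm⟩ := Metric.tendsto_atTop.1 hlim η hη
  exact closure_minimal (t := T ⁻¹' Metric.closedBall b η)
    (convexHull_min (Set.image_subset_iff.2 fun l hl => (hm l hl).le)
      ((convex_closedBall _ _).linear_preimage T.toLinearMap))
    (Metric.isClosed_closedBall.preimage T.continuous) (hy m)

section GradSpace

variable {d : ℕ} {Ω : Set (Fin d → ℝ)}

/-- The Hilbert space of the pairs `(f, g)`, `f ∈ L²(μ)` and `g ∈ L²(μ)^d`: the coordinate `none`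
is `f`, the coordinate `some j` is `g j`. -/
abbrev GradSpace (μ : Measure (Fin d → ℝ)) : Type := PiLp 2 fun _ : Option (Fin d) => Lp ℝ 2 μ

/-- The pairs `(φ, ∇φ)` with `φ ∈ C_c^∞(Ω)`; the closure of this set is the graph of the gradient
on `H¹₀(Ω)`. -/
def smoothPairs (Ω : Set (Fin d → ℝ)) : Set (GradSpace (volume.restrict Ω)) :=
  {x | ∃ φ : (Fin d → ℝ) → ℝ, ContDiff ℝ ∞ φ ∧ HasCompactSupport φ ∧ tsupport φ ⊆ Ω ∧
    x none =ᵐ[volume.restrict Ω] φ ∧ ∀ j, x (some j) =ᵐ[volume.restrict Ω] partialDeriv j φ}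

/-- The element `(f, g)` of `L²(μ) × L²(μ)^d`. -/
noncomputable def toGradSpace {μ : Measure (Fin d → ℝ)} {f : (Fin d → ℝ) → ℝ}
    {g : Fin d → (Fin d → ℝ) → ℝ} (hf : MemLp f 2 μ) (hg : ∀ j, MemLp (g j) 2 μ) : GradSpace μ :=
  WithLp.toLp 2 fun o => o.elim (hf.toLp f) fun j => (hg j).toLp (g j)

lemma tsupport_linearCombination_subset {X : Type*} [TopologicalSpace X] (φ ψ : X → ℝ) (a b : ℝ) :
    tsupport (fun z => a * φ z + b * ψ z) ⊆ tsupport φ ∪ tsupport ψ :=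
  (tsupport_add _ _).trans <| Set.union_subset_union
    (tsupport_mul_subset_right (f := fun _ => a)) (tsupport_mul_subset_right (f := fun _ => b))

lemma partialDeriv_linearCombination {φ ψ : (Fin d → ℝ) → ℝ} {z : Fin d → ℝ}
    (hφ : DifferentiableAt ℝ φ z) (hψ : DifferentiableAt ℝ ψ z) (a b : ℝ) (j : Fin d) :
    partialDeriv j (fun z => a * φ z + b * ψ z) z
      = a * partialDeriv j φ z + b * partialDeriv j ψ z := by
  rw [partialDeriv, fderiv_fun_add (hφ.const_mul a) (hψ.const_mul b), fderiv_const_mul hφ,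
    fderiv_const_mul hψ]
  simp [partialDeriv]

lemma coeFn_linearCombination {α : Type*} [MeasurableSpace α] {μ : Measure α} {x y : Lp ℝ 2 μ}
    {φ ψ : α → ℝ} (hx : x =ᵐ[μ] φ) (hy : y =ᵐ[μ] ψ) (a b : ℝ) :
    (a • x + b • y : Lp ℝ 2 μ) =ᵐ[μ] fun z => a * φ z + b * ψ z := by
  filter_upwards [Lp.coeFn_add (a • x) (b • y), Lp.coeFn_smul a x, Lp.coeFn_smul b y, hx, hy]
    with z hadd hax hby hxz hyz
  rw [hadd, Pi.add_apply, hax, hby, Pi.smul_apply, Pi.smul_apply, hxz, hyz, smul_eq_mul,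
    smul_eq_mul]

lemma convex_smoothPairs (Ω : Set (Fin d → ℝ)) : Convex ℝ (smoothPairs Ω) := by
  rintro x ⟨φ, hφ, hφc, hφs, hx, hxg⟩ y ⟨ψ, hψ, hψc, hψs, hy, hyg⟩ a b - - -
  have hsupp := tsupport_linearCombination_subset φ ψ a b
  refine ⟨fun z => a * φ z + b * ψ z, by fun_prop,
    (hφc.isCompact.union hψc.isCompact).of_isClosed_subset (isClosed_tsupport _) hsupp,
    hsupp.trans (Set.union_subset hφs hψs), coeFn_linearCombination hx hy a b, fun j => ?_⟩
  refine (coeFn_linearCombination (hxg j) (hyg j) a b).trans (Eventually.of_forall fun z => ?_)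
  exact (partialDeriv_linearCombination ((hφ.differentiable (by simp)) z)
    ((hψ.differentiable (by simp)) z) a b j).symm

lemma tendsto_toLp {α : Type*} [MeasurableSpace α] {μ : Measure α} {F : ℕ → α → ℝ} {f : α → ℝ}
    (hF : ∀ l, MemLp (F l) 2 μ) (hf : MemLp f 2 μ)
    (h : Tendsto (fun l => eLpNorm (fun y => F l y - f y) 2 μ) atTop (𝓝 0)) :
    Tendsto (fun l => (hF l).toLp (F l)) atTop (𝓝 (hf.toLp f)) :=
  (Lp.tendsto_Lp_iff_tendsto_eLpNorm'' F hF f hf).2 h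

lemma HasH10Grad.toGradSpace_mem_closure {f : (Fin d → ℝ) → ℝ} {g : Fin d → (Fin d → ℝ) → ℝ}
    (h : HasH10Grad Ω f g) :
    toGradSpace h.memLp_val h.memLp_grad ∈ closure (smoothPairs Ω) := by
  obtain ⟨φ, hφ⟩ := h.approx
  rw [mem_closure_iff_seq_limit]
  refine ⟨fun l => toGradSpace (hφ.memLp_val l) (fun j => hφ.memLp_grad j l), fun l =>
    ⟨φ l, hφ.smooth l, hφ.compactSupport l, hφ.support_subset l, (hφ.memLp_val l).coeFn_toLp,
      fun j => (hφ.memLp_grad j l).coeFn_toLp⟩, ?_⟩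
  refine ((PiLp.continuous_toLp 2 _).tendsto _).comp (tendsto_pi_nhds.2 fun o => ?_)
  cases o with
  | none => exact tendsto_toLp hφ.memLp_val h.memLp_val hφ.tendsto_val
  | some j => exact tendsto_toLp (hφ.memLp_grad j) (h.memLp_grad j) (hφ.tendsto_grad j)

lemma tendsto_eLpNorm_of_tendsto_Lp {α : Type*} [MeasurableSpace α] {μ : Measure α}
    {s : ℕ → Lp ℝ 2 μ} {y : Lp ℝ 2 μ} (hs : Tendsto s atTop (𝓝 y)) {F : ℕ → α → ℝ} {f : α → ℝ}
    (hF : ∀ l, s l =ᵐ[μ] F l) (hf : y =ᵐ[μ] f) :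
    Tendsto (fun l => eLpNorm (fun z => F l z - f z) 2 μ) atTop (𝓝 0) :=
  ((Lp.tendsto_Lp_iff_tendsto_eLpNorm' _ _).1 hs).congr fun l =>
    eLpNorm_congr_ae ((hF l).sub hf)

lemma hasH10Grad_of_mem_closure {x : GradSpace (volume.restrict Ω)}
    (hx : x ∈ closure (smoothPairs Ω)) {f : (Fin d → ℝ) → ℝ} (hf : MemLp f 2 (volume.restrict Ω))
    (hxf : x none =ᵐ[volume.restrict Ω] f) : HasH10Grad Ω f fun j => x (some j) := by
  obtain ⟨s, hs, hsx⟩ := mem_closure_iff_seq_limit.1 hx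
  choose φ hφ hφc hφs hφv hφg using hs
  have hcoord (o) : Tendsto (fun l => s l o) atTop (𝓝 (x o)) :=
    ((PiLp.continuous_apply 2 (fun _ : Option (Fin d) => Lp ℝ 2 (volume.restrict Ω)) o).tendsto
      x).comp hsx
  exact ⟨hf, fun j => Lp.memLp _, φ, hφ, hφc, hφs,
    tendsto_eLpNorm_of_tendsto_Lp (hcoord none) hφv hxf,
    fun j => tendsto_eLpNorm_of_tendsto_Lp (hcoord (some j)) (fun l => hφg l j) .rfl⟩

lemma norm_toGradSpace_le {f : ℕ → (Fin d → ℝ) → ℝ} {g : ℕ → Fin d → (Fin d → ℝ) → ℝ}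
    (hf : ∀ m, MemLp (f m) 2 (volume.restrict Ω))
    (hg : ∀ m j, MemLp (g m j) 2 (volume.restrict Ω)) {B C : ℝ}
    (hB : ∀ m, ‖(hf m).toLp (f m)‖ ≤ B) (hC : ∀ m j, l2Norm Ω (g m j) ≤ C) (m : ℕ) :
    ‖toGradSpace (hf m) (hg m)‖ ≤ √(B ^ 2 + ∑ _j : Fin d, C ^ 2) := by
  rw [PiLp.norm_eq_of_L2, Fintype.sum_option]
  refine Real.sqrt_le_sqrt (add_le_add (pow_le_pow_left₀ (norm_nonneg _) (hB m) 2)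
    (Finset.sum_le_sum fun j _ => pow_le_pow_left₀ (norm_nonneg _) ?_ 2))
  exact (Lp.norm_toLp _ (hg m j)).trans_le (hC m j)

theorem exists_hasH10Grad_of_tendsto {f : ℕ → (Fin d → ℝ) → ℝ}
    {g : ℕ → Fin d → (Fin d → ℝ) → ℝ} {f' : (Fin d → ℝ) → ℝ} (h : ∀ m, HasH10Grad Ω (f m) (g m))
    (hf' : MemLp f' 2 (volume.restrict Ω)) {C : ℝ} (hC : ∀ m j, l2Norm Ω (g m j) ≤ C)
    (hlim : Tendsto (fun m => eLpNorm (fun y => f m y - f' y) 2 (volume.restrict Ω)) atTop (𝓝 0)) :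
    ∃ g', HasH10Grad Ω f' g' := by
  set x : ℕ → GradSpace (volume.restrict Ω) :=
    fun m => toGradSpace (h m).memLp_val (h m).memLp_grad
  have hnone : Tendsto (fun m => x m none) atTop (𝓝 (hf'.toLp f')) :=
    tendsto_toLp (fun m => (h m).memLp_val) hf' hlim
  obtain ⟨B, hB⟩ := (Metric.isBounded_range_of_tendsto _ hnone).exists_norm_le
  -- A weak limit of the pairs `x m`, reached through convex combinations of their tails.
  obtain ⟨y, hy⟩ := exists_forall_mem_closure_convexHull_tail (norm_toGradSpace_le
    (fun m => (h m).memLp_val) (fun m => (h m).memLp_grad) (fun m => hB _ ⟨m, rfl⟩) hC)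
  have hclosure : y ∈ closure (smoothPairs Ω) :=
    closure_minimal (convexHull_min
      (Set.forall_mem_image.2 fun m _ => (h m).toGradSpace_mem_closure)
      (convex_smoothPairs Ω).closure) isClosed_closure (hy 0)
  have hval : y none = hf'.toLp f' := map_eq_of_forall_mem_closure_convexHull_tail
    (PiLp.proj (𝕜 := ℝ) 2 (fun _ : Option (Fin d) => Lp ℝ 2 (volume.restrict Ω)) none) hy hnone
  exact ⟨_, hasH10Grad_of_mem_closure hclosure hf' (hval ▸ hf'.coeFn_toLp)⟩

end GradSpace

/-! ### Limits of the discrete operators -/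

lemma isBigO_one_of_sq_le {ι : Type*} {l : Filter ι} {f : ι → ℝ} {C : ℝ}
    (h : ∀ᶠ m in l, f m ^ 2 ≤ C) : f =O[l] fun _ => (1 : ℝ) := by
  refine Asymptotics.IsBigO.of_bound (Real.sqrt C) ?_
  filter_upwards [h] with m hm
  rw [norm_one, mul_one, Real.norm_eq_abs]
  exact Real.abs_le_sqrt hm

lemma exists_subseq_tendsto_of_isBigO_one {X : Type*} [NormedAddCommGroup X] [ProperSpace X]
    {x : ℕ → X} (h : x =O[atTop] fun _ => (1 : ℝ)) :
    ∃ a, ∃ φ : ℕ → ℕ, StrictMono φ ∧ Tendsto (fun m => x (φ m)) atTop (𝓝 a) := by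
  obtain ⟨c, hc⟩ := h.bound
  have hball : ∃ᶠ m in atTop, x m ∈ Metric.closedBall (0 : X) c :=
    (hc.mono fun m hm => by simpa using hm).frequently
  obtain ⟨a, -, φ, hφ, hlim⟩ :=
    tendsto_subseq_of_frequently_bounded Metric.isBounded_closedBall hball
  exact ⟨a, φ, hφ, hlim⟩

namespace MACMesh

variable {d : ℕ} {M : MACMesh d}

lemma continuous_fv (i : Fin d) (k : Fin d → ℤ) : Continuous fun u : M.FaceField => fv u i k := by
  by_cases h : k ∈ M.faces i
  · simp only [fv_of_mem _ h]; fun_prop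
  · simp only [fv_of_notMem _ h]; fun_prop

lemma continuous_cv (k : Fin d → ℤ) : Continuous fun p : M.CellField => cv p k := by
  by_cases h : k ∈ M.cells
  · simp only [cv_of_mem _ h]; fun_prop
  · simp only [cv_of_notMem _ h]; fun_prop

lemma continuous_divVel : Continuous (divVel : M.FaceField → M.CellField) := by
  refine continuous_pi fun k => ?_
  simp only [divVel_apply]
  have := fun i k => continuous_fv (M := M) i k
  fun_prop

lemma continuous_grad (i : Fin d) (k : Fin d → ℤ) :
    Continuous fun p : M.CellField => grad p i k := by
  have := fun k => continuous_cv (M := M) k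
  simp only [grad]
  fun_prop

lemma continuous_divTau (μ lam : ℝ) (i : Fin d) (k : Fin d → ℤ) :
    Continuous fun v : M.FaceField => divTau μ lam v i k := by
  have := fun i k => continuous_fv (M := M) i k
  have : Continuous fun v : M.FaceField => grad (divVel v) i k :=
    (continuous_grad i k).comp continuous_divVel
  simp only [divTau, laplacian, diffFlux]
  fun_prop

lemma continuous_dualDensity (i : Fin d) (k : Fin d → ℤ) :
    Continuous fun ρ : M.CellField => dualDensity ρ i k := by
  have := fun k => continuous_cv (M := M) k
  simp only [dualDensity]
  fun_prop

lemma continuous_integral : Continuous (integral : M.CellField → ℝ) := by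
  unfold integral
  fun_prop

lemma dualDensity_one {i : Fin d} {k : Fin d → ℤ} (hk : k ∈ M.faces i) :
    dualDensity (M := M) (fun _ => 1) i k = 1 := by
  rw [dualDensity, cv_of_mem _ (mem_cells_of_mem_faces hk), cv_of_mem _ (add_e_mem_cells hk),
    mul_one, mul_one, ← dualVol, div_self (dualVol_pos hk).ne']

lemma grad_deltaP (γ Ma : ℝ) (ρ : M.CellField) {i : Fin d} {k : Fin d → ℤ}
    (hk : k ∈ M.faces i) :
    grad (deltaP γ Ma ρ) i k = (1 / Ma ^ 2) * grad (pressure γ ρ) i k := by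
  simp only [grad, cv_of_mem _ (mem_cells_of_mem_faces hk), cv_of_mem _ (add_e_mem_cells hk),
    deltaP]
  ring

lemma integral_deltaP (γ Ma : ℝ) (ρ : M.CellField) : integral (deltaP γ Ma ρ) = 0 := by
  have hV := (sum_vol_pos (M := M)).ne'
  rw [integral]
  simp only [deltaP, mul_div_assoc', ← Finset.sum_div, mul_sub, Finset.sum_sub_distrib,
    ← Finset.sum_mul]
  rw [← mul_assoc, mul_inv_cancel₀ hV, one_mul, integral, sub_self, zero_div]

section Limits

variable {ι : Type*} {l : Filter ι} {ρm ρ ρ' : ι → M.CellField} {u w u' : ι → M.FaceField}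
  {v z v' : M.FaceField}

lemma tendsto_dualDensity (hρ : Tendsto ρ l (𝓝 fun _ => 1)) {i : Fin d} {k : Fin d → ℤ}
    (hk : k ∈ M.faces i) : Tendsto (fun m => dualDensity (ρ m) i k) l (𝓝 1) := by
  have hlim := ((continuous_dualDensity i k).tendsto _).comp hρ
  rwa [dualDensity_one hk] at hlim

lemma tendsto_sqrt_dualDensity_div (hρm : Tendsto ρm l (𝓝 fun _ => 1))
    (hρ : Tendsto ρ l (𝓝 fun _ => 1)) {i : Fin d} {k : Fin d → ℤ} (hk : k ∈ M.faces i) :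
    Tendsto (fun m => Real.sqrt (dualDensity (ρ m) i k / dualDensity (ρm m) i k)) l (𝓝 1) := by
  simpa using
    ((tendsto_dualDensity hρ hk).div (tendsto_dualDensity hρm hk) one_ne_zero).sqrt

lemma tendsto_massFlux (hρ : Tendsto ρ l (𝓝 fun _ => 1)) (hu : Tendsto u l (𝓝 v))
    (i : Fin d) (k : Fin d → ℤ) :
    Tendsto (fun m => massFlux (ρ m) (u m) i k) l (𝓝 (massFlux (fun _ => 1) v i k)) := by
  by_cases hk : k ∈ M.faces i
  · rw [massFlux_one]
    simp only [massFlux]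
    have hK := ((continuous_cv k).tendsto _).comp hρ
    have hL := ((continuous_cv (k + e i)).tendsto _).comp hρ
    rw [cv_of_mem _ (mem_cells_of_mem_faces hk)] at hK
    rw [cv_of_mem _ (add_e_mem_cells hk)] at hL
    -- The upwind choice may oscillate with `m`, but both candidates tend to `1`.
    have hupwind : Tendsto (fun m => if 0 ≤ fv (u m) i k then cv (ρ m) k else cv (ρ m) (k + e i))
        l (𝓝 1) := hK.if' hL
    simpa using (hupwind.const_mul (M.area i k)).mul (((continuous_fv i k).tendsto _).comp hu)
  · simp only [massFlux_of_notMem _ _ hk]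
    exact tendsto_const_nhds

lemma tendsto_divMass (hρ : Tendsto ρ l (𝓝 fun _ => 1)) (hu : Tendsto u l (𝓝 v))
    (k : Fin d → ℤ) :
    Tendsto (fun m => divMass (ρ m) (u m) k) l (𝓝 (divMass (fun _ => 1) v k)) :=
  (tendsto_finsetSum _ fun i _ =>
    (tendsto_massFlux hρ hu i k).sub (tendsto_massFlux hρ hu i (k - e i))).const_mul _

lemma tendsto_conv (hρ : Tendsto ρ l (𝓝 fun _ => 1)) (hw : Tendsto w l (𝓝 z))
    (hu : Tendsto u l (𝓝 v)) (i : Fin d) (k : Fin d → ℤ) :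
    Tendsto (fun m => conv (ρ m) (w m) (u m) i k) l (𝓝 (conv (fun _ => 1) z v i k)) := by
  have hflux : ∀ j k, Tendsto (fun m => dualFlux (ρ m) (u m) i j k) l
      (𝓝 (dualFlux (fun _ => 1) v i j k)) := fun j k =>
    ((tendsto_massFlux hρ hu j k).add (tendsto_massFlux hρ hu j (k + e i))).div_const 2
  have hval : ∀ j k, Tendsto (fun m => dualFaceVal (w m) i j k) l
      (𝓝 (dualFaceVal z i j k)) := fun j k =>
    ((((continuous_fv i k).tendsto _).comp hw).add
      (((continuous_fv i (k + e j)).tendsto _).comp hw)).div_const 2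
  exact (tendsto_finsetSum _ fun j _ => ((hflux j k).mul (hval j k)).sub
    ((hflux j (k - e j)).mul (hval j (k - e j)))).const_mul _

lemma tendsto_apply_face (hu : Tendsto u l (𝓝 v)) (i : Fin d) (k : M.faces i) :
    Tendsto (fun m => u m i k) l (𝓝 (v i k)) :=
  tendsto_pi_nhds.1 (tendsto_pi_nhds.1 hu i) k

variable {γ μ lam δt : ℝ} {Ma : ι → ℝ} {π π' : M.CellField}

lemma tendsto_scaled_grad_pressure (hπ : Tendsto (fun m => deltaP γ (Ma m) (ρ m)) l (𝓝 π))
    {i : Fin d} {k : Fin d → ℤ} (hk : k ∈ M.faces i) :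
    Tendsto (fun m => (1 / Ma m ^ 2) * grad (pressure γ (ρ m)) i k) l (𝓝 (grad π i k)) := by
  simp only [← grad_deltaP _ _ _ hk]
  exact ((continuous_grad i k).tendsto _).comp hπ

lemma tendsto_sqrt_mul_scaled_grad_pressure (hρm : Tendsto ρm l (𝓝 fun _ => 1))
    (hρ : Tendsto ρ l (𝓝 fun _ => 1))
    (hπ : Tendsto (fun m => deltaP γ (Ma m) (ρ m)) l (𝓝 π))
    {i : Fin d} {k : Fin d → ℤ} (hk : k ∈ M.faces i) :
    Tendsto (fun m => (1 / Ma m ^ 2) * (Real.sqrt (dualDensity (ρ m) i k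
      / dualDensity (ρm m) i k) * grad (pressure γ (ρ m)) i k)) l (𝓝 (grad π i k)) := by
  have hlim := (tendsto_sqrt_dualDensity_div hρm hρ hk).mul (tendsto_scaled_grad_pressure hπ hk)
  rw [one_mul] at hlim
  exact hlim.congr fun m => by ring

namespace IsCompressibleStep

lemma tendsto_prediction [l.NeBot]
    (hstep : ∀ m, IsCompressibleStep γ μ lam δt (Ma m) (ρm m) (ρ m) (ρ' m) (u m) (w m) (u' m))
    (hρm : Tendsto ρm l (𝓝 fun _ => 1)) (hρ : Tendsto ρ l (𝓝 fun _ => 1))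
    (hu : Tendsto u l (𝓝 v)) (hw : Tendsto w l (𝓝 z))
    (hπ : Tendsto (fun m => deltaP γ (Ma m) (ρ m)) l (𝓝 π)) (i : Fin d) (k : M.faces i) :
    (1 / δt) * (z i k - v i k) + conv (fun _ => 1) z v i k - divTau μ lam z i k + grad π i k
      = 0 := by
  have htime := (((tendsto_dualDensity hρ k.2).mul (tendsto_apply_face hw i k)).sub
    ((tendsto_dualDensity hρm k.2).mul (tendsto_apply_face hu i k))).const_mul (1 / δt)
  have hlim := ((htime.add (tendsto_conv hρ hw hu i k)).sub
    (((continuous_divTau μ lam i k).tendsto _).comp hw)).add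
    (tendsto_sqrt_mul_scaled_grad_pressure hρm hρ hπ k.2)
  rw [one_mul, one_mul] at hlim
  exact tendsto_nhds_unique hlim
    (tendsto_const_nhds.congr fun m => ((hstep m).prediction i k).symm)

lemma tendsto_correction [l.NeBot]
    (hstep : ∀ m, IsCompressibleStep γ μ lam δt (Ma m) (ρm m) (ρ m) (ρ' m) (u m) (w m) (u' m))
    (hρm : Tendsto ρm l (𝓝 fun _ => 1)) (hρ : Tendsto ρ l (𝓝 fun _ => 1))
    (hw : Tendsto w l (𝓝 z)) (hu' : Tendsto u' l (𝓝 v'))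
    (hπ : Tendsto (fun m => deltaP γ (Ma m) (ρ m)) l (𝓝 π))
    (hπ' : Tendsto (fun m => deltaP γ (Ma m) (ρ' m)) l (𝓝 π')) (i : Fin d) (k : M.faces i) :
    (1 / δt) * (v' i k - z i k) + grad π' i k - grad π i k = 0 := by
  have htime := ((tendsto_dualDensity hρ k.2).const_mul (1 / δt)).mul
    ((tendsto_apply_face hu' i k).sub (tendsto_apply_face hw i k))
  have hlim := (htime.add (tendsto_scaled_grad_pressure hπ' k.2)).sub
    (tendsto_sqrt_mul_scaled_grad_pressure hρm hρ hπ k.2)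
  rw [mul_one] at hlim
  exact tendsto_nhds_unique hlim
    (tendsto_const_nhds.congr fun m => ((hstep m).correction i k).symm)

lemma isBigO_predicted (hδt : δt ≠ 0)
    (hstep : ∀ m, IsCompressibleStep γ μ lam δt (Ma m) (ρm m) (ρ m) (ρ' m) (u m) (w m) (u' m))
    (hρm : Tendsto ρm l (𝓝 fun _ => 1)) (hρ : Tendsto ρ l (𝓝 fun _ => 1))
    {i : Fin d} {k : Fin d → ℤ} (hk : k ∈ M.faces i)
    (hu' : (fun m => fv (u' m) i k) =O[l] fun _ => (1 : ℝ))
    (hgrad : (fun m => (1 / Ma m ^ 2) * grad (pressure γ (ρ m)) i k) =O[l] fun _ => (1 : ℝ))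
    (hgrad' : (fun m => (1 / Ma m ^ 2) * grad (pressure γ (ρ' m)) i k) =O[l] fun _ => (1 : ℝ)) :
    (fun m => fv (w m) i k) =O[l] fun _ => (1 : ℝ) := by
  have hr := tendsto_dualDensity hρ hk
  have hfactor : (fun m => δt / dualDensity (ρ m) i k) =O[l] fun _ => (1 : ℝ) :=
    (tendsto_const_nhds.div hr one_ne_zero).isBigO_one ℝ
  have hsqrt := (tendsto_sqrt_dualDensity_div hρm hρ hk).isBigO_one ℝ
  have hscaled := (hsqrt.mul hgrad).congr_right fun _ => mul_one (1 : ℝ)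
  have hforce := (hfactor.mul (hgrad'.sub hscaled)).congr_right fun _ => mul_one (1 : ℝ)
  refine (hu'.add hforce).congr' ?_ EventuallyEq.rfl
  filter_upwards [hr.eventually_ne one_ne_zero] with m hm
  have hcorrection := (hstep m).correction i ⟨k, hk⟩
  rw [← fv_of_mem (u' m) hk, ← fv_of_mem (w m) hk] at hcorrection
  have hsolve : fv (w m) i k = fv (u' m) i k - δt / dualDensity (ρ m) i k *
      (1 / δt * dualDensity (ρ m) i k * (fv (u' m) i k - fv (w m) i k)) := by
    field_simp
    ring
  rw [hsolve]
  linear_combination (δt / dualDensity (ρ m) i k) * hcorrection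

end IsCompressibleStep

lemma divVel_eq_zero_of_massBalance_of_tendsto [l.NeBot]
    (hmass : ∀ m, MassBalance δt (ρ m) (ρ' m) (u m)) (hρ : Tendsto ρ l (𝓝 fun _ => 1))
    (hρ' : Tendsto ρ' l (𝓝 fun _ => 1)) (hu : Tendsto u l (𝓝 v)) : divVel v = 0 := by
  funext k
  have htime := ((tendsto_pi_nhds.1 hρ' k).sub (tendsto_pi_nhds.1 hρ k)).const_mul (1 / δt)
  rw [sub_self, mul_zero] at htime
  have hlim := htime.add (tendsto_divMass hρ' hu k)
  rw [zero_add] at hlim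
  exact tendsto_nhds_unique hlim (tendsto_const_nhds.congr fun m => (hmass m k).symm)

lemma tendsto_of_massBalance (hδt : δt ≠ 0) (hmass : ∀ m, MassBalance δt (ρm m) (ρ m) (u m))
    (hρ : Tendsto ρ l (𝓝 fun _ => 1)) (hu : Tendsto u l (𝓝 v)) (hv : divVel v = 0) :
    Tendsto ρm l (𝓝 fun _ => 1) := by
  refine tendsto_pi_nhds.2 fun k => ?_
  have hdiv := tendsto_divMass hρ hu k
  rw [show divMass (fun _ => 1) v k = 0 from congrFun hv k] at hdiv
  have hlim := (tendsto_pi_nhds.1 hρ k).add (hdiv.const_mul δt)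
  rw [mul_zero, add_zero] at hlim
  refine hlim.congr fun m => ?_
  rw [(hmass m).divMass_eq k]
  field_simp
  ring

end Limits

/-! ### Sequences of solutions of the compressible scheme -/

lemma le_faceEnergy (γ δt Ma : ℝ) {ρm : M.CellField} (ρ : M.CellField) (u : M.FaceField)
    {i : Fin d} {k : Fin d → ℤ} (hlow : 1 / 2 ≤ dualDensity ρm i k)
    (hup : dualDensity ρm i k ≤ 2) :
    fv u i k ^ 2 / 4 + (δt * ((1 / Ma ^ 2) * grad (pressure γ ρ) i k)) ^ 2 / 4
      ≤ faceEnergy γ δt Ma ρm ρ u i k := by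
  rw [faceEnergy, ← mul_pow]
  refine add_le_add (by nlinarith [sq_nonneg (fv u i k)]) ?_
  exact div_le_div_of_nonneg_left (sq_nonneg _) (by linarith) (by linarith)

theorem IsCompressibleSol.energy_le_energy_zero {γ μ lam δt Ma : ℝ} {N : ℕ}
    {ρ₀ : (Fin d → ℝ) → ℝ} {u₀ : Fin d → (Fin d → ℝ) → ℝ} {ρ : ℤ → M.CellField}
    {u w : ℕ → M.FaceField} (hsol : IsCompressibleSol γ μ lam δt Ma N ρ₀ u₀ ρ u w)
    (hδt : 0 < δt) (hμ : 0 ≤ μ) (hμlam : 0 ≤ μ + lam) {Ψ h : ℝ → ℝ}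
    (hΨ : IsElasticPotential γ Ψ h) (hρm : ∀ k, 0 < ρ (-1) k) (hρ : ∀ k, 0 < ρ 0 k) {n : ℕ}
    (hn : n ≤ N) :
    (∀ k, 0 < ρ (n - 1) k) ∧ (∀ k, 0 < ρ n k) ∧
      energy γ δt Ma Ψ (ρ (n - 1)) (ρ n) (u n) ≤ energy γ δt Ma Ψ (ρ (-1)) (ρ 0) (u 0) := by
  induction n with
  | zero =>
    rw [Nat.cast_zero, zero_sub]
    exact ⟨hρm, hρ, le_rfl⟩
  | succ n ih =>
    obtain ⟨hprev, hcur, hle⟩ := ih (by omega)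
    have hstep := hsol.isCompressibleStep hn
    have hnext := (hstep.energy_le hδt hμ hμlam hΨ hprev hcur).trans hle
    rw [Nat.cast_succ, add_sub_cancel_right]
    exact ⟨hcur, hstep.mass.density_pos hδt hcur, hnext⟩

/-- A sequence of solutions of the compressible scheme with vanishing Mach numbers and
well-prepared initial discrete fields, whose initial velocities converge to `V₀`; the data from
which these initial fields are computed are existentially quantified in `sol`. -/
structure IsLowMachSequence (M : MACMesh d) (γ μ lam δt : ℝ) (N : ℕ) (Ma : ℕ → ℝ)
    (ρ : ℕ → ℤ → M.CellField) (u w : ℕ → ℕ → M.FaceField) (V₀ : M.FaceField) : Prop where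
  mach_pos : ∀ m, 0 < Ma m
  mach_tendsto : Tendsto Ma atTop (𝓝 0)
  density_init : ∃ C : ℝ, ∀ m k, |ρ m 0 k - 1| ≤ C * Ma m ^ 2
  velocity_init : Tendsto (fun m => u m 0) atTop (𝓝 V₀)
  div_init : divVel V₀ = 0
  sol : ∀ m, ∃ ρ₀ u₀, IsCompressibleSol γ μ lam δt (Ma m) N ρ₀ u₀ (ρ m) (u m) (w m)

namespace IsLowMachSequence

variable {γ μ lam δt : ℝ} {N : ℕ} {Ma : ℕ → ℝ} {ρ : ℕ → ℤ → M.CellField}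
  {u w : ℕ → ℕ → M.FaceField} {V₀ : M.FaceField}

lemma comp (H : IsLowMachSequence M γ μ lam δt N Ma ρ u w V₀) {θ : ℕ → ℕ}
    (hθ : Tendsto θ atTop atTop) :
    IsLowMachSequence M γ μ lam δt N (fun m => Ma (θ m)) (fun m => ρ (θ m)) (fun m => u (θ m))
      (fun m => w (θ m)) V₀ where
  mach_pos _ := H.mach_pos _
  mach_tendsto := H.mach_tendsto.comp hθ
  density_init := H.density_init.imp fun _ hC _ => hC _
  velocity_init := H.velocity_init.comp hθ
  div_init := H.div_init
  sol _ := H.sol _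

lemma massBalance (H : IsLowMachSequence M γ μ lam δt N Ma ρ u w V₀) {n : ℕ} (hn : n ≤ N)
    (m : ℕ) : MassBalance δt (ρ m (n - 1)) (ρ m n) (u m n) := by
  obtain ⟨ρ₀, u₀, hsol⟩ := H.sol m
  exact hsol.massBalance hn

lemma isCompressibleStep (H : IsLowMachSequence M γ μ lam δt N Ma ρ u w V₀) {n : ℕ} (hn : n < N)
    (m : ℕ) : IsCompressibleStep γ μ lam δt (Ma m) (ρ m (n - 1)) (ρ m n) (ρ m (n + 1)) (u m n)
      (w m (n + 1)) (u m (n + 1)) := by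
  obtain ⟨ρ₀, u₀, hsol⟩ := H.sol m
  exact hsol.isCompressibleStep hn

lemma tendsto_mach_sq (H : IsLowMachSequence M γ μ lam δt N Ma ρ u w V₀) :
    Tendsto (fun m => Ma m ^ 2) atTop (𝓝 0) := by
  simpa using H.mach_tendsto.pow 2

/-! #### The initial energy -/

lemma tendsto_density_zero (H : IsLowMachSequence M γ μ lam δt N Ma ρ u w V₀) :
    Tendsto (fun m => ρ m 0) atTop (𝓝 fun _ => 1) := by
  obtain ⟨C, hC⟩ := H.density_init
  refine tendsto_pi_nhds.2 fun k => tendsto_iff_norm_sub_tendsto_zero.2 ?_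
  refine squeeze_zero (fun _ => norm_nonneg _) (fun m => hC m k) ?_
  simpa using H.tendsto_mach_sq.const_mul C

lemma tendsto_density_neg_one (H : IsLowMachSequence M γ μ lam δt N Ma ρ u w V₀) (hδt : δt ≠ 0) :
    Tendsto (fun m => ρ m (-1)) atTop (𝓝 fun _ => 1) :=
  tendsto_of_massBalance hδt (fun m => by simpa using H.massBalance (Nat.zero_le N) m)
    H.tendsto_density_zero H.velocity_init H.div_init

lemma isBigO_pressure_zero (H : IsLowMachSequence M γ μ lam δt N Ma ρ u w V₀) (k : M.cells) :
    (fun m => (1 / Ma m ^ 2) * (ρ m 0 k ^ γ - 1)) =O[atTop] fun _ => (1 : ℝ) := by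
  obtain ⟨C, hC⟩ := H.density_init
  have hrpow : (fun x : ℝ => x ^ γ - 1 ^ γ) =O[𝓝 1] fun x => x - 1 :=
    (Real.hasDerivAt_rpow_const (Or.inl one_ne_zero)).isBigO_sub
  have hpressure := hrpow.comp_tendsto (tendsto_pi_nhds.1 H.tendsto_density_zero k)
  have hdensity : (fun m => ρ m 0 k - 1) =O[atTop] fun m => Ma m ^ 2 := by
    refine Asymptotics.IsBigO.of_bound C (Eventually.of_forall fun m => ?_)
    rw [Real.norm_eq_abs, Real.norm_of_nonneg (sq_nonneg _)]
    exact hC m k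
  refine ((Asymptotics.isBigO_refl (fun m => 1 / Ma m ^ 2) atTop).mul
    (hpressure.trans hdensity)).congr (fun m => ?_) (fun m => ?_)
  · simp only [Function.comp_apply, Real.one_rpow]
  · exact one_div_mul_cancel (pow_ne_zero 2 (H.mach_pos m).ne')

lemma isBigO_grad_pressure_zero (H : IsLowMachSequence M γ μ lam δt N Ma ρ u w V₀) {i : Fin d}
    {k : Fin d → ℤ} (hk : k ∈ M.faces i) :
    (fun m => (1 / Ma m ^ 2) * grad (pressure γ (ρ m 0)) i k) =O[atTop] fun _ => (1 : ℝ) := by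
  refine (((H.isBigO_pressure_zero ⟨_, add_e_mem_cells hk⟩).sub
    (H.isBigO_pressure_zero ⟨k, mem_cells_of_mem_faces hk⟩)).const_mul_left
    (M.area i k / M.dualVol i k)).congr_left fun m => ?_
  simp only [grad, cv_of_mem _ (mem_cells_of_mem_faces hk), cv_of_mem _ (add_e_mem_cells hk),
    pressure]
  ring

lemma isBigO_elastic_zero (H : IsLowMachSequence M γ μ lam δt N Ma ρ u w V₀) {Ψ h : ℝ → ℝ}
    (hΨ : IsElasticPotential γ Ψ h) (k : M.cells) :
    (fun m => (1 / Ma m ^ 2) * Ψ (ρ m 0 k)) =O[atTop] fun _ => (1 : ℝ) := by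
  obtain ⟨C, hC⟩ := H.density_init
  have hk := tendsto_pi_nhds.1 H.tendsto_density_zero k
  have hderiv : (fun m => h (ρ m 0 k)) =O[atTop] fun _ => (1 : ℝ) :=
    (hΨ.continuousAt_deriv.tendsto.comp hk).isBigO_one ℝ
  refine Asymptotics.IsBigO.trans (Asymptotics.IsBigO.of_bound C ?_) hderiv
  filter_upwards [hk.eventually (lt_mem_nhds one_pos)] with m hm
  have hMa := H.mach_pos m
  have hnonneg := hΨ.nonneg hm
  rw [Real.norm_of_nonneg (by positivity), Real.norm_eq_abs]
  calc (1 / Ma m ^ 2) * Ψ (ρ m 0 k)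
      ≤ (1 / Ma m ^ 2) * (|h (ρ m 0 k)| * (C * Ma m ^ 2)) := by
        gcongr
        exact (hΨ.le_abs_deriv_mul hm).trans (by gcongr; exact hC m k)
    _ = C * |h (ρ m 0 k)| := by field_simp

lemma isBigO_faceEnergy_zero (H : IsLowMachSequence M γ μ lam δt N Ma ρ u w V₀) (hδt : δt ≠ 0)
    {i : Fin d} {k : Fin d → ℤ} (hk : k ∈ M.faces i) :
    (fun m => faceEnergy γ δt (Ma m) (ρ m (-1)) (ρ m 0) (u m 0) i k)
      =O[atTop] fun _ => (1 : ℝ) := by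
  have hr := tendsto_dualDensity (H.tendsto_density_neg_one hδt) hk
  have hvelocity := ((continuous_fv i k).tendsto _).comp H.velocity_init
  have hkinetic := ((hr.mul (hvelocity.pow 2)).div_const 2).isBigO_one ℝ
  have hweight : (fun m => δt ^ 2 / (2 * dualDensity (ρ m (-1)) i k)) =O[atTop]
      fun _ => (1 : ℝ) :=
    (tendsto_const_nhds.div (hr.const_mul 2) (by norm_num)).isBigO_one ℝ
  refine hkinetic.add ((((H.isBigO_grad_pressure_zero hk).pow 2).mul hweight).congr
    (fun m => ?_) (fun _ => by simp))
  ring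

theorem isBigO_energy_zero (H : IsLowMachSequence M γ μ lam δt N Ma ρ u w V₀) (hδt : δt ≠ 0)
    {Ψ h : ℝ → ℝ} (hΨ : IsElasticPotential γ Ψ h) :
    (fun m => energy γ δt (Ma m) Ψ (ρ m (-1)) (ρ m 0) (u m 0)) =O[atTop] fun _ => (1 : ℝ) := by
  have hface : (fun m => ∑ i, ∑ k ∈ M.faces i, M.dualVol i k
      * faceEnergy γ δt (Ma m) (ρ m (-1)) (ρ m 0) (u m 0) i k) =O[atTop] fun _ => (1 : ℝ) :=
    .fun_sum fun i _ => .fun_sum fun k hk => (H.isBigO_faceEnergy_zero hδt hk).const_mul_left _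
  have helastic : (fun m => ∑ k : M.cells, M.vol k * ((1 / Ma m ^ 2) * Ψ (ρ m 0 k)))
      =O[atTop] fun _ => (1 : ℝ) :=
    .fun_sum fun k _ => (H.isBigO_elastic_zero hΨ k).const_mul_left _
  refine (hface.add helastic).congr_left fun m => ?_
  simp only [energy, integral, Finset.mul_sum, mul_left_comm]

/-! #### Uniform estimates -/

theorem exists_energy_bound (H : IsLowMachSequence M γ μ lam δt N Ma ρ u w V₀) (hδt : 0 < δt)
    (hμ : 0 ≤ μ) (hμlam : 0 ≤ μ + lam) {Ψ h : ℝ → ℝ} (hΨ : IsElasticPotential γ Ψ h) :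
    ∃ E : ℝ, ∀ᶠ m in atTop, ∀ n : ℕ, n ≤ N → (∀ k, 0 < ρ m (n - 1) k) ∧ (∀ k, 0 < ρ m n k) ∧
      energy γ δt (Ma m) Ψ (ρ m (n - 1)) (ρ m n) (u m n) ≤ E := by
  obtain ⟨E, hE⟩ := (H.isBigO_energy_zero hδt.ne' hΨ).bound
  have hpos : ∀ {r : ℕ → M.CellField}, Tendsto r atTop (𝓝 fun _ => 1) →
      ∀ᶠ m in atTop, ∀ k, 0 < r m k := fun hr =>
    eventually_all.2 fun k => (tendsto_pi_nhds.1 hr k).eventually (lt_mem_nhds one_pos)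
  refine ⟨E, ?_⟩
  filter_upwards [hE, hpos (H.tendsto_density_neg_one hδt.ne'), hpos H.tendsto_density_zero]
    with m hEm hρm hρ n hn
  obtain ⟨ρ₀, u₀, hsol⟩ := H.sol m
  obtain ⟨hprev, hcur, hle⟩ := hsol.energy_le_energy_zero hδt hμ hμlam hΨ hρm hρ hn
  rw [norm_one, mul_one] at hEm
  exact ⟨hprev, hcur, hle.trans ((le_abs_self _).trans hEm)⟩

theorem tendsto_density (H : IsLowMachSequence M γ μ lam δt N Ma ρ u w V₀) (hδt : 0 < δt)
    (hγ : 0 < γ) (hμ : 0 ≤ μ) (hμlam : 0 ≤ μ + lam) {n : ℕ} (hn : n ≤ N) :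
    Tendsto (fun m => ρ m n) atTop (𝓝 fun _ => 1) := by
  obtain ⟨Ψ, h, hΨ⟩ := exists_isElasticPotential hγ
  obtain ⟨E, hE⟩ := H.exists_energy_bound hδt hμ hμlam hΨ
  refine tendsto_pi_nhds.2 fun k => Metric.tendsto_nhds.2 fun ε hε => ?_
  obtain ⟨η, hη, hcoercive⟩ := hΨ.coercive hε
  have hv := vol_pos k.2
  have hsmall : Tendsto (fun m => Ma m ^ 2 * (E / M.vol k)) atTop (𝓝 0) := by
    simpa using H.tendsto_mach_sq.mul_const (E / M.vol k)
  filter_upwards [hE, hsmall.eventually (gt_mem_nhds hη)] with m hm hlt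
  obtain ⟨hprev, hcur, hle⟩ := hm n hn
  have hMa := H.mach_pos m
  have hcell := (vol_mul_elastic_le_energy hΨ hprev hcur (u m n) k).trans hle
  refine hcoercive _ (hcur k) (lt_of_le_of_lt ?_ hlt)
  field_simp at hcell ⊢
  linarith

lemma tendsto_density_pred (H : IsLowMachSequence M γ μ lam δt N Ma ρ u w V₀) (hδt : 0 < δt)
    (hγ : 0 < γ) (hμ : 0 ≤ μ) (hμlam : 0 ≤ μ + lam) {n : ℕ} (hn : n ≤ N) :
    Tendsto (fun m => ρ m (n - 1)) atTop (𝓝 fun _ => 1) := by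
  cases n with
  | zero => simpa using H.tendsto_density_neg_one hδt.ne'
  | succ n => simpa using H.tendsto_density hδt hγ hμ hμlam (n := n) (by omega)

theorem isBigO_fv_and_grad_pressure (H : IsLowMachSequence M γ μ lam δt N Ma ρ u w V₀)
    (hδt : 0 < δt) (hγ : 0 < γ) (hμ : 0 ≤ μ) (hμlam : 0 ≤ μ + lam) {n : ℕ} (hn : n ≤ N)
    {i : Fin d} {k : Fin d → ℤ} (hk : k ∈ M.faces i) :
    ((fun m => fv (u m n) i k) =O[atTop] fun _ => (1 : ℝ)) ∧
      (fun m => (1 / Ma m ^ 2) * grad (pressure γ (ρ m n)) i k) =O[atTop] fun _ => (1 : ℝ) := by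
  obtain ⟨Ψ, h, hΨ⟩ := exists_isElasticPotential hγ
  obtain ⟨E, hE⟩ := H.exists_energy_bound hδt hμ hμlam hΨ
  have hr := tendsto_dualDensity (H.tendsto_density_pred hδt hγ hμ hμlam hn) hk
  have hbound : ∀ᶠ m in atTop, fv (u m n) i k ^ 2
      + (δt * ((1 / Ma m ^ 2) * grad (pressure γ (ρ m n)) i k)) ^ 2
      ≤ 4 * (E / M.dualVol i k) := by
    filter_upwards [hE, hr.eventually (le_mem_nhds (by norm_num : (1 / 2 : ℝ) < 1)),
      hr.eventually (ge_mem_nhds one_lt_two)] with m hm hlow hup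
    obtain ⟨hprev, hcur, hle⟩ := hm n hn
    have hface : faceEnergy γ δt (Ma m) (ρ m (n - 1)) (ρ m n) (u m n) i k ≤ E / M.dualVol i k :=
      (le_div_iff₀' (dualVol_pos hk)).2
        ((dualVol_mul_faceEnergy_le_energy hΨ hprev hcur (u m n) hk).trans hle)
    linarith [le_faceEnergy γ δt (Ma m) (ρ m n) (u m n) hlow hup]
  have hgrad : (fun m => δt * ((1 / Ma m ^ 2) * grad (pressure γ (ρ m n)) i k))
      =O[atTop] fun _ => (1 : ℝ) :=
    isBigO_one_of_sq_le (hbound.mono fun m hm => (le_add_of_nonneg_left (sq_nonneg _)).trans hm)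
  exact ⟨isBigO_one_of_sq_le (hbound.mono fun m hm =>
    (le_add_of_nonneg_right (sq_nonneg _)).trans hm),
    (Asymptotics.isBigO_const_mul_left_iff hδt.ne').1 hgrad⟩

lemma isBigO_velocity (H : IsLowMachSequence M γ μ lam δt N Ma ρ u w V₀) (hδt : 0 < δt)
    (hγ : 0 < γ) (hμ : 0 ≤ μ) (hμlam : 0 ≤ μ + lam) {n : ℕ} (hn : n ≤ N) :
    (fun m => u m n) =O[atTop] fun _ => (1 : ℝ) := by
  refine Asymptotics.isBigO_pi.2 fun i => Asymptotics.isBigO_pi.2 fun k => ?_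
  simpa only [fv_of_mem _ k.2] using (H.isBigO_fv_and_grad_pressure hδt hγ hμ hμlam hn k.2).1

lemma isBigO_deltaP (H : IsLowMachSequence M γ μ lam δt N Ma ρ u w V₀) (hδt : 0 < δt)
    (hγ : 0 < γ) (hμ : 0 ≤ μ) (hμlam : 0 ≤ μ + lam) {n : ℕ} (hn : n ≤ N) :
    (fun m => deltaP γ (Ma m) (ρ m n)) =O[atTop] fun _ => (1 : ℝ) :=
  isBigO_one_of_isBigO_grad (fun m => integral_deltaP γ (Ma m) (ρ m n)) fun i k hk => by
    simpa only [grad_deltaP _ _ _ hk]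
      using (H.isBigO_fv_and_grad_pressure hδt hγ hμ hμlam hn hk).2

lemma isBigO_predicted (H : IsLowMachSequence M γ μ lam δt N Ma ρ u w V₀) (hδt : 0 < δt)
    (hγ : 0 < γ) (hμ : 0 ≤ μ) (hμlam : 0 ≤ μ + lam) {n : ℕ} (hn : n < N) :
    (fun m => w m (n + 1)) =O[atTop] fun _ => (1 : ℝ) := by
  refine Asymptotics.isBigO_pi.2 fun i => Asymptotics.isBigO_pi.2 fun k => ?_
  obtain ⟨hu', hgrad'⟩ :=
    H.isBigO_fv_and_grad_pressure hδt hγ hμ hμlam (Nat.succ_le_of_lt hn) k.2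
  rw [Nat.cast_succ] at hgrad'
  simpa only [fv_of_mem _ k.2] using IsCompressibleStep.isBigO_predicted hδt.ne'
    (H.isCompressibleStep hn) (H.tendsto_density_pred hδt hγ hμ hμlam hn.le)
    (H.tendsto_density hδt hγ hμ hμlam hn.le) k.2 hu'
    (H.isBigO_fv_and_grad_pressure hδt hγ hμ hμlam hn.le k.2).2 hgrad'

/-! #### Passage to the limit in the scheme -/

theorem isIncompressibleSol (H : IsLowMachSequence M γ μ lam δt N Ma ρ u w V₀) (hδt : 0 < δt)
    (hγ : 0 < γ) (hμ : 0 ≤ μ) (hμlam : 0 ≤ μ + lam) {v z : ℕ → M.FaceField}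
    {π : ℕ → M.CellField} (hv : ∀ n ≤ N, Tendsto (fun m => u m n) atTop (𝓝 (v n)))
    (hz : ∀ n < N, Tendsto (fun m => w m (n + 1)) atTop (𝓝 (z (n + 1))))
    (hπ : ∀ n ≤ N, Tendsto (fun m => deltaP γ (Ma m) (ρ m n)) atTop (𝓝 (π n))) :
    IsIncompressibleSol μ lam δt N V₀ (π 0) v z π where
  init_velocity := tendsto_nhds_unique (hv 0 N.zero_le) H.velocity_init
  init_pressure := rfl
  mean_zero n hn := by
    have hlim := (continuous_integral.tendsto _).comp (hπ n hn)
    simp only [Function.comp_def, integral_deltaP] at hlim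
    exact tendsto_nhds_unique hlim tendsto_const_nhds
  prediction n hn := IsCompressibleStep.tendsto_prediction (H.isCompressibleStep hn)
    (H.tendsto_density_pred hδt hγ hμ hμlam hn.le) (H.tendsto_density hδt hγ hμ hμlam hn.le)
    (hv n hn.le) (hz n hn) (hπ n hn.le)
  correction n hn := IsCompressibleStep.tendsto_correction (H.isCompressibleStep hn)
    (H.tendsto_density_pred hδt hγ hμ hμlam hn.le) (H.tendsto_density hδt hγ hμ hμlam hn.le)
    (hz n hn) (hv (n + 1) hn) (hπ n hn.le) (by simpa using hπ (n + 1) hn)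
  div_free n hn := congrFun (divVel_eq_zero_of_massBalance_of_tendsto
    (H.massBalance (Nat.succ_le_of_lt hn)) (H.tendsto_density_pred hδt hγ hμ hμlam hn)
    (H.tendsto_density hδt hγ hμ hμlam hn) (hv (n + 1) hn))

theorem exists_subseq_tendsto (H : IsLowMachSequence M γ μ lam δt N Ma ρ u w V₀) (hδt : 0 < δt)
    (hγ : 0 < γ) (hμ : 0 ≤ μ) (hμlam : 0 ≤ μ + lam) :
    ∃ (v z : ℕ → M.FaceField) (π : ℕ → M.CellField), ∃ φ : ℕ → ℕ, StrictMono φ ∧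
      (∀ n ≤ N, Tendsto (fun m => u (φ m) n) atTop (𝓝 (v n))) ∧
      (∀ n < N, Tendsto (fun m => w (φ m) (n + 1)) atTop (𝓝 (z (n + 1)))) ∧
      ∀ n ≤ N, Tendsto (fun m => deltaP γ (Ma (φ m)) (ρ (φ m) n)) atTop (𝓝 (π n)) := by
  have hbounded : (fun m => ((fun n : Fin (N + 1) => (u m n, deltaP γ (Ma m) (ρ m n))),
      (fun n : Fin N => w m (n + 1)))) =O[atTop] fun _ => (1 : ℝ) := by
    refine Asymptotics.IsBigO.prod_left (Asymptotics.isBigO_pi.2 fun n => ?_)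
      (Asymptotics.isBigO_pi.2 fun n => H.isBigO_predicted hδt hγ hμ hμlam n.2)
    exact (H.isBigO_velocity hδt hγ hμ hμlam (Nat.lt_succ_iff.1 n.2)).prod_left
      (H.isBigO_deltaP hδt hγ hμ hμlam (Nat.lt_succ_iff.1 n.2))
  obtain ⟨⟨a, b⟩, φ, hφ, hlim⟩ := exists_subseq_tendsto_of_isBigO_one hbounded
  rw [Prod.tendsto_iff] at hlim
  have ha := fun n => (Prod.tendsto_iff _ _).1 (tendsto_pi_nhds.1 hlim.1 n)
  refine ⟨fun n => if h : n < N + 1 then (a ⟨n, h⟩).1 else 0,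
    fun n => if h : n - 1 < N then b ⟨n - 1, h⟩ else 0,
    fun n => if h : n < N + 1 then (a ⟨n, h⟩).2 else 0, φ, hφ, fun n hn => ?_, fun n hn => ?_,
    fun n hn => ?_⟩
  · simpa only [dif_pos (Nat.lt_succ_of_le hn)] using (ha ⟨n, Nat.lt_succ_of_le hn⟩).1
  · simpa only [add_tsub_cancel_right, dif_pos hn] using tendsto_pi_nhds.1 hlim.2 ⟨n, hn⟩
  · simpa only [dif_pos (Nat.lt_succ_of_le hn)] using (ha ⟨n, Nat.lt_succ_of_le hn⟩).2

lemma exists_isIncompressibleSol_subseq (H : IsLowMachSequence M γ μ lam δt N Ma ρ u w V₀)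
    (hδt : 0 < δt) (hγ : 0 < γ) (hμ : 0 ≤ μ) (hμlam : 0 ≤ μ + lam) {P₀ : M.CellField}
    (hP : Tendsto (fun m => deltaP γ (Ma m) (ρ m 0)) atTop (𝓝 P₀)) :
    ∃ (v z : ℕ → M.FaceField) (π : ℕ → M.CellField), IsIncompressibleSol μ lam δt N V₀ P₀ v z π ∧
      ∃ φ : ℕ → ℕ, ∀ n ≤ N, Tendsto (fun m => u (φ m) n) atTop (𝓝 (v n)) ∧
        Tendsto (fun m => deltaP γ (Ma (φ m)) (ρ (φ m) n)) atTop (𝓝 (π n)) := by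
  obtain ⟨v, z, π, φ, hφ, hv, hz, hπ⟩ := H.exists_subseq_tendsto hδt hγ hμ hμlam
  have hπ₀ : π 0 = P₀ :=
    tendsto_nhds_unique (hπ 0 N.zero_le) (hP.comp hφ.tendsto_atTop)
  exact ⟨v, z, π, hπ₀ ▸ (H.comp hφ.tendsto_atTop).isIncompressibleSol hδt hγ hμ hμlam hv hz hπ,
    φ, fun n hn => ⟨hv n hn, hπ n hn⟩⟩

theorem exists_tendsto (H : IsLowMachSequence M γ μ lam δt N Ma ρ u w V₀) (hδt : 0 < δt)
    (hγ : 0 < γ) (hμ : 0 ≤ μ) (hμlam : 0 ≤ μ + lam) {P₀ : M.CellField}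
    (hP : Tendsto (fun m => deltaP γ (Ma m) (ρ m 0)) atTop (𝓝 P₀)) :
    ∃ (v z : ℕ → M.FaceField) (π : ℕ → M.CellField), IsIncompressibleSol μ lam δt N V₀ P₀ v z π ∧
      ∀ n ≤ N, Tendsto (fun m => u m n) atTop (𝓝 (v n)) ∧
        Tendsto (fun m => deltaP γ (Ma m) (ρ m n)) atTop (𝓝 (π n)) := by
  obtain ⟨v, z, π, hsol, -⟩ := H.exists_isIncompressibleSol_subseq hδt hγ hμ hμlam hP
  refine ⟨v, z, π, hsol, fun n hn => ?_⟩
  rw [← Prod.tendsto_iff (fun m => (u m n, deltaP γ (Ma m) (ρ m n))) (v n, π n)]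
  refine tendsto_of_subseq_tendsto fun θ hθ => ?_
  obtain ⟨v', z', π', hsol', φ, hlim⟩ :=
    (H.comp hθ).exists_isIncompressibleSol_subseq hδt hγ hμ hμlam (hP.comp hθ)
  obtain ⟨hvelocity, hpressure⟩ := (hsol.unique hδt hμ hμlam H.div_init hsol').1 n hn
  refine ⟨φ, ?_⟩
  rw [Prod.tendsto_iff, ← hvelocity, ← hpressure]
  exact hlim n hn

end IsLowMachSequence

end MACMesh

/-! ### Convergence of the density functions -/

namespace MACMesh

variable {d : ℕ} {M : MACMesh d}

lemma eq_of_mem_cellBox {k l : Fin d → ℤ} (hk : k ∈ M.cells) (hl : l ∈ M.cells)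
    {y : Fin d → ℝ} (hyk : y ∈ M.cellBox k) (hyl : y ∈ M.cellBox l) : k = l := by
  have le_of_mem : ∀ {k l : Fin d → ℤ}, k ∈ M.cells → l ∈ M.cells → y ∈ M.cellBox k →
      y ∈ M.cellBox l → ∀ j, k j ≤ l j := fun {k l} hk hl hyk hyl j => by
    by_contra! hlt
    have hx := M.x_le_x j (a := l j + 1) (b := k j) (by linarith [(mem_cells.1 hl j).1])
      (Int.add_one_le_iff.2 hlt) (mem_cells.1 hk j).2.le
    exact lt_asymm ((hyl j trivial).2.trans_le hx) (hyk j trivial).1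
  exact le_antisymm (le_of_mem hk hl hyk hyl) (le_of_mem hl hk hyl hyk)

lemma cellFun_of_mem (p : M.CellField) {k : M.cells} {y : Fin d → ℝ} (hy : y ∈ M.cellBox k) :
    cellFun p y = p k := by
  rw [cellFun, Finset.sum_eq_single_of_mem k (Finset.mem_univ k) fun l _ hlk =>
    Set.indicator_of_notMem (fun hyl => hlk (Subtype.ext (eq_of_mem_cellBox l.2 k.2 hyl hy))) _,
    Set.indicator_of_mem hy]

lemma exists_mem_Ioo_of_ne (j : Fin d) {t : ℝ} (ht : t ∈ Set.Ioo (M.x j 0) (M.x j (M.n j)))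
    (hne : ∀ a : ℤ, t ≠ M.x j a) :
    ∃ a : ℤ, (0 ≤ a ∧ a < M.n j) ∧ t ∈ Set.Ioo (M.x j a) (M.x j (a + 1)) := by
  have hlayer : ∀ n : ℕ, t < M.x j n →
      ∃ a : ℤ, (0 ≤ a ∧ a < n) ∧ t ∈ Set.Ioo (M.x j a) (M.x j (a + 1)) := by
    intro n hn
    induction n with
    | zero => exact absurd (ht.1.trans hn) (by simp)
    | succ n ih =>
      rcases lt_or_gt_of_ne (hne n) with hbelow | habove
      · obtain ⟨a, ⟨ha, han⟩, hat⟩ := ih hbelow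
        exact ⟨a, ⟨ha, by push_cast; omega⟩, hat⟩
      · exact ⟨n, ⟨by positivity, by push_cast; omega⟩, habove, by simpa using hn⟩
  exact hlayer (M.n j) ht.2

lemma ae_exists_mem_cellBox :
    ∀ᵐ y ∂(volume.restrict M.domain), ∃ k : M.cells, y ∈ M.cellBox k := by
  have hne : ∀ᵐ y : Fin d → ℝ, ∀ j, ∀ a : ℤ, y j ≠ M.x j a :=
    ae_all_iff.2 fun j => ae_all_iff.2 fun a =>
      Measure.ae_eval_ne (fun _ : Fin d => (volume : Measure ℝ)) j (M.x j a)
  refine (ae_restrict_iff' measurableSet_openBox).2 ?_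
  filter_upwards [hne] with y hy hyΩ
  choose a ha hya using fun j => exists_mem_Ioo_of_ne j (hyΩ j trivial) (hy j)
  exact ⟨⟨a, mem_cells.2 ha⟩, fun j _ => hya j⟩

lemma eLpNorm_cellFun_sub_le (p : M.CellField) (c : ℝ) (q : ℝ≥0∞) :
    eLpNorm (fun y => cellFun p y - c) q (volume.restrict M.domain)
      ≤ volume M.domain ^ q.toReal⁻¹ * ENNReal.ofReal (∑ k, |p k - c|) := by
  rw [← Measure.restrict_apply_univ]
  refine eLpNorm_le_of_ae_bound ?_
  filter_upwards [ae_exists_mem_cellBox] with y ⟨k, hk⟩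
  rw [cellFun_of_mem p hk, Real.norm_eq_abs]
  exact Finset.single_le_sum (f := fun k => |p k - c|) (fun k _ => abs_nonneg _)
    (Finset.mem_univ k)

lemma iSup_eLpNorm_densityFun_sub_le (r : ℤ → M.CellField) (c : ℝ) {T δt : ℝ} (hδt : 0 < δt)
    {N : ℕ} (hN : ⌊T / δt⌋₊ ≤ N) (q : ℝ≥0∞) :
    ⨆ t ∈ Set.Icc 0 T, eLpNorm (fun y => densityFun δt r t y - c) q (volume.restrict M.domain)
      ≤ volume M.domain ^ q.toReal⁻¹
        * ENNReal.ofReal (∑ n ∈ Finset.range (N + 1), ∑ k, |r (n : ℕ) k - c|) := by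
  refine iSup₂_le fun t ht => ?_
  have hlevel : ⌊t / δt⌋₊ ∈ Finset.range (N + 1) := by
    refine Finset.mem_range.2 (Nat.lt_succ_of_le (le_trans ?_ hN))
    exact Nat.floor_le_floor (div_le_div_of_nonneg_right ht.2 hδt.le)
  simp only [densityFun, ← Int.natCast_floor_eq_floor (div_nonneg ht.1 hδt.le)]
  refine (eLpNorm_cellFun_sub_le _ c q).trans ?_
  gcongr
  exact Finset.single_le_sum (f := fun n : ℕ => ∑ k, |r n k - c|)
    (fun _ _ => Finset.sum_nonneg fun _ _ => abs_nonneg _) hlevel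

theorem tendsto_densityFun {ι : Type*} {l : Filter ι} {r : ι → ℤ → M.CellField} {c T δt : ℝ}
    (hδt : 0 < δt) {N : ℕ} (hN : ⌊T / δt⌋₊ ≤ N)
    (hr : ∀ n ≤ N, Tendsto (fun m => r m (n : ℕ)) l (𝓝 fun _ => c)) (q : ℝ≥0∞) :
    Tendsto (fun m => ⨆ t ∈ Set.Icc 0 T, eLpNorm (fun y => densityFun δt (r m) t y - c) q
      (volume.restrict M.domain)) l (𝓝 0) := by
  have hfin : volume M.domain ^ q.toReal⁻¹ ≠ (⊤ : ℝ≥0∞) :=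
    ENNReal.rpow_ne_top_of_nonneg (by positivity) volume_openBox_ne_top
  have hsum : Tendsto (fun m => ∑ n ∈ Finset.range (N + 1), ∑ k, |r m (n : ℕ) k - c|) l
      (𝓝 (∑ _n ∈ Finset.range (N + 1), ∑ _k : M.cells, |c - c|)) :=
    tendsto_finsetSum _ fun n hn => tendsto_finsetSum _ fun k _ =>
      ((tendsto_pi_nhds.1 (hr n (Finset.mem_range_succ_iff.1 hn)) k).sub_const c).abs
  have hbound := ENNReal.Tendsto.const_mul (ENNReal.tendsto_ofReal hsum) (Or.inr hfin)
  simp only [sub_self, abs_zero, Finset.sum_const_zero, ENNReal.ofReal_zero, mul_zero] at hbound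
  exact tendsto_of_tendsto_of_tendsto_of_le_of_le tendsto_const_nhds hbound (fun _ => zero_le)
    fun m => iSup_eLpNorm_densityFun_sub_le (r m) c hδt hN q

end MACMesh

/-! ### Well-prepared data -/

lemma tendsto_seminorm_zero {X ι : Type*} [NormedAddCommGroup X] [NormedSpace ℝ X]
    [FiniteDimensional ℝ X] (p : Seminorm ℝ X) {l : Filter ι} {x : ι → X}
    (hx : Tendsto x l (𝓝 0)) : Tendsto (fun m => p (x m)) l (𝓝 0) := by
  have hcont : Continuous p := by
    simpa only [interior_univ, continuousOn_univ] using p.convexOn.continuousOn_interior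
  simpa only [map_zero, Function.comp_def] using (hcont.tendsto 0).comp hx

lemma norm_setAverage_sub_le {α E : Type*} [MeasurableSpace α] {ν : Measure α}
    [NormedAddCommGroup E] [NormedSpace ℝ E] [CompleteSpace E] {f : α → E} (c : E)
    {s Ω : Set α} (hsΩ : s ⊆ Ω) (hs₀ : ν s ≠ 0) (hs : ν s ≠ ⊤)
    (hf : MemLp f ⊤ (ν.restrict Ω)) :
    ‖(⨍ y in s, f y ∂ν) - c‖ ≤ (eLpNorm (fun y => f y - c) ⊤ (ν.restrict Ω)).toReal := by
  have hfc : MemLp (fun y => f y - c) ⊤ (ν.restrict Ω) := hf.sub (memLp_top_const c)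
  have : IsFiniteMeasure (ν.restrict s) := isFiniteMeasure_restrict.2 hs
  rw [← mem_closedBall_iff_norm]
  refine (convex_closedBall c _).set_average_mem Metric.isClosed_closedBall hs₀ hs ?_
    ((hf.mono_measure (Measure.restrict_mono hsΩ le_rfl)).integrable le_top)
  filter_upwards [ae_restrict_of_ae_restrict_of_subset hsΩ (ae_le_lpNorm_exponent_top hfc)]
    with y hy
  rwa [mem_closedBall_iff_norm, toReal_eLpNorm hfc.aestronglyMeasurable]

namespace WellPrepared

variable {d : ℕ} {Ω : Set (Fin d → ℝ)} {Ma C : ℝ} {ρ₀ : (Fin d → ℝ) → ℝ}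
  {u₀ : Fin d → (Fin d → ℝ) → ℝ} {Gu₀ : Fin d → Fin d → (Fin d → ℝ) → ℝ}

lemma l2Norm_grad_le (h : WellPrepared Ω Ma C ρ₀ u₀ Gu₀) (hMa : 0 ≤ Ma) (i j : Fin d) :
    l2Norm Ω (Gu₀ i j) ≤ C := by
  have hdiv : 0 ≤ (1 / Ma) * l2Norm Ω (fun y => ∑ i, Gu₀ i i y) :=
    mul_nonneg (by positivity) (l2Norm_nonneg _ _)
  have hdensity : 0 ≤ (1 / Ma ^ 2)
      * (eLpNorm (fun y => ρ₀ y - 1) ⊤ (volume.restrict Ω)).toReal := by positivity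
  calc l2Norm Ω (Gu₀ i j)
      ≤ h1Norm Ω u₀ Gu₀ := Real.le_sqrt_of_sq_le <| by
        calc l2Norm Ω (Gu₀ i j) ^ 2
            ≤ ∑ j, l2Norm Ω (Gu₀ i j) ^ 2 :=
              Finset.single_le_sum (f := fun j => l2Norm Ω (Gu₀ i j) ^ 2)
                (fun _ _ => sq_nonneg _) (Finset.mem_univ j)
          _ ≤ l2Norm Ω (u₀ i) ^ 2 + ∑ j, l2Norm Ω (Gu₀ i j) ^ 2 :=
              le_add_of_nonneg_left (sq_nonneg _)
          _ ≤ ∑ i, (l2Norm Ω (u₀ i) ^ 2 + ∑ j, l2Norm Ω (Gu₀ i j) ^ 2) :=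
              Finset.single_le_sum
                (f := fun i => l2Norm Ω (u₀ i) ^ 2 + ∑ j, l2Norm Ω (Gu₀ i j) ^ 2)
                (fun _ _ => by positivity) (Finset.mem_univ i)
    _ ≤ C := by linarith [h.bound]

lemma l2Norm_div_le (h : WellPrepared Ω Ma C ρ₀ u₀ Gu₀) (hMa : 0 < Ma) :
    l2Norm Ω (fun y => ∑ i, Gu₀ i i y) ≤ C * Ma := by
  have hvelocity : 0 ≤ h1Norm Ω u₀ Gu₀ := Real.sqrt_nonneg _
  have hdensity : 0 ≤ (1 / Ma ^ 2)
      * (eLpNorm (fun y => ρ₀ y - 1) ⊤ (volume.restrict Ω)).toReal := by positivity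
  rw [mul_comm, ← inv_mul_le_iff₀ hMa, ← one_div]
  linarith [h.bound]

lemma eLpNorm_density_sub_one_le (h : WellPrepared Ω Ma C ρ₀ u₀ Gu₀) (hMa : 0 < Ma) :
    (eLpNorm (fun y => ρ₀ y - 1) ⊤ (volume.restrict Ω)).toReal ≤ C * Ma ^ 2 := by
  have hvelocity : 0 ≤ h1Norm Ω u₀ Gu₀ := Real.sqrt_nonneg _
  have hdiv : 0 ≤ (1 / Ma) * l2Norm Ω (fun y => ∑ i, Gu₀ i i y) :=
    mul_nonneg (by positivity) (l2Norm_nonneg _ _)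
  rw [mul_comm, ← inv_mul_le_iff₀ (pow_pos hMa 2), ← one_div]
  linarith [h.bound]

end WellPrepared

namespace MACMesh

variable {d : ℕ} {M : MACMesh d}

lemma exists_isFaceInterpolate {f : Fin d → (Fin d → ℝ) → ℝ}
    (hf : ∀ i, ∃ g, HasH10Grad M.domain (f i) g) : ∃ U, M.IsFaceInterpolate f U := by
  choose g hg using hf
  exact ⟨fun i k => M.slabMean (f i) (g i i) i k (M.width i k), fun i k =>
    isFaceMean_slabMean (hg i) (mem_cells_of_mem_faces k.2)⟩

lemma tendsto_faceInterpolate {f : ℕ → Fin d → (Fin d → ℝ) → ℝ}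
    {g : ℕ → Fin d → Fin d → (Fin d → ℝ) → ℝ} {f' : Fin d → (Fin d → ℝ) → ℝ}
    (hfg : ∀ m i, HasH10Grad M.domain (f m i) (g m i))
    (hf' : ∀ i, ∃ g', HasH10Grad M.domain (f' i) g') {C : ℝ}
    (hC : ∀ m i, l2Norm M.domain (g m i i) ≤ C)
    (hlim : ∀ i, Tendsto (fun m => eLpNorm (fun y => f m i y - f' i y) 2
      (volume.restrict M.domain)) atTop (𝓝 0))
    {U : ℕ → M.FaceField} {V : M.FaceField} (hU : ∀ m, M.IsFaceInterpolate (f m) (U m))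
    (hV : M.IsFaceInterpolate f' V) : Tendsto U atTop (𝓝 V) := by
  refine tendsto_pi_nhds.2 fun i => tendsto_pi_nhds.2 fun k => ?_
  obtain ⟨g', hg'⟩ := hf' i
  exact tendsto_faceMean (fun m => hfg m i) hg' (fun m => hC m i) (hlim i)
    (mem_cells_of_mem_faces k.2) (fun m => hU m i k) (hV i k)

lemma divVel_eq_zero_of_tendsto_faceInterpolate {ι : Type*} {l : Filter ι} [l.NeBot]
    {f : ι → Fin d → (Fin d → ℝ) → ℝ} {g : ι → Fin d → Fin d → (Fin d → ℝ) → ℝ}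
    (hfg : ∀ m i, HasH10Grad M.domain (f m i) (g m i))
    (hdiv : Tendsto (fun m => l2Norm M.domain fun y => ∑ i, g m i i y) l (𝓝 0))
    {U : ι → M.FaceField} {V : M.FaceField} (hU : ∀ m, M.IsFaceInterpolate (f m) (U m))
    (hlim : Tendsto U l (𝓝 V)) : divVel V = 0 := by
  funext k
  refine tendsto_nhds_unique (tendsto_pi_nhds.1 ((continuous_divVel.tendsto _).comp hlim) k) ?_
  refine squeeze_zero_norm (fun m => abs_divVel_le (hfg m) (hU m) k) ?_
  simpa using (hdiv.const_mul √(M.vol k)).const_mul (1 / M.vol k)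

theorem IsLowMachSequence.of_wellPrepared {γ μ lam δt C : ℝ} {N : ℕ} {Ma : ℕ → ℝ}
    (hMa_pos : ∀ m, 0 < Ma m) (hMa : Tendsto Ma atTop (𝓝 0)) {ρ₀ : ℕ → (Fin d → ℝ) → ℝ}
    {u₀ : ℕ → Fin d → (Fin d → ℝ) → ℝ} {Gu₀ : ℕ → Fin d → Fin d → (Fin d → ℝ) → ℝ}
    (hdata : ∀ m, WellPrepared M.domain (Ma m) C (ρ₀ m) (u₀ m) (Gu₀ m))
    {ubar₀ : Fin d → (Fin d → ℝ) → ℝ} (hubar₀ : ∀ i, ∃ g, HasH10Grad M.domain (ubar₀ i) g)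
    (hconv₀ : ∀ i, Tendsto (fun m => eLpNorm (fun y => u₀ m i y - ubar₀ i y) 2
      (volume.restrict M.domain)) atTop (𝓝 0))
    {V₀ : M.FaceField} (hV₀ : M.IsFaceInterpolate ubar₀ V₀)
    {ρ : ℕ → ℤ → M.CellField} {u w : ℕ → ℕ → M.FaceField}
    (hsol : ∀ m, IsCompressibleSol γ μ lam δt (Ma m) N (ρ₀ m) (u₀ m) (ρ m) (u m) (w m)) :
    IsLowMachSequence M γ μ lam δt N Ma ρ u w V₀ := by
  have hgrad : ∀ m i, HasH10Grad M.domain (u₀ m i) (Gu₀ m i) := fun m => (hdata m).velocity_h10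
  have hinterp : ∀ m, M.IsFaceInterpolate (u₀ m) (u m 0) := fun m => (hsol m).init_velocity
  have hvelocity : Tendsto (fun m => u m 0) atTop (𝓝 V₀) :=
    tendsto_faceInterpolate hgrad hubar₀
      (fun m i => (hdata m).l2Norm_grad_le (hMa_pos m).le i i) hconv₀ hinterp hV₀
  have hdiv : Tendsto (fun m => l2Norm M.domain fun y => ∑ i, Gu₀ m i i y) atTop (𝓝 0) :=
    squeeze_zero (fun _ => l2Norm_nonneg _ _) (fun m => (hdata m).l2Norm_div_le (hMa_pos m))
      (by simpa using hMa.const_mul C)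
  refine ⟨hMa_pos, hMa, ⟨C, fun m k => ?_⟩, hvelocity,
    divVel_eq_zero_of_tendsto_faceInterpolate hgrad hdiv hinterp hvelocity,
    fun m => ⟨_, _, hsol m⟩⟩
  rw [(hsol m).init_density k]
  refine (norm_setAverage_sub_le 1 (cellBox_subset_domain k.2) ?_ (volume_cellBox_ne_top _)
    (hdata m).density_memLp).trans ((hdata m).eLpNorm_density_sub_one_le (hMa_pos m))
  exact (ENNReal.toReal_pos_iff.1 (volume_cellBox k.2 ▸ vol_pos k.2)).1.ne'

end MACMesh

theorem mainTheorem1_general (d : ℕ) (M : MACMesh d)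
    (T δt γ μ lam : ℝ) (hδt : 0 < δt) (hγ : 0 < γ) (hμ : 0 ≤ μ)
    (hμlam : 0 ≤ μ + lam) (N : ℕ) (hN : N = ⌊T / δt⌋₊)
    (Ma : ℕ → ℝ) (hMa_pos : ∀ m, 0 < Ma m) (hMa : Tendsto Ma atTop (𝓝 0))
    (ρ₀ : ℕ → (Fin d → ℝ) → ℝ) (u₀ : ℕ → Fin d → (Fin d → ℝ) → ℝ)
    (Gu₀ : ℕ → Fin d → Fin d → (Fin d → ℝ) → ℝ)
    (hdata : ∃ C : ℝ, ∀ m, WellPrepared M.domain (Ma m) C (ρ₀ m) (u₀ m) (Gu₀ m))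
    (ubar₀ : Fin d → (Fin d → ℝ) → ℝ)
    (hubar₀ : ∀ i, MemLp (ubar₀ i) 2 (volume.restrict M.domain))
    (hconv₀ : ∀ i, Tendsto
      (fun m => eLpNorm (fun y => u₀ m i y - ubar₀ i y) 2 (volume.restrict M.domain))
      atTop (𝓝 0))
    (ρ : ℕ → ℤ → M.CellField) (u : ℕ → ℕ → M.FaceField)
    (hsol : ∀ m, ∃ w : ℕ → M.FaceField,
      MACMesh.IsCompressibleSol γ μ lam δt (Ma m) N (ρ₀ m) (u₀ m) (ρ m) (u m) w) :
    (∀ q : ℝ≥0∞,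
      Tendsto (fun m => ⨆ t ∈ Set.Icc 0 T,
        eLpNorm (fun y => MACMesh.densityFun δt (ρ m) t y - 1) q
          (volume.restrict M.domain)) atTop (𝓝 0)) ∧
    (∀ φ : ℕ → ℕ, StrictMono φ → ∃ ψ : ℕ → ℕ, StrictMono ψ ∧ ∃ P₀ : M.CellField,
      Tendsto (fun m => MACMesh.deltaP γ (Ma (φ (ψ m))) (ρ (φ (ψ m)) 0)) atTop (𝓝 P₀)) ∧
    (∀ i, ∃ g, HasH10Grad M.domain (ubar₀ i) g) ∧
    ∃ V₀ : M.FaceField, MACMesh.IsFaceInterpolate ubar₀ V₀ ∧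
      (∀ k : M.cells, MACMesh.divVel V₀ k = 0) ∧
      ∀ φ : ℕ → ℕ, StrictMono φ → ∀ P₀ : M.CellField,
        Tendsto (fun m => MACMesh.deltaP γ (Ma (φ m)) (ρ (φ m) 0)) atTop (𝓝 P₀) →
        ∃ (v w : ℕ → M.FaceField) (π : ℕ → M.CellField),
          MACMesh.IsIncompressibleSol μ lam δt N V₀ P₀ v w π ∧
          (∀ v' w' π', MACMesh.IsIncompressibleSol μ lam δt N V₀ P₀ v' w' π' →
            (∀ n ≤ N, v' n = v n ∧ π' n = π n) ∧ ∀ n < N, w' (n + 1) = w (n + 1)) ∧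
          ∀ p : Seminorm ℝ (Fin (N + 1) → M.FaceField × M.CellField),
            Tendsto (fun m => p fun n =>
              (u (φ m) n - v n,
                MACMesh.deltaP γ (Ma (φ m)) (ρ (φ m) n) - π n)) atTop (𝓝 0) := by
  obtain ⟨C, hC⟩ := hdata
  choose w hw using hsol
  have hlimit_h10 : ∀ i, ∃ g, HasH10Grad M.domain (ubar₀ i) g := fun i =>
    exists_hasH10Grad_of_tendsto (fun m => (hC m).velocity_h10 i) (hubar₀ i)
      (fun m j => (hC m).l2Norm_grad_le (hMa_pos m).le i j) (hconv₀ i)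
  obtain ⟨V₀, hV₀⟩ := MACMesh.exists_isFaceInterpolate hlimit_h10
  have H := MACMesh.IsLowMachSequence.of_wellPrepared hMa_pos hMa hC hlimit_h10 hconv₀ hV₀ hw
  refine ⟨MACMesh.tendsto_densityFun hδt hN.ge
      fun n hn => H.tendsto_density hδt hγ hμ hμlam hn, fun φ hφ => ?_,
    hlimit_h10, V₀, hV₀, congrFun H.div_init, fun φ hφ P₀ hP => ?_⟩
  · obtain ⟨P₀, ψ, hψ, hlim⟩ := exists_subseq_tendsto_of_isBigO_one
      ((H.comp hφ.tendsto_atTop).isBigO_deltaP hδt hγ hμ hμlam N.zero_le)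
    exact ⟨ψ, hψ, P₀, hlim⟩
  · obtain ⟨v, z, π, hvπ, hlim⟩ :=
      (H.comp hφ.tendsto_atTop).exists_tendsto hδt hγ hμ hμlam hP
    refine ⟨v, z, π, hvπ, fun v' w' π' => hvπ.unique hδt hμ hμlam H.div_init,
      fun p => tendsto_seminorm_zero p (tendsto_pi_nhds.2 fun n => ?_)⟩
    obtain ⟨hvelocity, hpressure⟩ := hlim n (Nat.lt_succ_iff.1 n.2)
    simpa only [sub_self, Pi.zero_apply, Prod.mk_zero_zero] using
      (hvelocity.sub_const (v n)).prodMk_nhds (hpressure.sub_const (π n))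

theorem mainTheorem1 (d : ℕ) (hd : d = 2 ∨ d = 3) (M : MACMesh d)
    (T δt γ μ lam : ℝ) (hT : 0 < T) (hδt : 0 < δt) (hγ : 1 ≤ γ) (hμ : 0 < μ)
    (hμlam : 0 < μ + lam) (N : ℕ) (hN : N = ⌊T / δt⌋₊)
    (Ma : ℕ → ℝ) (hMa_pos : ∀ m, 0 < Ma m) (hMa : Tendsto Ma atTop (𝓝 0))
    -- well-prepared initial data, whose velocities converge in `L²(Ω)^d`
    (ρ₀ : ℕ → (Fin d → ℝ) → ℝ) (u₀ : ℕ → Fin d → (Fin d → ℝ) → ℝ)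
    (Gu₀ : ℕ → Fin d → Fin d → (Fin d → ℝ) → ℝ)
    (hdata : ∃ C : ℝ, ∀ m, WellPrepared M.domain (Ma m) C (ρ₀ m) (u₀ m) (Gu₀ m))
    (ubar₀ : Fin d → (Fin d → ℝ) → ℝ)
    (hubar₀ : ∀ i, MemLp (ubar₀ i) 2 (volume.restrict M.domain))
    (hconv₀ : ∀ i, Tendsto
      (fun m => eLpNorm (fun y => u₀ m i y - ubar₀ i y) 2 (volume.restrict M.domain))
      atTop (𝓝 0))
    -- corresponding solutions of the compressible scheme
    (ρ : ℕ → ℤ → M.CellField) (u : ℕ → ℕ → M.FaceField)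
    (hsol : ∀ m, ∃ w : ℕ → M.FaceField,
      MACMesh.IsCompressibleSol γ μ lam δt (Ma m) N (ρ₀ m) (u₀ m) (ρ m) (u m) w) :
    -- convergence of the density in `L^∞(0,T; L^q(Ω))`
    (∀ q : ℝ, 1 ≤ q → q ≤ min γ 2 →
      Tendsto (fun m => ⨆ t ∈ Set.Icc 0 T,
        eLpNorm (fun y => MACMesh.densityFun δt (ρ m) t y - 1) (ENNReal.ofReal q)
          (volume.restrict M.domain)) atTop (𝓝 0)) ∧
    -- every subsequence has a further subsequence along which the initial `δp⁰` converges
    (∀ φ : ℕ → ℕ, StrictMono φ → ∃ ψ : ℕ → ℕ, StrictMono ψ ∧ ∃ P₀ : M.CellField,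
      Tendsto (fun m => MACMesh.deltaP γ (Ma (φ (ψ m))) (ρ (φ (ψ m)) 0)) atTop (𝓝 P₀)) ∧
    -- the limit initial velocity is in `H¹₀(Ω)^d`, the field of its face averages is discretely
    -- divergence-free, and
    (∀ i, ∃ g, HasH10Grad M.domain (ubar₀ i) g) ∧
    ∃ V₀ : M.FaceField, MACMesh.IsFaceInterpolate ubar₀ V₀ ∧
      (∀ k : M.cells, MACMesh.divVel V₀ k = 0) ∧
      -- whenever the initial `δp⁰` converges, along the whole sequence (`φ = id`) or along
      -- a subsequence, so do `(u, δp)`, to the unique solution of the incompressible scheme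
      ∀ φ : ℕ → ℕ, StrictMono φ → ∀ P₀ : M.CellField,
        Tendsto (fun m => MACMesh.deltaP γ (Ma (φ m)) (ρ (φ m) 0)) atTop (𝓝 P₀) →
        ∃ (v w : ℕ → M.FaceField) (π : ℕ → M.CellField),
          MACMesh.IsIncompressibleSol μ lam δt N V₀ P₀ v w π ∧
          (∀ v' w' π', MACMesh.IsIncompressibleSol μ lam δt N V₀ P₀ v' w' π' →
            (∀ n ≤ N, v' n = v n ∧ π' n = π n) ∧ ∀ n < N, w' (n + 1) = w (n + 1)) ∧
          -- convergence for every norm (even every seminorm) on the space of discrete functions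
          ∀ p : Seminorm ℝ (Fin (N + 1) → M.FaceField × M.CellField),
            Tendsto (fun m => p fun n =>
              (u (φ m) n - v n,
                MACMesh.deltaP γ (Ma (φ m)) (ρ (φ m) n) - π n)) atTop (𝓝 0) := by
  obtain ⟨hdensity, hrest⟩ := mainTheorem1_general d M T δt γ μ lam hδt (zero_lt_one.trans_le hγ)
    hμ.le hμlam.le N hN Ma hMa_pos hMa ρ₀ u₀ Gu₀ hdata ubar₀ hubar₀ hconv₀ ρ u hsol
  exact ⟨fun q _ _ => hdensity (ENNReal.ofReal q), hrest⟩
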